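/- Let $n\ge 1$ and let $q:\mathbb{R}^n\to\mathbb{R}$ be a continuous function, not identically zero, which is a solution of the elliptic Signorini problem $$\Delta q\le 0 \ \text{ and }\ q\,\Delta q=0 \ \text{ in } \mathbb{R}^n,\qquad \Delta q=0 \ \text{ in } \{x_n\neq 0\},\qquad q\ge 0 \ \text{ on } \{x_n=0\}.$$ Here $\Delta q\le 0$ means that $\Delta q=-\mu$ in the sense of distributions for some nonnegative locally finite Borel measure $\mu$ on $\mathbb{R}^n$; then $q\,\Delta q=0$ means that $q=0$ $\mu$-almost everywhere, and $\Delta q=0$ in $\{x_n\ne0\}$ means that $\mu(\{x_n\neq 0\})=0$. Assume that $q$ is $\lambda$-homogeneous for some $\lambda\in\mathbb{R}$, that is, $q(rx)=r^\lambda q(x)$ for all $r>0$ and $x\in\mathbb{R}^n$, and that $q$ is convex in every direction parallel to $\{x_n=0\}$, that is, $t\mapsto q(x+te)$ is convex on $\mathbb{R}$ for every $x\in\mathbb{R}^n$ and every $e\in\mathbb{R}^n$ with $e_n=0$. Then one of the following holds: - $\lambda=3/2$; - $q$ is a harmonic polynomial and $\lambda$ is an integer; - $\lambda=1$ and $q(x)=a\,x_n-b\,|x_n|$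 for some $a\in\mathbb{R}$ and $b>0$. -/

import Mathlib

open MeasureTheory Laplacian

/-- The ambient space `ℝⁿ` with `n = m + 1 ≥ 1`; its last coordinate `x (Fin.last m)` plays the
role of `x_n`, so the thin space `{x_n = 0}` is `{x | x (Fin.last m) = 0}`. -/
abbrev Space (m : ℕ) : Type := EuclideanSpace ℝ (Fin (m + 1))

/-- `q` is homogeneous of degree `lam`: `q (r x) = r ^ lam * q x` for all `r > 0`. -/
def IsHomogeneousOfDegree {m : ℕ} (q : Space m → ℝ) (lam : ℝ) : Prop :=
  ∀ r : ℝ, 0 < r → ∀ x : Space m, q (r • x) = r ^ lam * q x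

/-- `-Δ q = μ` in the sense of distributions on `ℝⁿ`: `∫ q Δφ = - ∫ φ dμ` for every
`φ ∈ C_c^∞(ℝⁿ)`. -/
def HasNegLaplacian {m : ℕ} (q : Space m → ℝ) (μ : Measure (Space m)) : Prop :=
  ∀ φ : Space m → ℝ, ContDiff ℝ (⊤ : ℕ∞) φ → HasCompactSupport φ →
    ∫ x, q x * Δ φ x = - ∫ x, φ x ∂μ

/-- Global solutions of the elliptic Signorini (thin obstacle) problem with zero obstacle on
`{x_n = 0}`. The inequality `Δ q ≤ 0` is understood as measures: `Δ q = -μ` for a (nonnegative)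
locally finite Borel measure `μ`. Accordingly `q Δ q = 0` says that the measure `q μ` vanishes,
and `Δ q = 0` on `{x_n ≠ 0}` says that `μ` gives no mass to `{x_n ≠ 0}`. -/
structure IsSignoriniSolution {m : ℕ} (q : Space m → ℝ) : Prop where
  continuous : Continuous q
  nonneg_on_thin : ∀ x : Space m, x (Fin.last m) = 0 → 0 ≤ q x
  laplacian : ∃ μ : Measure (Space m), IsLocallyFiniteMeasure μ ∧
    HasNegLaplacian q μ ∧
    (∀ᵐ x ∂μ, q x = 0) ∧
    μ {x : Space m | x (Fin.last m) ≠ 0} = 0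

/-- `q` is convex in every direction parallel to `{x_n = 0}`. -/
def IsConvexAlongThin {m : ℕ} (q : Space m → ℝ) : Prop :=
  ∀ x e : Space m, e (Fin.last m) = 0 → ConvexOn ℝ Set.univ (fun t : ℝ => q (x + t • e))

/-- `q` is a harmonic polynomial in `x_1, …, x_n`. -/
def IsHarmonicPolynomial {m : ℕ} (q : Space m → ℝ) : Prop :=
  (∃ P : MvPolynomial (Fin (m + 1)) ℝ, ∀ x : Space m, q x = MvPolynomial.eval (fun i => x i) P) ∧
    InnerProductSpace.HarmonicOnNhd q Set.univ

/-! First derivatives of `q` are compared with the half-harmonic function w = Re √(X + iY), where Y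
= x_n and X is a unit coordinate of the thin space. In the upper half space w is positive, harmonic
and homogeneous of degree 1/2; on x_n = 0 it vanishes for X ≤ 0, and its normal derivative vanishes
for X > 0. If u ≥ 0 is harmonic in the upper half space and homogeneous of degree λ - 1, Green's
identity expresses (λ - 3/2) times a weighted mean of u w by boundary terms on the thin space. If
these have a sign and u does not vanish, λ lies on one side of 3/2.

Reductions. A continuous homogeneous function of negative degree is zero, and one of degree zero is
constant. If the measure μ = -Δq vanishes, Weyl's lemma makes `q` smooth, and Euler's identity then
makes it a polynomial of integral degree (`isHarmonicPolynomial_of_weakHarmonic`). Otherwise `q` is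
replaced by its part even in x_n, which has the same measure, degree and values on the thin space.

Structure. Tangential convexity makes the tangential Laplacian nonnegative, so Δq ≤ 0 forces
concavity in x_n (`concaveOn_normal`). With evenness, q is largest on the thin space and its normal
derivative is nonpositive above it. The contact set is a closed convex cone. If it is the whole thin
space, then q ≤ 0; convex functions on a line that are bounded above are constant, so q depends on
x_n alone and has degree one (`eq_neg_abs_of_contact`).

Otherwise a unit tangential e satisfies e·x ≤ 0 on the contact cone. Lower bound
(`three_halves_le`): take u = -∂_n q and X = -e·x. The trace of u lives on the contact set, where
∂_n w = 0, and formally ∂_n u is the tangential Laplacian of q, which is nonnegative. Upper bound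
(`le_three_halves`): take X = e·x and u the derivative of q along -z, with z in the relative
interior of the cone. The cone spans the thin space, because μ cannot live on a hyperplane of it
(`mem_span_contactSet`); hence convexity gives u ≥ 0. Formally ∂_n u lives on the contact set, where
w = 0, and ∂_n w ≥ 0.

All of this is done weakly, since `q` is only continuous: symmetric difference quotients replace
derivatives, a smoothed folding map yields the equation in the half space, and w is regularized by
shifting X by ±d and Y by d². -/

open Filter Topology Set

/-! ### Test functions and directional derivatives -/

/-- Test functions: smooth functions with compact support. -/
structure IsTest {m : ℕ} (φ : Space m → ℝ) : Prop where
  smooth : ContDiff ℝ (⊤ : ℕ∞) φ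
  compact : HasCompactSupport φ

/-- Derivative of `ψ` in the direction `e`. -/
noncomputable def pd {m : ℕ} (e : Space m) (ψ : Space m → ℝ) : Space m → ℝ :=
  fun x => fderiv ℝ ψ x e

/-- Measurable functions that are bounded on bounded sets. -/
structure LocBdd {m : ℕ} (f : Space m → ℝ) : Prop where
  measurable : Measurable f
  bdd : ∀ R : ℝ, ∃ C : ℝ, ∀ x, ‖x‖ ≤ R → |f x| ≤ C

section Test
variable {m : ℕ}

theorem contDiff_pd {ψ : Space m → ℝ} (h : ContDiff ℝ (⊤ : ℕ∞) ψ) (e : Space m) :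
    ContDiff ℝ (⊤ : ℕ∞) (pd e ψ) := by
  have : ContDiff ℝ (⊤ : ℕ∞) (fderiv ℝ ψ) :=
    h.fderiv_right (by simp)
  exact this.clm_apply contDiff_const

theorem IsTest.pd {φ : Space m → ℝ} (h : IsTest φ) (e : Space m) : IsTest (pd e φ) :=
  ⟨contDiff_pd h.smooth e, h.compact.fderiv_apply (𝕜 := ℝ) e⟩

theorem IsTest.add {φ ψ : Space m → ℝ} (h : IsTest φ) (h' : IsTest ψ) :
    IsTest (fun x => φ x + ψ x) :=
  ⟨h.smooth.add h'.smooth, h.compact.add h'.compact⟩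

theorem IsTest.mul_left {φ g : Space m → ℝ} (h : IsTest φ) (hg : ContDiff ℝ (⊤ : ℕ∞) g) :
    IsTest (fun x => g x * φ x) :=
  ⟨hg.mul h.smooth, h.compact.mul_left⟩

theorem IsTest.sum {ι : Type*} (s : Finset ι) {φ : ι → Space m → ℝ} (h : ∀ i, IsTest (φ i)) :
    IsTest (fun x => ∑ i ∈ s, φ i x) := by
  classical
  induction s using Finset.induction_on with
  | empty =>
    simp only [Finset.sum_empty]
    exact ⟨contDiff_const, HasCompactSupport.zero⟩
  | insert a s ha ih =>
    simp only [Finset.sum_insert ha]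
    exact (h a).add ih

theorem IsTest.continuous {φ : Space m → ℝ} (h : IsTest φ) : Continuous φ := h.smooth.continuous

theorem IsTest.differentiable {φ : Space m → ℝ} (h : IsTest φ) : Differentiable ℝ φ :=
  h.smooth.differentiable (by simp)

theorem IsTest.exists_radius {φ : Space m → ℝ} (h : IsTest φ) :
    ∃ R : ℝ, 0 < R ∧ ∀ x, R < ‖x‖ → φ x = 0 := by
  obtain ⟨R, hR⟩ := h.compact.isCompact.isBounded.subset_closedBall (0 : Space m)
  refine ⟨max R 1, by positivity, fun x hx => ?_⟩
  by_contra hne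
  have := hR (subset_tsupport φ hne)
  rw [mem_closedBall_zero_iff] at this
  exact absurd hx (not_lt.2 (this.trans (le_max_left _ _)))

theorem IsTest.exists_bound {φ : Space m → ℝ} (h : IsTest φ) : ∃ C : ℝ, 0 ≤ C ∧ ∀ x, |φ x| ≤ C := by
  obtain ⟨C, hC⟩ := h.continuous.bounded_above_of_compact_support h.compact
  exact ⟨C, (norm_nonneg _).trans (hC 0), hC⟩

theorem isTest_of_radius {φ : Space m → ℝ} (h : ContDiff ℝ (⊤ : ℕ∞) φ) (R : ℝ)
    (hR : ∀ x, R < ‖x‖ → φ x = 0) : IsTest φ :=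
  ⟨h, HasCompactSupport.intro (isCompact_closedBall (0 : Space m) R) fun x hx => hR x (by
    simpa using hx)⟩

theorem IsTest.comp_translate {φ : Space m → ℝ} (h : IsTest φ) (a : Space m) :
    IsTest (fun x => φ (x - a)) := by
  obtain ⟨R, -, hR⟩ := h.exists_radius
  refine isTest_of_radius (h.smooth.comp (contDiff_id.sub contDiff_const)) (R + ‖a‖) fun x hx => hR _ ?_
  have := norm_sub_norm_le x a
  linarith

theorem pd_translate (φ : Space m → ℝ) (e a : Space m) (x : Space m) :
    pd e (fun x => φ (x - a)) x = pd e φ (x - a) := by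
  simp only [pd]
  rw [fderiv_comp_sub]

theorem pd_comm {ψ : Space m → ℝ} (h : ContDiff ℝ (⊤ : ℕ∞) ψ) (e e' : Space m) :
    pd e (pd e' ψ) = pd e' (pd e ψ) := by
  have h1 : Differentiable ℝ (fderiv ℝ ψ) :=
    (h.fderiv_right (m := 1) (by norm_cast)).differentiable (by simp)
  ext x
  have key : ∀ a b : Space m, pd a (pd b ψ) x = fderiv ℝ (fderiv ℝ ψ) x a b := by
    intro a b
    change fderiv ℝ (fun y => fderiv ℝ ψ y b) x a = _
    rw [fderiv_clm_apply (h1 x) (differentiableAt_const _)]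
    simp
  rw [key, key]
  have hs : IsSymmSndFDerivAt ℝ ψ x :=
    (h.contDiffAt).isSymmSndFDerivAt (by
    simp only [minSmoothness_of_isRCLikeNormedField]
    exact WithTop.coe_le_coe.2 (le_top (a := (2 : ℕ∞))))
  exact hs e e'

theorem pd_add {φ ψ : Space m → ℝ} (e : Space m) (h : Differentiable ℝ φ) (h' : Differentiable ℝ ψ)
    (x : Space m) : pd e (fun x => φ x + ψ x) x = pd e φ x + pd e ψ x := by
  simp only [pd]
  rw [fderiv_fun_add (h x) (h' x)]
  rfl

theorem pd_sum {ι : Type*} (s : Finset ι) {φ : ι → Space m → ℝ} (e : Space m)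
    (h : ∀ i, Differentiable ℝ (φ i)) (x : Space m) :
    pd e (fun x => ∑ i ∈ s, φ i x) x = ∑ i ∈ s, pd e (φ i) x := by
  simp only [pd]
  rw [fderiv_fun_sum fun i _ => h i x]
  simp

theorem pd_mul_at {φ ψ : Space m → ℝ} (e : Space m) {x : Space m} (h : DifferentiableAt ℝ φ x)
    (h' : DifferentiableAt ℝ ψ x) :
    pd e (fun x => φ x * ψ x) x = φ x * pd e ψ x + pd e φ x * ψ x := by
  simp only [pd]
  rw [fderiv_fun_mul h h']
  simp [mul_comm]

theorem pd_mul {φ ψ : Space m → ℝ} (e : Space m) (h : Differentiable ℝ φ) (h' : Differentiable ℝ ψ)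
    (x : Space m) : pd e (fun x => φ x * ψ x) x = φ x * pd e ψ x + pd e φ x * ψ x :=
  pd_mul_at e (h x) (h' x)

theorem hasDerivAt_line {ψ : Space m → ℝ} (h : Differentiable ℝ ψ) (x e : Space m) (t : ℝ) :
    HasDerivAt (fun t : ℝ => ψ (x + t • e)) (pd e ψ (x + t • e)) t := by
  have h1 : HasDerivAt (fun t : ℝ => x + t • e) e t := by
    simpa using ((hasDerivAt_id t).smul_const e).const_add x
  exact (h (x + t • e)).hasFDerivAt.comp_hasDerivAt t h1

end Test

/-! ### Locally bounded functions paired with test functions -/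

section LocBdd
variable {m : ℕ}

theorem LocBdd.of_continuous {f : Space m → ℝ} (h : Continuous f) : LocBdd f := by
  refine ⟨h.measurable, fun R => ?_⟩
  obtain ⟨C, hC⟩ := (isCompact_closedBall (0 : Space m) R).exists_bound_of_continuousOn h.continuousOn
  exact ⟨C, fun x hx => hC x (by simpa using hx)⟩

theorem LocBdd.mul {f g : Space m → ℝ} (hf : LocBdd f) (hg : LocBdd g) :
    LocBdd (fun x => f x * g x) := by
  refine ⟨hf.measurable.mul hg.measurable, fun R => ?_⟩
  obtain ⟨C, hC⟩ := hf.bdd R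
  obtain ⟨D, hD⟩ := hg.bdd R
  refine ⟨C * D, fun x hx => ?_⟩
  rw [abs_mul]
  exact mul_le_mul (hC x hx) (hD x hx) (abs_nonneg _) ((abs_nonneg _).trans (hC x hx))

theorem LocBdd.indicator {f : Space m → ℝ} (hf : LocBdd f) {s : Set (Space m)}
    (hs : MeasurableSet s) : LocBdd (s.indicator f) := by
  refine ⟨hf.measurable.indicator hs, fun R => ?_⟩
  obtain ⟨C, hC⟩ := hf.bdd R
  refine ⟨C, fun x hx => ?_⟩
  by_cases h : x ∈ s
  · simpa [h] using hC x hx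
  · simpa [h] using (abs_nonneg _).trans (hC x hx)

theorem integrable_of_bounded {μ : Measure (Space m)} [IsLocallyFiniteMeasure μ] {f : Space m → ℝ}
    (hf : AEStronglyMeasurable f μ) {C R : ℝ} (hb : ∀ x, ‖x‖ ≤ R → |f x| ≤ C)
    (hs : ∀ x, R < ‖x‖ → f x = 0) : Integrable f μ := by
  have h1 : IntegrableOn (fun _ : Space m => C) (Metric.closedBall 0 R) μ :=
    integrableOn_const ((isCompact_closedBall (0 : Space m) R).measure_lt_top.ne)
  rw [← integrable_indicator_iff Metric.isClosed_closedBall.measurableSet] at h1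
  refine h1.mono' hf (Eventually.of_forall fun x => ?_)
  by_cases h : ‖x‖ ≤ R
  · rw [Set.indicator_of_mem (by simpa using h)]
    exact hb x h
  · rw [Set.indicator_of_notMem (by simpa using h), hs x (not_le.1 h)]
    simp

theorem LocBdd.integrable_mul {f φ : Space m → ℝ} (hf : LocBdd f) (hφ : IsTest φ) :
    Integrable (fun x => f x * φ x) := by
  obtain ⟨R, -, hR⟩ := hφ.exists_radius
  obtain ⟨C, hC⟩ := (hf.mul (LocBdd.of_continuous hφ.continuous)).bdd R
  refine integrable_of_bounded (hf.measurable.mul hφ.continuous.measurable).aestronglyMeasurable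
    hC fun x hx => ?_
  simp [hR x hx]

theorem IsTest.integrable {φ : Space m → ℝ} (hφ : IsTest φ) (μ : Measure (Space m))
    [IsLocallyFiniteMeasure μ] : Integrable φ μ :=
  hφ.continuous.integrable_of_hasCompactSupport hφ.compact

theorem tendsto_integral_of_bounded {ι : Type*} {l : Filter ι} [l.IsCountablyGenerated]
    {μ : Measure (Space m)} [IsLocallyFiniteMeasure μ] {F : ι → Space m → ℝ} {G : Space m → ℝ}
    (C R : ℝ) (hm : ∀ᶠ k in l, AEStronglyMeasurable (F k) μ)
    (hb : ∀ᶠ k in l, ∀ x, ‖x‖ ≤ R → |F k x| ≤ C) (hs : ∀ᶠ k in l, ∀ x, R < ‖x‖ → F k x = 0)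
    (hlim : ∀ᵐ x ∂μ, Tendsto (fun k => F k x) l (𝓝 (G x))) :
    Tendsto (fun k => ∫ x, F k x ∂μ) l (𝓝 (∫ x, G x ∂μ)) := by
  have h1 : IntegrableOn (fun _ : Space m => C) (Metric.closedBall 0 R) μ :=
    integrableOn_const ((isCompact_closedBall (0 : Space m) R).measure_lt_top.ne)
  rw [← integrable_indicator_iff Metric.isClosed_closedBall.measurableSet] at h1
  refine tendsto_integral_filter_of_dominated_convergence _ hm ?_ h1 hlim
  filter_upwards [hb, hs] with k hk hk'
  refine Eventually.of_forall fun x => ?_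
  by_cases h : ‖x‖ ≤ R
  · rw [Set.indicator_of_mem (by simpa using h)]
    exact hk x h
  · rw [Set.indicator_of_notMem (by simpa using h), hk' x (not_le.1 h)]
    simp

theorem hasDerivAt_integral_mul {f : Space m → ℝ} (hf : LocBdd f) {g g' : ℝ → Space m → ℝ}
    {t₀ ε R C : ℝ} (hε : 0 < ε) (hg : ∀ t, Continuous (g t)) (hg' : Continuous (g' t₀))
    (hs : ∀ t ∈ Metric.ball t₀ ε, ∀ y, R < ‖y‖ → g t y = 0)
    (hs' : ∀ t ∈ Metric.ball t₀ ε, ∀ y, R < ‖y‖ → g' t y = 0)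
    (hb : ∀ t ∈ Metric.ball t₀ ε, ∀ y, |g' t y| ≤ C)
    (hd : ∀ t ∈ Metric.ball t₀ ε, ∀ y, HasDerivAt (fun t => g t y) (g' t y) t) :
    HasDerivAt (fun t => ∫ y, f y * g t y) (∫ y, f y * g' t₀ y) t₀ := by
  obtain ⟨D, hD⟩ := hf.bdd R
  have h1 : IntegrableOn (fun _ : Space m => D * C) (Metric.closedBall 0 R) :=
    integrableOn_const ((isCompact_closedBall (0 : Space m) R).measure_lt_top.ne)
  rw [← integrable_indicator_iff Metric.isClosed_closedBall.measurableSet] at h1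
  refine (hasDerivAt_integral_of_dominated_loc_of_deriv_le (Metric.ball_mem_nhds t₀ hε)
    (Eventually.of_forall fun t => (hf.measurable.mul (hg t).measurable).aestronglyMeasurable) ?_
    (hf.measurable.mul hg'.measurable).aestronglyMeasurable
    (Eventually.of_forall fun y t ht => ?_) h1
    (Eventually.of_forall fun y t ht => (hd t ht y).const_mul (f y))).2
  · obtain ⟨D', hD'⟩ := (hf.mul (LocBdd.of_continuous (hg t₀))).bdd R
    refine integrable_of_bounded (hf.measurable.mul (hg t₀).measurable).aestronglyMeasurable hD'
      fun x hx => ?_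
    simp [hs t₀ (Metric.mem_ball_self hε) x hx]
  · by_cases h : ‖y‖ ≤ R
    · rw [Set.indicator_of_mem (by simpa using h), norm_mul]
      exact mul_le_mul (hD y h) (hb t ht y) (abs_nonneg _) ((abs_nonneg _).trans (hD y h))
    · rw [Set.indicator_of_notMem (by simpa using h), hs' t ht y (not_le.1 h)]
      simp

/-- The parameter acts on the smooth factor only, so no regularity of `f` is needed. For `t` near
`t₀` all supports lie in one ball, which gives the dominating function. -/
theorem hasDerivAt_integral_translate {f φ : Space m → ℝ} (hf : LocBdd f) (hφ : IsTest φ)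
    (e : Space m) (t₀ : ℝ) :
    HasDerivAt (fun t : ℝ => ∫ y, f y * φ (y - t • e)) (-∫ y, f y * pd e φ (y - t₀ • e)) t₀ := by
  obtain ⟨R, hR0, hR⟩ := hφ.exists_radius
  obtain ⟨R', hR0', hR'⟩ := (hφ.pd e).exists_radius
  obtain ⟨C, hC0, hC⟩ := (hφ.pd e).exists_bound
  have key : ∀ t ∈ Metric.ball t₀ 1, ∀ y : Space m,
      max R R' + (|t₀| + 1) * ‖e‖ < ‖y‖ → max R R' < ‖y - t • e‖ := by
    intro t ht y hy
    have h1 : |t| ≤ |t₀| + 1 := by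
      rw [Metric.mem_ball, Real.dist_eq] at ht
      have := abs_sub_abs_le_abs_sub t t₀
      linarith
    have h2 : ‖t • e‖ ≤ (|t₀| + 1) * ‖e‖ := by
      rw [norm_smul]
      exact mul_le_mul_of_nonneg_right h1 (norm_nonneg _)
    have := norm_sub_norm_le y (t • e)
    linarith
  have h := hasDerivAt_integral_mul hf (g := fun t y => φ (y - t • e))
    (g' := fun t y => -pd e φ (y - t • e)) (t₀ := t₀) (ε := 1)
    (R := max R R' + (|t₀| + 1) * ‖e‖) (C := C) one_pos
    (fun t => hφ.continuous.comp (by fun_prop)) ((hφ.pd e).continuous.comp (by fun_prop)).neg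
    (fun t ht y hy => hR _ ((le_max_left _ _).trans_lt (key t ht y hy)))
    (fun t ht y hy => by
      simp only [neg_eq_zero]
      exact hR' _ ((le_max_right _ _).trans_lt (key t ht y hy)))
    (fun t _ y => by
      rw [abs_neg]
      exact hC _)
    (fun t _ y => by
      have := hasDerivAt_line hφ.differentiable y (-e) t
      simp only [smul_neg, ← sub_eq_add_neg] at this
      convert this using 1
      simp [_root_.pd])
  simpa only [mul_neg, integral_neg] using h

theorem integral_mul_translate (f φ : Space m → ℝ) (a : Space m) :
    ∫ y, f y * φ (y - a) = ∫ y, f (y + a) * φ y := by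
  rw [← integral_add_right_eq_self (fun y => f y * φ (y - a)) a]
  simp

theorem tendsto_symm_slope {F : ℝ → ℝ} {F' : ℝ} (h : HasDerivAt F F' 0) :
    Tendsto (fun s : ℝ => (F s - F (-s)) / (2 * s)) (𝓝[>] 0) (𝓝 F') := by
  have h1 := hasDerivAt_iff_tendsto_slope_zero.1 h
  simp only [zero_add, smul_eq_mul] at h1
  have hr : Tendsto (fun s : ℝ => s) (𝓝[>] 0) (𝓝[≠] 0) :=
    tendsto_id.mono_left (nhdsWithin_mono _ fun x hx => ne_of_gt hx)
  have hl : Tendsto (fun s : ℝ => -s) (𝓝[>] 0) (𝓝[≠] 0) := by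
    refine tendsto_nhdsWithin_iff.2 ⟨?_, ?_⟩
    · have : Tendsto (fun s : ℝ => -s) (𝓝 0) (𝓝 (-0)) := tendsto_id.neg
      rw [neg_zero] at this
      exact this.mono_left nhdsWithin_le_nhds
    · filter_upwards [self_mem_nhdsWithin] with s hs
      simpa using ne_of_gt hs
  have h2 := ((h1.comp hr).add (h1.comp hl)).div_const 2
  rw [add_self_div_two] at h2
  refine h2.congr' ?_
  filter_upwards [self_mem_nhdsWithin] with s hs
  have : s ≠ 0 := ne_of_gt hs
  simp only [Function.comp]
  field_simp
  ring

/-- If the symmetric difference quotients of `f` in the direction `e` are locally bounded and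
converge to `D`, then `D` is the distributional derivative of `f`. -/
theorem integral_symmDeriv_mul {f D φ : Space m → ℝ} (hf : LocBdd f) (hφ : IsTest φ) (e : Space m)
    (hlim : ∀ x, Tendsto (fun s : ℝ => (f (x + s • e) - f (x - s • e)) / (2 * s)) (𝓝[>] 0) (𝓝 (D x)))
    (hb : ∀ R : ℝ, ∃ C : ℝ, ∀ x, ‖x‖ ≤ R → ∀ s ∈ Ioc (0 : ℝ) 1,
      |(f (x + s • e) - f (x - s • e)) / (2 * s)| ≤ C) :
    ∫ x, D x * φ x = -∫ x, f x * pd e φ x := by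
  obtain ⟨R, hR0, hR⟩ := hφ.exists_radius
  obtain ⟨C, hC⟩ := hb R
  obtain ⟨B, hB0, hB⟩ := hφ.exists_bound
  have h1 : Tendsto (fun s : ℝ => ∫ x, (f (x + s • e) - f (x - s • e)) / (2 * s) * φ x) (𝓝[>] 0)
      (𝓝 (∫ x, D x * φ x)) := by
    refine tendsto_integral_of_bounded (C * B) R ?_ ?_ ?_ ?_
    · refine Eventually.of_forall fun s => Measurable.aestronglyMeasurable ?_
      have h1 := hf.measurable.comp (measurable_add_const (s • e))
      have h2 := hf.measurable.comp (measurable_sub_const (s • e))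
      exact ((h1.sub h2).div_const _).mul hφ.continuous.measurable
    · filter_upwards [Ioc_mem_nhdsGT (zero_lt_one' ℝ)] with s hs x hx
      rw [abs_mul]
      exact mul_le_mul (hC x hx s hs) (hB x) (abs_nonneg _) ((abs_nonneg _).trans (hC x hx s hs))
    · exact Eventually.of_forall fun s x hx => by simp [hR x hx]
    · exact Eventually.of_forall fun x => (hlim x).mul_const _
  -- Discrete integration by parts: translating the variable moves the difference quotient from `f`
  -- to `φ`, so both limits are limits of the same integrals.
  have h2 := tendsto_symm_slope (hasDerivAt_integral_translate hf hφ e 0)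
  simp only [zero_smul, sub_zero] at h2
  refine tendsto_nhds_unique h1 (h2.congr fun s => ?_)
  rw [integral_mul_translate, integral_mul_translate]
  have i1 : Integrable (fun y => f (y + s • e) * φ y) := by
    have := (hf.integrable_mul (hφ.comp_translate (s • e))).comp_add_right (s • e)
    simpa using this
  have i2 : Integrable (fun y => f (y + (-s) • e) * φ y) := by
    have := (hf.integrable_mul (hφ.comp_translate ((-s) • e))).comp_add_right ((-s) • e)
    simpa using this
  rw [← integral_sub i1 i2, ← integral_div]
  refine integral_congr_ae (Eventually.of_forall fun x => ?_)
  simp only [neg_smul, ← sub_eq_add_neg]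
  ring

theorem integral_pd_eq_zero {f φ : Space m → ℝ} (hf : LocBdd f) (hφ : IsTest φ) (e : Space m)
    (h : ∀ x (s : ℝ), f (x + s • e) = f x) : ∫ x, f x * pd e φ x = 0 := by
  have := integral_symmDeriv_mul (D := fun _ => 0) hf hφ e (fun x => ?_) fun R => ⟨0, fun x _ s _ => ?_⟩
  · simpa using this
  · have h' : ∀ s : ℝ, f (x - s • e) = f x := fun s => by
      simpa [sub_eq_add_neg] using h x (-s)
    simp [h, h']
  · have h' : f (x - s • e) = f x := by
      simpa [sub_eq_add_neg] using h x (-s)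
    simp [h, h']

/-- Distributional convexity along a line. -/
theorem integral_pd_pd_nonneg {f φ : Space m → ℝ} (hf : LocBdd f) (hφ : IsTest φ)
    (h0 : ∀ x, 0 ≤ φ x) (e : Space m)
    (h : ∀ x (s : ℝ), 2 * f x ≤ f (x + s • e) + f (x - s • e)) :
    0 ≤ ∫ x, f x * pd e (pd e φ) x := by
  set G : ℝ → ℝ := fun t => ∫ y, f y * φ (y - t • e) with hG
  have hd : ∀ t, HasDerivAt G (-∫ y, f y * pd e φ (y - t • e)) t :=
    fun t => hasDerivAt_integral_translate hf hφ e t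
  have hd2 : HasDerivAt (fun t : ℝ => -∫ y, f y * pd e φ (y - t • e))
      (∫ y, f y * pd e (pd e φ) y) 0 := by
    have := (hasDerivAt_integral_translate hf (hφ.pd e) e 0).fun_neg
    simpa using this
  by_contra hneg
  push Not at hneg
  have hpos : ∀ t, 2 * G 0 ≤ G t + G (-t) := by
    intro t
    have i1 : ∀ t : ℝ, Integrable (fun y => f (y + t • e) * φ y) := fun t => by
      have := (hf.integrable_mul (hφ.comp_translate (t • e))).comp_add_right (t • e)
      simpa using this
    simp only [hG]
    rw [integral_mul_translate, integral_mul_translate, integral_mul_translate,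
      ← integral_add (i1 t) (i1 (-t)), ← integral_const_mul]
    refine integral_mono ((i1 0).const_mul 2) ((i1 t).add (i1 (-t))) fun y => ?_
    have := mul_le_mul_of_nonneg_right (h y t) (h0 y)
    simp only [zero_smul, add_zero, neg_smul, ← sub_eq_add_neg]
    linarith
  -- Midpoint convexity only compares `G t + G (-t)` with `2 * G 0`. The symmetrized function has a
  -- minimum at 0, and its second derivative there is twice the integral in question.
  set g : ℝ → ℝ := fun t => G t + G (-t) with hg
  have hgd : ∀ t, HasDerivAt g ((-∫ y, f y * pd e φ (y - t • e)) -
      (-∫ y, f y * pd e φ (y - (-t) • e))) t := by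
    intro t
    have := (hd (-t)).comp t (hasDerivAt_neg t)
    refine ((hd t).fun_add this).congr_deriv ?_
    ring
  have hgd2 : HasDerivAt (fun t : ℝ => (-∫ y, f y * pd e φ (y - t • e)) -
      (-∫ y, f y * pd e φ (y - (-t) • e))) (2 * ∫ y, f y * pd e (pd e φ) y) 0 := by
    have h1 : HasDerivAt (fun t : ℝ => -∫ y, f y * pd e φ (y - t • e))
      (∫ y, f y * pd e (pd e φ) y) (-0) := by simpa using hd2
    have := h1.comp (0 : ℝ) (hasDerivAt_neg 0)
    refine (hd2.fun_sub this).congr_deriv ?_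
    ring
  have hdg : deriv g = fun t : ℝ => (-∫ y, f y * pd e φ (y - t • e)) -
      (-∫ y, f y * pd e φ (y - (-t) • e)) := funext fun t => (hgd t).deriv
  have hmin : IsLocalMin g 0 := Eventually.of_forall fun t => by
    have := hpos t
    simp only [hg, neg_zero]
    linarith
  have hlt : deriv (deriv g) 0 < 0 := by
    rw [hdg, hgd2.deriv]
    linarith
  have hmax := isLocalMax_of_deriv_deriv_neg hlt (by
    rw [hdg]
    simp) (hgd 0).continuousAt
  -- a function with a local minimum and maximum at a point is locally constant there
  have hev : g =ᶠ[𝓝 0] fun _ => g 0 := by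
    filter_upwards [hmin, hmax] with t h1 h2 using le_antisymm h2 h1
  have h3 : deriv g =ᶠ[𝓝 0] fun _ => 0 := by
    filter_upwards [hev.eventuallyEq_nhds] with t ht
    rw [ht.deriv_eq]
    simp
  rw [h3.deriv_eq] at hlt
  simp at hlt

theorem nonneg_of_forall_test {g : Space m → ℝ} (hg : Continuous g)
    (h : ∀ φ : Space m → ℝ, IsTest φ → (∀ x, 0 ≤ φ x) → 0 ≤ ∫ x, g x * φ x) (x₀ : Space m) :
    0 ≤ g x₀ := by
  by_contra hneg
  push Not at hneg
  obtain ⟨ε, hε, hball⟩ := Metric.mem_nhds_iff.1 ((hg.tendsto x₀).eventually (gt_mem_nhds hneg))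
  let b : ContDiffBump x₀ := ⟨ε / 4, ε / 2, by positivity, by linarith⟩
  have hb : IsTest (b : Space m → ℝ) := ⟨b.contDiff, b.hasCompactSupport⟩
  have h1 := h b hb fun x => b.nonneg
  have hle : ∀ x, g x * b x ≤ 0 := by
    intro x
    by_cases hx : x ∈ Metric.ball x₀ ε
    · exact mul_nonpos_of_nonpos_of_nonneg (le_of_lt (hball hx)) b.nonneg
    · rw [b.zero_of_le_dist, mul_zero]
      simp only [Metric.mem_ball, not_lt] at hx
      change ε / 2 ≤ _
      linarith
  have h2 : ∫ x, g x * b x = 0 := le_antisymm (integral_nonpos hle) h1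
  have h3 : ∫ x, -(g x * b x) = 0 := by rw [integral_neg, h2, neg_zero]
  have hc : Continuous fun x => -(g x * b x) := (hg.mul b.continuous).neg
  rw [integral_eq_zero_iff_of_nonneg (fun x => by simpa using hle x)
    ((LocBdd.of_continuous hg).integrable_mul hb).fun_neg, hc.ae_eq_iff_eq _ continuous_zero] at h3
  have h4 := congrFun h3 x₀
  have h5 : b x₀ = 1 := b.one_of_mem_closedBall (by simp [b.rIn_pos.le])
  simp [h5] at h4
  linarith

end LocBdd

/-! ### Coordinates, the Laplacian and reflection in the thin space -/

/-- The standard basis vectors of `Space m`. -/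
noncomputable def bv {m : ℕ} (i : Fin (m + 1)) : Space m := EuclideanSpace.single i 1

/-- The unit normal of the thin space. -/
noncomputable def en {m : ℕ} : Space m := bv (Fin.last m)

/-- The Laplacian in the directions of the thin space. -/
noncomputable def tl {m : ℕ} (ψ : Space m → ℝ) : Space m → ℝ :=
  fun x => ∑ i : Fin m, pd (bv i.castSucc) (pd (bv i.castSucc) ψ) x

/-- The upper half space. -/
def upperHalf (m : ℕ) : Set (Space m) := {x | 0 < x (Fin.last m)}

section Geometry
variable {m : ℕ}

theorem bv_apply (i j : Fin (m + 1)) : (bv i : Space m) j = if j = i then 1 else 0 := by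
  simp [bv]

theorem bv_castSucc_last (i : Fin m) : (bv i.castSucc : Space m) (Fin.last m) = 0 := by
  rw [bv_apply, if_neg (Fin.castSucc_lt_last i).ne']

@[simp] theorem en_last : (en : Space m) (Fin.last m) = 1 := by
  simp [en, bv_apply]

theorem inner_bv (x : Space m) (i : Fin (m + 1)) : inner ℝ (bv i) x = x i := by
  simp [bv, EuclideanSpace.inner_single_left]

theorem sum_smul_bv (x : Space m) : ∑ i, x i • bv i = x := by
  ext j
  simp [bv_apply]

theorem pd_pd_eq {ψ : Space m → ℝ} (h : ContDiff ℝ 2 ψ) (a b : Space m) (x : Space m) :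
    pd a (pd b ψ) x = fderiv ℝ (fderiv ℝ ψ) x a b := by
  have h1 : Differentiable ℝ (fderiv ℝ ψ) :=
    (h.fderiv_right (m := 1) (by norm_num)).differentiable (by simp)
  change fderiv ℝ (fun y => fderiv ℝ ψ y b) x a = _
  rw [fderiv_clm_apply (h1 x) (differentiableAt_const _)]
  simp

theorem laplacian_eq_sum_pd {ψ : Space m → ℝ} (h : ContDiff ℝ 2 ψ) (x : Space m) :
    Δ ψ x = ∑ i, pd (bv i) (pd (bv i) ψ) x := by
  rw [InnerProductSpace.laplacian_eq_iteratedFDeriv_orthonormalBasis ψ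
    (EuclideanSpace.basisFun (Fin (m + 1)) ℝ)]
  refine Finset.sum_congr rfl fun i _ => ?_
  rw [iteratedFDeriv_two_apply, pd_pd_eq h]
  simp [bv]

theorem ContDiff.two {ψ : Space m → ℝ} (h : ContDiff ℝ (⊤ : ℕ∞) ψ) : ContDiff ℝ 2 ψ :=
  h.of_le (WithTop.coe_le_coe.2 (le_top (a := (2 : ℕ∞))))

theorem laplacian_eq_tl_add {ψ : Space m → ℝ} (h : ContDiff ℝ (⊤ : ℕ∞) ψ) (x : Space m) :
    Δ ψ x = tl ψ x + pd en (pd en ψ) x := by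
  rw [laplacian_eq_sum_pd h.two, Fin.sum_univ_castSucc]
  rfl

theorem IsTest.tl {φ : Space m → ℝ} (h : IsTest φ) : IsTest (tl φ) :=
  IsTest.sum _ fun _ => (h.pd _).pd _

theorem IsTest.laplacian {φ : Space m → ℝ} (h : IsTest φ) : IsTest (Δ φ) := by
  have : Δ φ = fun x => ∑ i, _root_.pd (bv i) (_root_.pd (bv i) φ) x :=
    funext (laplacian_eq_sum_pd h.smooth.two)
  rw [this]
  exact IsTest.sum _ fun _ => (h.pd _).pd _

theorem pd_tl {φ : Space m → ℝ} (h : ContDiff ℝ (⊤ : ℕ∞) φ) (e : Space m) :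
    pd e (tl φ) = tl (pd e φ) := by
  ext x
  have hd : ∀ i : Fin m, Differentiable ℝ (pd (bv i.castSucc) (pd (bv i.castSucc) φ)) := fun i =>
    (contDiff_pd (contDiff_pd h _) _).differentiable (by simp)
  unfold tl
  rw [pd_sum _ _ hd]
  refine Finset.sum_congr rfl fun i _ => ?_
  rw [pd_comm (contDiff_pd h _), pd_comm h]

theorem isOpen_upperHalf : IsOpen (upperHalf m) :=
  isOpen_lt continuous_const (EuclideanSpace.proj (Fin.last m)).continuous

theorem measurableSet_upperHalf : MeasurableSet (upperHalf m) := isOpen_upperHalf.measurableSet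

theorem volume_thin : volume {x : Space m | x (Fin.last m) = 0} = 0 := by
  have h := Measure.addHaar_submodule (volume : Measure (Space m))
    (LinearMap.ker (EuclideanSpace.proj (Fin.last m) : Space m →L[ℝ] ℝ).toLinearMap) (by
      intro h
      have : (en : Space m) ∈ LinearMap.ker
        (EuclideanSpace.proj (Fin.last m) : Space m →L[ℝ] ℝ).toLinearMap := by rw [h]; trivial
      simp at this)
  refine measure_mono_null (fun x hx => ?_) h
  simpa using hx

theorem volume_inner_eq_zero {e : Space m} (he : e ≠ 0) :
    volume {x : Space m | inner ℝ e x = 0} = 0 := by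
  have h := Measure.addHaar_submodule (volume : Measure (Space m))
    (LinearMap.ker (innerSL ℝ e).toLinearMap) (by
      intro h
      have : e ∈ LinearMap.ker (innerSL ℝ e).toLinearMap := by rw [h]; trivial
      simp [he] at this)
  refine measure_mono_null (fun x hx => ?_) h
  simpa using hx

/-- Reflection in the thin space. -/
noncomputable def mirror : Space m ≃ₗᵢ[ℝ] Space m := (ℝ ∙ (en : Space m))ᗮ.reflection

theorem norm_en : ‖(en : Space m)‖ = 1 := by simp [en, bv]

theorem mirror_eq (x : Space m) : mirror x = x - (2 * x (Fin.last m)) • en := by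
  rw [mirror, Submodule.reflection_orthogonal_apply, Submodule.reflection_singleton_apply, norm_en,
    en, inner_bv]
  simp [mul_smul, two_smul]

theorem mirror_last (x : Space m) : (mirror x) (Fin.last m) = -x (Fin.last m) := by
  rw [mirror_eq]
  simp
  ring

theorem mirror_mirror (x : Space m) : mirror (mirror x) = x := Submodule.reflection_reflection _ x

theorem mirror_of_thin {x : Space m} (h : x (Fin.last m) = 0) : mirror x = x := by
  simp [mirror_eq, h]

theorem mirror_add_smul {e : Space m} (he : e (Fin.last m) = 0) (x : Space m) (t : ℝ) :
    mirror (x + t • e) = mirror x + t • e := by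
  rw [map_add, map_smul, mirror_of_thin he]

theorem mirror_en : mirror (en : Space m) = -en := by
  rw [mirror_eq]
  simp [two_smul]

theorem measurePreserving_mirror : MeasurePreserving (mirror : Space m → Space m) :=
  (mirror : Space m ≃ₗᵢ[ℝ] Space m).measurePreserving

theorem integral_mirror (f : Space m → ℝ) : ∫ x, f (mirror x) = ∫ x, f x :=
  measurePreserving_mirror.integral_comp
    (mirror : Space m ≃ₗᵢ[ℝ] Space m).toHomeomorph.measurableEmbedding f

/-- The integral of an even function is twice its integral over the upper half space. -/
theorem integral_eq_two_mul_upperHalf {f : Space m → ℝ} (hf : Integrable f)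
    (heven : ∀ x, f (mirror x) = f x) : ∫ x, f x = 2 * ∫ x in upperHalf m, f x := by
  have h1 := integral_add_compl (measurableSet_upperHalf (m := m)) hf
  have h2 : ∫ x in (upperHalf m)ᶜ, f x = ∫ x in upperHalf m, f x := by
    have h3 : ∫ x in (upperHalf m)ᶜ, f x = ∫ x in mirror ⁻¹' (upperHalf m), f x := by
      refine setIntegral_congr_set ?_
      have : ∀ᵐ x : Space m, x (Fin.last m) ≠ 0 := by
        rw [ae_iff]
        simpa using volume_thin
      filter_upwards [this] with x hx
      refine propext ⟨fun h => ?_, fun h => ?_⟩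
      · have h' : ¬ 0 < x (Fin.last m) := h
        change 0 < (mirror x) (Fin.last m)
        rw [mirror_last]
        have := lt_of_le_of_ne (not_lt.1 h') hx
        linarith
      · have h' : 0 < (mirror x) (Fin.last m) := h
        rw [mirror_last] at h'
        change ¬ 0 < x (Fin.last m)
        linarith
    have h4 := measurePreserving_mirror.setIntegral_preimage_emb
      (mirror : Space m ≃ₗᵢ[ℝ] Space m).toHomeomorph.measurableEmbedding f (upperHalf m)
    simp only [heven] at h4
    rw [h3, h4]
  rw [← h1, h2]
  ring

end Geometry

/-! ### Symmetric derivatives of convex and concave functions -/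

/-- `D` is the limit of the symmetric difference quotients of `f` in the direction `e`, and these
are locally bounded. -/
structure IsSymmDeriv {m : ℕ} (e : Space m) (f D : Space m → ℝ) : Prop where
  locBdd : LocBdd D
  lim : ∀ x, Tendsto (fun s : ℝ => (f (x + s • e) - f (x - s • e)) / (2 * s)) (𝓝[>] 0) (𝓝 (D x))
  bdd : ∀ R : ℝ, ∃ C : ℝ, ∀ x, ‖x‖ ≤ R → ∀ s ∈ Ioc (0 : ℝ) 1,
      |(f (x + s • e) - f (x - s • e)) / (2 * s)| ≤ C

section SymmDeriv
variable {m : ℕ}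

theorem IsSymmDeriv.integral_mul {e : Space m} {f D φ : Space m → ℝ} (h : IsSymmDeriv e f D)
    (hf : LocBdd f) (hφ : IsTest φ) : ∫ x, D x * φ x = -∫ x, f x * pd e φ x :=
  integral_symmDeriv_mul hf hφ e h.lim h.bdd

theorem IsSymmDeriv.neg {e : Space m} {f D : Space m → ℝ} (h : IsSymmDeriv e f D) :
    IsSymmDeriv e (fun x => -f x) (fun x => -D x) := by
  have key : ∀ x (s : ℝ), (-f (x + s • e) - -f (x - s • e)) / (2 * s) =
      -((f (x + s • e) - f (x - s • e)) / (2 * s)) := fun x s => by ring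
  refine ⟨⟨h.locBdd.measurable.neg, fun R => ?_⟩, fun x => ?_, fun R => ?_⟩
  · simpa using h.locBdd.bdd R
  · simp only [key]
    exact (h.lim x).neg
  · simpa only [key, abs_neg] using h.bdd R

/-- The symmetric quotient is the average of the slopes over `[-s, 0]` and `[0, s]`, and slopes of a
convex function increase. These bounds dominate the quotients uniformly in `s`. -/
theorem convex_symm_slope_bounds {g : ℝ → ℝ} (hg : ConvexOn ℝ univ g) {s : ℝ} (hs : s ∈ Ioc (0 : ℝ) 1) :
    g 0 - g (-1) ≤ (g s - g (-s)) / (2 * s) ∧ (g s - g (-s)) / (2 * s) ≤ g 1 - g 0 := by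
  obtain ⟨h0, h1⟩ := hs
  have a := hg.2 (mem_univ 0) (mem_univ 1) (sub_nonneg.2 h1) h0.le (by ring)
  have b := hg.2 (mem_univ 0) (mem_univ (-1)) (sub_nonneg.2 h1) h0.le (by ring)
  have c := hg.2 (mem_univ s) (mem_univ (-s)) (by norm_num : (0 : ℝ) ≤ 1 / 2)
    (by norm_num : (0 : ℝ) ≤ 1 / 2) (by norm_num)
  simp only [smul_eq_mul, mul_zero, mul_one, zero_add, mul_neg] at a b c
  rw [show 1 / 2 * s + -(1 / 2 * s) = 0 by ring] at c
  rw [le_div_iff₀ (by positivity), div_le_iff₀ (by positivity)]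
  constructor <;> nlinarith

/-- The limit is the mean of the left and right derivatives, so it exists at every point, corners
included. Working with symmetric quotients thus avoids exceptional null sets. -/
theorem convex_tendsto_symm_slope {g : ℝ → ℝ} (hg : ConvexOn ℝ univ g) :
    ∃ d, Tendsto (fun s : ℝ => (g s - g (-s)) / (2 * s)) (𝓝[>] 0) (𝓝 d) := by
  have hr := hg.hasDerivWithinAt_rightDeriv_of_mem_interior (x := 0) (by simp)
  have hl := hg.hasDerivWithinAt_leftDeriv_of_mem_interior (x := 0) (by simp)
  rw [hasDerivWithinAt_iff_tendsto_slope' (by simp)] at hr hl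
  have hneg : Tendsto (fun s : ℝ => -s) (𝓝[>] 0) (𝓝[<] 0) := by
    have := tendsto_neg_nhdsGT (a := (0 : ℝ))
    rwa [neg_zero] at this
  have h2 := (hr.add (hl.comp hneg)).div_const 2
  refine ⟨_, h2.congr' ?_⟩
  filter_upwards [self_mem_nhdsWithin] with s hs
  have : s ≠ 0 := ne_of_gt hs
  simp only [Function.comp, slope_def_field, sub_zero]
  field_simp
  ring

theorem exists_symmDeriv_of_convex {f : Space m → ℝ} (hf : Continuous f) (e : Space m)
    (hc : ∀ x, ConvexOn ℝ univ (fun t : ℝ => f (x + t • e))) :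
    ∃ D, IsSymmDeriv e f D ∧ ∀ x, f x - f (x - e) ≤ D x := by
  have hlim : ∀ x, ∃ d, Tendsto (fun s : ℝ => (f (x + s • e) - f (x - s • e)) / (2 * s)) (𝓝[>] 0)
      (𝓝 d) := by
    intro x
    obtain ⟨d, hd⟩ := convex_tendsto_symm_slope (hc x)
    refine ⟨d, ?_⟩
    simpa only [neg_smul, ← sub_eq_add_neg] using hd
  have hbd : ∀ x, ∀ s ∈ Ioc (0 : ℝ) 1, f x - f (x - e) ≤ (f (x + s • e) - f (x - s • e)) / (2 * s) ∧
      (f (x + s • e) - f (x - s • e)) / (2 * s) ≤ f (x + e) - f x := by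
    intro x s hs
    have := convex_symm_slope_bounds (hc x) hs
    simpa only [neg_smul, ← sub_eq_add_neg, zero_smul, add_zero, one_smul] using this
  choose D hD using hlim
  have hev : ∀ᶠ s in 𝓝[>] (0 : ℝ), s ∈ Ioc (0 : ℝ) 1 := Ioc_mem_nhdsGT one_pos
  have hDl : ∀ x, f x - f (x - e) ≤ D x := fun x =>
    ge_of_tendsto (hD x) (hev.mono fun s hs => (hbd x s hs).1)
  have hDu : ∀ x, D x ≤ f (x + e) - f x := fun x =>
    le_of_tendsto (hD x) (hev.mono fun s hs => (hbd x s hs).2)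
  have l1 : LocBdd (fun x => f x - f (x - e)) := LocBdd.of_continuous (by fun_prop)
  have l2 : LocBdd (fun x => f (x + e) - f x) := LocBdd.of_continuous (by fun_prop)
  refine ⟨D, ⟨⟨?_, fun R => ?_⟩, hD, fun R => ?_⟩, hDl⟩
  · have hseq : Tendsto (fun n : ℕ => 1 / ((n : ℝ) + 1)) atTop (𝓝[>] 0) := by
      refine tendsto_nhdsWithin_iff.2 ⟨tendsto_one_div_add_atTop_nhds_zero_nat, ?_⟩
      exact Eventually.of_forall fun n => by
        simp only [mem_Ioi]
        positivity
    refine measurable_of_tendsto_metrizable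
      (f := fun (n : ℕ) x => (f (x + (1 / ((n : ℝ) + 1)) • e) - f (x - (1 / ((n : ℝ) + 1)) • e)) /
        (2 * (1 / ((n : ℝ) + 1)))) (fun n => ?_) (tendsto_pi_nhds.2 fun x => (hD x).comp hseq)
    exact Continuous.measurable (by fun_prop)
  · obtain ⟨C, hC⟩ := l1.bdd R
    obtain ⟨C', hC'⟩ := l2.bdd R
    refine ⟨max C C', fun x hx => abs_le.2 ⟨?_, ?_⟩⟩
    · have := (abs_le.1 (hC x hx)).1
      linarith [hDl x, le_max_left C C']
    · have := (abs_le.1 (hC' x hx)).2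
      linarith [hDu x, le_max_right C C']
  · obtain ⟨C, hC⟩ := l1.bdd R
    obtain ⟨C', hC'⟩ := l2.bdd R
    refine ⟨max C C', fun x hx s hs => abs_le.2 ⟨?_, ?_⟩⟩
    · have := (abs_le.1 (hC x hx)).1
      linarith [(hbd x s hs).1, le_max_left C C']
    · have := (abs_le.1 (hC' x hx)).2
      linarith [(hbd x s hs).2, le_max_right C C']

theorem exists_symmDeriv_of_concave {f : Space m → ℝ} (hf : Continuous f) (e : Space m)
    (hc : ∀ x, ConcaveOn ℝ univ (fun t : ℝ => f (x + t • e))) : ∃ D, IsSymmDeriv e f D := by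
  obtain ⟨D, hD, -⟩ := exists_symmDeriv_of_convex hf.neg e fun x => (hc x).neg
  refine ⟨_, by simpa using hD.neg⟩

/-- Symmetric derivatives of homogeneous functions are homogeneous. -/
theorem IsSymmDeriv.homogeneous {e : Space m} {f D : Space m → ℝ} (h : IsSymmDeriv e f D) {lam : ℝ}
    (hf : IsHomogeneousOfDegree f lam) : IsHomogeneousOfDegree D (lam - 1) := by
  intro r hr x
  have h1 := h.lim (r • x)
  have h2 : Tendsto (fun s : ℝ => s / r) (𝓝[>] 0) (𝓝[>] 0) := by
    refine tendsto_nhdsWithin_iff.2 ⟨?_, ?_⟩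
    · have : Tendsto (fun s : ℝ => s / r) (𝓝 0) (𝓝 (0 / r)) := tendsto_id.div_const r
      rw [zero_div] at this
      exact this.mono_left nhdsWithin_le_nhds
    · filter_upwards [self_mem_nhdsWithin] with s hs
      exact div_pos hs hr
  have h3 := ((h.lim x).comp h2).const_mul (r ^ (lam - 1))
  refine tendsto_nhds_unique h1 (h3.congr' ?_)
  filter_upwards [self_mem_nhdsWithin] with s hs
  have hs0 : s ≠ 0 := ne_of_gt hs
  have e1 : r • x + s • e = r • (x + (s / r) • e) := by
    rw [smul_add, smul_smul, mul_div_cancel₀ _ hr.ne']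
  have e2 : r • x - s • e = r • (x - (s / r) • e) := by
    rw [smul_sub, smul_smul, mul_div_cancel₀ _ hr.ne']
  simp only [Function.comp]
  rw [e1, e2, hf r hr, hf r hr, Real.rpow_sub_one hr.ne']
  field_simp

theorem IsSymmDeriv.mirror_odd {f D : Space m → ℝ} (h : IsSymmDeriv en f D)
    (hf : ∀ x, f (mirror x) = f x) (x : Space m) : D (mirror x) = -D x := by
  refine tendsto_nhds_unique (h.lim (mirror x)) ((h.lim x).neg.congr fun s => ?_)
  have e1 : mirror x + s • en = mirror (x - s • en) := by
    rw [map_sub, map_smul, mirror_en]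
    simp
  have e2 : mirror x - s • en = mirror (x + s • en) := by
    rw [map_add, map_smul, mirror_en]
    simp [sub_eq_add_neg]
  rw [e1, e2, hf, hf]
  ring

end SymmDeriv

/-! ### Tangential convexity forces normal concavity -/

section Convexity
variable {m : ℕ}

/-- Distributional convexity in the direction `e` implies convexity on lines. -/
theorem convexOn_of_integral_pd_pd_nonneg {f : Space m → ℝ} (hf : Continuous f) (e : Space m)
    (h : ∀ φ : Space m → ℝ, IsTest φ → (∀ x, 0 ≤ φ x) → 0 ≤ ∫ x, f x * pd e (pd e φ) x)
    (x : Space m) : ConvexOn ℝ univ (fun t : ℝ => f (x + t • e)) := by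
  have hfl := LocBdd.of_continuous hf
  refine ⟨convex_univ, fun t _ t' _ a b ha hb hab => ?_⟩
  -- The convexity inequality at `x` is tested against every nonnegative `φ`. The pairing `G` of `f`
  -- with translates of `φ` is twice differentiable with `G'' ≥ 0`, and its convexity is the tested
  -- inequality.
  have key := nonneg_of_forall_test
    (g := fun x => a * f (x + t • e) + b * f (x + t' • e) - f (x + (a * t + b * t') • e))
    (by fun_prop) (fun φ hφ h0 => ?_) x
  · simp only [smul_eq_mul]
    linarith
  set G : ℝ → ℝ := fun t => ∫ y, f y * φ (y - t • e) with hG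
  have hd : ∀ t, HasDerivAt G (-∫ y, f y * pd e φ (y - t • e)) t :=
    fun t => hasDerivAt_integral_translate hfl hφ e t
  have hd' : deriv G = fun t => -∫ y, f y * pd e φ (y - t • e) := funext fun t => (hd t).deriv
  have hd2 : ∀ t, HasDerivAt (deriv G) (∫ y, f y * pd e (pd e φ) (y - t • e)) t := fun t => by
    rw [hd']
    simpa using (hasDerivAt_integral_translate hfl (hφ.pd e) e t).fun_neg
  have hconv : ConvexOn ℝ univ G := by
    refine convexOn_univ_of_deriv2_nonneg (fun t => (hd t).differentiableAt)
      (fun t => (hd2 t).differentiableAt) fun t => ?_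
    simp only [Function.iterate_succ, Function.iterate_zero, Function.comp, id]
    rw [(hd2 t).deriv]
    have h1 := h _ (hφ.comp_translate (t • e)) fun y => h0 _
    have h2 : ∀ y, pd e (pd e fun x => φ (x - t • e)) y = pd e (pd e φ) (y - t • e) := fun y => by
      rw [show (pd e fun x => φ (x - t • e)) = fun y => pd e φ (y - t • e) from
        funext (pd_translate φ e _), pd_translate]
    simpa only [h2] using h1
  have hc := hconv.2 (mem_univ t) (mem_univ t') ha hb hab
  simp only [hG, smul_eq_mul] at hc
  rw [integral_mul_translate, integral_mul_translate, integral_mul_translate] at hc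
  have i1 : ∀ t : ℝ, Integrable (fun y => f (y + t • e) * φ y) := fun t => by
    have := (hfl.integrable_mul (hφ.comp_translate (t • e))).comp_add_right (t • e)
    simpa using this
  have : ∫ x, (a * f (x + t • e) + b * f (x + t' • e) - f (x + (a * t + b * t') • e)) * φ x =
      a * (∫ x, f (x + t • e) * φ x) + b * (∫ x, f (x + t' • e) * φ x) -
        ∫ x, f (x + (a * t + b * t') • e) * φ x := by
    rw [← integral_const_mul, ← integral_const_mul,
      ← integral_add ((i1 t).const_mul a) ((i1 t').const_mul b),
      ← integral_sub (((i1 t).const_mul a).fun_add ((i1 t').const_mul b)) (i1 _)]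
    refine integral_congr_ae (Eventually.of_forall fun x => ?_)
    ring
  rw [this]
  linarith

theorem IsConvexAlongThin.two_mul_le {q : Space m → ℝ} (h : IsConvexAlongThin q) {e : Space m}
    (he : e (Fin.last m) = 0) (x : Space m) (s : ℝ) :
    2 * q x ≤ q (x + s • e) + q (x - s • e) := by
  have := (h x e he).2 (mem_univ s) (mem_univ (-s)) (by norm_num : (0 : ℝ) ≤ 1 / 2)
    (by norm_num : (0 : ℝ) ≤ 1 / 2) (by norm_num)
  simp only [smul_eq_mul] at this
  rw [show 1 / 2 * s + 1 / 2 * -s = 0 by ring, zero_smul, add_zero, neg_smul,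
    ← sub_eq_add_neg] at this
  linarith

theorem integral_mul_tl_nonneg {q φ : Space m → ℝ} (hc : Continuous q) (h : IsConvexAlongThin q)
    (hφ : IsTest φ) (h0 : ∀ x, 0 ≤ φ x) : 0 ≤ ∫ x, q x * tl φ x := by
  simp only [tl, Finset.mul_sum]
  rw [integral_finsetSum _ fun i _ =>
    (LocBdd.of_continuous hc).integrable_mul ((hφ.pd _).pd _)]
  exact Finset.sum_nonneg fun i _ => integral_pd_pd_nonneg (LocBdd.of_continuous hc) hφ h0 _
    fun x s => h.two_mul_le (bv_castSucc_last i) x s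

theorem HasNegLaplacian.apply_test {q : Space m → ℝ} {μ : Measure (Space m)}
    (h : HasNegLaplacian q μ) {φ : Space m → ℝ} (hφ : IsTest φ) :
    ∫ x, q x * Δ φ x = - ∫ x, φ x ∂μ := h φ hφ.smooth hφ.compact

theorem integral_mul_laplacian_eq {q φ : Space m → ℝ} (hq : Continuous q) (hφ : IsTest φ) :
    ∫ x, q x * Δ φ x = (∫ x, q x * tl φ x) + ∫ x, q x * pd en (pd en φ) x := by
  rw [← integral_add ((LocBdd.of_continuous hq).integrable_mul hφ.tl)
    ((LocBdd.of_continuous hq).integrable_mul ((hφ.pd _).pd _))]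
  refine integral_congr_ae (Eventually.of_forall fun x => ?_)
  simp only [laplacian_eq_tl_add hφ.smooth]
  ring

/-- In the distributional sense the second normal derivative equals -μ minus the tangential
Laplacian, and both terms are nonpositive. -/
theorem concaveOn_normal {q : Space m → ℝ} {μ : Measure (Space m)} (hc : Continuous q)
    (hconv : IsConvexAlongThin q) (hμ : HasNegLaplacian q μ) (x : Space m) :
    ConcaveOn ℝ univ (fun t : ℝ => q (x + t • en)) := by
  have := convexOn_of_integral_pd_pd_nonneg (f := fun x => -q x) hc.neg en (fun φ hφ h0 => ?_) x
  · exact neg_convexOn_iff.1 this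
  have h1 := hμ.apply_test hφ
  rw [integral_mul_laplacian_eq hc hφ] at h1
  have h2 := integral_mul_tl_nonneg hc hconv hφ h0
  have h3 : 0 ≤ ∫ x, φ x ∂μ := integral_nonneg h0
  simp only [neg_mul, integral_neg]
  linarith

end Convexity

/-! ### Folding: the equation in the upper half space -/

section Fold
variable {m : ℕ}

/-- Smooth approximation of the folding map `(x', x_n) ↦ (x', |x_n|)`. -/
noncomputable def fold (κ : ℝ) (x : Space m) : Space m :=
  x + (√(x (Fin.last m) ^ 2 + κ ^ 2) - x (Fin.last m)) • en

theorem norm_sq_add_smul_en (x : Space m) (c : ℝ) :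
    ‖x + c • (en : Space m)‖ ^ 2 = ‖x‖ ^ 2 + 2 * c * x (Fin.last m) + c ^ 2 := by
  rw [norm_add_sq_real, norm_smul, norm_en, real_inner_smul_right, real_inner_comm, en, inner_bv,
    mul_one, Real.norm_eq_abs, sq_abs]
  ring

/-- Folding replaces x_n by √(x_n² + κ²), which is at least |x_n|. So composing a test function with
the fold keeps its support in the same ball for every κ. -/
theorem norm_le_norm_fold (κ : ℝ) (x : Space m) : ‖x‖ ≤ ‖fold κ x‖ := by
  refine le_of_sq_le_sq ?_ (norm_nonneg _)
  rw [fold, norm_sq_add_smul_en]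
  have := Real.sq_sqrt (show 0 ≤ x (Fin.last m) ^ 2 + κ ^ 2 by positivity)
  nlinarith [sq_nonneg κ]

theorem fold_zero_of_nonneg {x : Space m} (hx : 0 ≤ x (Fin.last m)) : fold 0 x = x := by
  simp [fold, Real.sqrt_sq hx]

theorem fold_zero_mirror (x : Space m) : fold 0 (mirror x) = fold 0 x := by
  simp only [fold, mirror_last, neg_sq]
  rw [mirror_eq, sub_add, ← sub_smul, sub_eq_add_neg, ← neg_smul]
  congr 2
  ring

theorem continuous_fold_right (κ : ℝ) : Continuous (fold κ : Space m → Space m) := by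
  unfold fold
  fun_prop

theorem tendsto_fold (x : Space m) : Tendsto (fun κ => fold κ x) (𝓝[>] 0) (𝓝 (fold 0 x)) := by
  have : Continuous fun κ => fold κ x := by
    unfold fold
    fun_prop
  exact (this.tendsto 0).mono_left nhdsWithin_le_nhds

theorem fold_arg_pos {κ : ℝ} (hκ : 0 < κ) (x : Space m) : 0 < x (Fin.last m) ^ 2 + κ ^ 2 := by
  positivity

theorem contDiff_coord (i : Fin (m + 1)) : ContDiff ℝ (⊤ : ℕ∞) (fun x : Space m => x i) :=
  (EuclideanSpace.proj (𝕜 := ℝ) i : Space m →L[ℝ] ℝ).contDiff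

theorem hasFDerivAt_coord (i : Fin (m + 1)) (x : Space m) :
    HasFDerivAt (fun x : Space m => x i) (EuclideanSpace.proj (𝕜 := ℝ) i : Space m →L[ℝ] ℝ) x :=
  (EuclideanSpace.proj (𝕜 := ℝ) i : Space m →L[ℝ] ℝ).hasFDerivAt

theorem contDiff_fold {κ : ℝ} (hκ : 0 < κ) : ContDiff ℝ (⊤ : ℕ∞) (fold κ : Space m → Space m) := by
  have h1 : ContDiff ℝ (⊤ : ℕ∞) fun x : Space m => √(x (Fin.last m) ^ 2 + κ ^ 2) :=
    (((contDiff_coord _).pow 2).add contDiff_const).sqrt fun x => (fold_arg_pos hκ x).ne'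
  exact contDiff_id.add ((h1.sub (contDiff_coord _)).smul contDiff_const)

theorem pd_comp_fold {κ : ℝ} (hκ : 0 < κ) {ψ : Space m → ℝ} (hψ : Differentiable ℝ ψ)
    (e x : Space m) : pd e (fun x => ψ (fold κ x)) x = fderiv ℝ ψ (fold κ x)
      (e + ((x (Fin.last m) / √(x (Fin.last m) ^ 2 + κ ^ 2) - 1) * e (Fin.last m)) • en) := by
  have h1 := (((hasFDerivAt_coord (Fin.last m) x).pow 2).add_const (κ ^ 2)).sqrt
    (fold_arg_pos hκ x).ne'
  have h2 := ((h1.sub (hasFDerivAt_coord (Fin.last m) x)).smul_const (en : Space m))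
  have h3 := (hasFDerivAt_id x).add h2
  have h4 : HasFDerivAt (fun x => ψ (fold κ x)) _ x := (hψ (fold κ x)).hasFDerivAt.comp x h3
  simp only [pd]
  rw [h4.fderiv]
  simp only [ContinuousLinearMap.comp_apply, add_apply, ContinuousLinearMap.smulRight_apply,
    sub_apply, smul_apply, smul_eq_mul]
  congr 2
  have := Real.sqrt_pos.2 (fold_arg_pos hκ x)
  congr 1
  field_simp
  simp
  ring

theorem pd_comp_fold_tangential {κ : ℝ} (hκ : 0 < κ) {ψ : Space m → ℝ} (hψ : Differentiable ℝ ψ)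
    {e : Space m} (he : e (Fin.last m) = 0) :
    pd e (fun x => ψ (fold κ x)) = fun x => pd e ψ (fold κ x) := by
  ext x
  rw [pd_comp_fold hκ hψ, he]
  simp [pd]

theorem pd_comp_fold_normal {κ : ℝ} (hκ : 0 < κ) {ψ : Space m → ℝ} (hψ : Differentiable ℝ ψ)
    (x : Space m) : pd en (fun x => ψ (fold κ x)) x =
      x (Fin.last m) / √(x (Fin.last m) ^ 2 + κ ^ 2) * pd en ψ (fold κ x) := by
  rw [pd_comp_fold hκ hψ, en_last]
  simp [pd]
  ring

theorem tl_comp_fold {κ : ℝ} (hκ : 0 < κ) {ψ : Space m → ℝ} (hψ : ContDiff ℝ (⊤ : ℕ∞) ψ)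
    (x : Space m) : tl (fun x => ψ (fold κ x)) x = tl ψ (fold κ x) := by
  unfold tl
  refine Finset.sum_congr rfl fun i _ => ?_
  rw [pd_comp_fold_tangential hκ (hψ.differentiable (by simp)) (bv_castSucc_last i),
    pd_comp_fold_tangential hκ ((contDiff_pd hψ _).differentiable (by simp)) (bv_castSucc_last i)]

theorem IsTest.comp_fold {κ : ℝ} (hκ : 0 < κ) {ψ : Space m → ℝ} (hψ : IsTest ψ) :
    IsTest fun x => ψ (fold κ x) := by
  obtain ⟨R, -, hR⟩ := hψ.exists_radius
  exact isTest_of_radius (hψ.smooth.comp (contDiff_fold hκ)) R fun x hx =>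
    hR _ (hx.trans_le (norm_le_norm_fold κ x))

theorem abs_div_sqrt_le_one (t κ : ℝ) : |t / √(t ^ 2 + κ ^ 2)| ≤ 1 := by
  rw [abs_div, abs_of_nonneg (Real.sqrt_nonneg _)]
  refine div_le_one_of_le₀ (Real.abs_le_sqrt ?_) (Real.sqrt_nonneg _)
  nlinarith [sq_nonneg κ]

/-- First integration by parts: weak form of the equation with one normal derivative on `q`. -/
theorem weak_form {q D φ : Space m → ℝ} {μ : Measure (Space m)} (hq : Continuous q)
    (hμ : HasNegLaplacian q μ) (hD : IsSymmDeriv en q D) (hφ : IsTest φ) :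
    ∫ x, (q x * tl φ x - D x * pd en φ x) = -∫ x, φ x ∂μ := by
  rw [← hμ.apply_test hφ, integral_mul_laplacian_eq hq hφ,
    integral_sub ((LocBdd.of_continuous hq).integrable_mul hφ.tl)
      (hD.locBdd.integrable_mul (hφ.pd _)),
    hD.integral_mul (LocBdd.of_continuous hq) (hφ.pd en)]
  ring

/-- Weak form of the equation in the upper half space. -/
theorem weak_form_upperHalf {q D ψ : Space m → ℝ} {μ : Measure (Space m)} [IsLocallyFiniteMeasure μ]
    (hq : Continuous q) (heven : ∀ x, q (mirror x) = q x)
    (hμ : HasNegLaplacian q μ) (hthin : ∀ᵐ x ∂μ, x (Fin.last m) = 0)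
    (hD : IsSymmDeriv en q D) (hψ : IsTest ψ) :
    ∫ x in upperHalf m, (q x * tl ψ x - D x * pd en ψ x) = -(1 / 2) * ∫ x, ψ x ∂μ := by
  -- This is the integrand of `weak_form` for the test function `ψ ∘ fold κ`. Only one normal
  -- derivative falls on the fold, and its factor x_n/√(x_n² + κ²) stays bounded by 1; a second one
  -- would produce a term of size 1/κ.
  set F : ℝ → Space m → ℝ := fun κ x => q x * tl ψ (fold κ x) -
    D x * (x (Fin.last m) / √(x (Fin.last m) ^ 2 + κ ^ 2) * pd en ψ (fold κ x)) with hF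
  obtain ⟨R₁, -, hR₁⟩ := hψ.tl.exists_radius
  obtain ⟨R₂, -, hR₂⟩ := (hψ.pd en).exists_radius
  obtain ⟨R₃, -, hR₃⟩ := hψ.exists_radius
  obtain ⟨B₁, hB₁0, hB₁⟩ := hψ.tl.exists_bound
  obtain ⟨B₂, hB₂0, hB₂⟩ := (hψ.pd en).exists_bound
  obtain ⟨B₃, hB₃0, hB₃⟩ := hψ.exists_bound
  obtain ⟨C₁, hC₁⟩ := (LocBdd.of_continuous hq).bdd (max R₁ R₂)
  obtain ⟨C₂, hC₂⟩ := hD.locBdd.bdd (max R₁ R₂)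
  have hFm : ∀ κ, AEStronglyMeasurable (F κ) := fun κ => by
    refine Measurable.aestronglyMeasurable ?_
    have h1 : Continuous (fold κ : Space m → Space m) := continuous_fold_right κ
    have h2 : Measurable fun x : Space m => x (Fin.last m) / √(x (Fin.last m) ^ 2 + κ ^ 2) := by
      have : Continuous fun x : Space m => √(x (Fin.last m) ^ 2 + κ ^ 2) := by fun_prop
      exact (contDiff_coord (Fin.last m)).continuous.measurable.div this.measurable
    exact (hq.mul (hψ.tl.continuous.comp h1)).measurable.sub (hD.locBdd.measurable.mul
      (h2.mul ((hψ.pd en).continuous.comp h1).measurable))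
  have hFs : ∀ κ x, max R₁ R₂ < ‖x‖ → F κ x = 0 := fun κ x hx => by
    have h1 := norm_le_norm_fold κ x
    simp only [hF]
    rw [hR₁ _ (((le_max_left _ _).trans_lt hx).trans_le h1),
      hR₂ _ (((le_max_right _ _).trans_lt hx).trans_le h1)]
    simp
  have hFb : ∀ κ x, ‖x‖ ≤ max R₁ R₂ → |F κ x| ≤ C₁ * B₁ + C₂ * (1 * B₂) := fun κ x hx => by
    refine (abs_sub _ _).trans (add_le_add ?_ ?_)
    · rw [abs_mul]
      exact mul_le_mul (hC₁ x hx) (hB₁ _) (abs_nonneg _) ((abs_nonneg _).trans (hC₁ x hx))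
    · rw [abs_mul, abs_mul]
      exact mul_le_mul (hC₂ x hx) (mul_le_mul (abs_div_sqrt_le_one _ _) (hB₂ _) (abs_nonneg _)
        zero_le_one) (by positivity) ((abs_nonneg _).trans (hC₂ x hx))
  have hlim : Tendsto (fun κ => ∫ x, F κ x) (𝓝[>] 0) (𝓝 (∫ x, F 0 x)) := by
    refine tendsto_integral_of_bounded _ _ (Eventually.of_forall hFm) (Eventually.of_forall hFb)
      (Eventually.of_forall hFs) ?_
    have : ∀ᵐ x : Space m, x (Fin.last m) ≠ 0 := by
      rw [ae_iff]
      simpa using volume_thin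
    filter_upwards [this] with x hx
    have hc : ContinuousAt (fun κ : ℝ => x (Fin.last m) / √(x (Fin.last m) ^ 2 + κ ^ 2)) 0 := by
      refine ContinuousAt.div (by fun_prop) (by fun_prop) ?_
      have : 0 < x (Fin.last m) ^ 2 := by positivity
      simpa [Real.sqrt_sq_eq_abs] using hx
    have h1 := (hψ.tl.continuous.tendsto _).comp (tendsto_fold x)
    have h2 := ((hψ.pd en).continuous.tendsto _).comp (tendsto_fold x)
    exact (h1.const_mul (q x)).sub (((hc.tendsto.mono_left nhdsWithin_le_nhds).mul h2).const_mul _)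
  have hlim2 : Tendsto (fun κ => ∫ x, ψ (fold κ x) ∂μ) (𝓝[>] 0) (𝓝 (∫ x, ψ (fold 0 x) ∂μ)) := by
    refine tendsto_integral_of_bounded B₃ R₃ ?_ (Eventually.of_forall fun κ x _ => hB₃ _)
      (Eventually.of_forall fun κ x hx => hR₃ _ (hx.trans_le (norm_le_norm_fold κ x)))
      (Eventually.of_forall fun x => (hψ.continuous.tendsto _).comp (tendsto_fold x))
    exact Eventually.of_forall fun κ =>
      (hψ.continuous.comp (continuous_fold_right κ)).aestronglyMeasurable
  have heq : ∫ x, F 0 x = -∫ x, ψ (fold 0 x) ∂μ := by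
    refine tendsto_nhds_unique hlim (hlim2.neg.congr' ?_)
    filter_upwards [self_mem_nhdsWithin] with κ hκ
    rw [← weak_form hq hμ hD (hψ.comp_fold hκ)]
    refine integral_congr_ae (Eventually.of_forall fun x => ?_)
    simp only [hF]
    rw [tl_comp_fold hκ hψ.smooth, pd_comp_fold_normal hκ hψ.differentiable]
  have hψμ : ∫ x, ψ (fold 0 x) ∂μ = ∫ x, ψ x ∂μ := by
    refine integral_congr_ae ?_
    filter_upwards [hthin] with x hx
    rw [fold_zero_of_nonneg hx.ge]
  have hF0 : ∫ x, F 0 x = 2 * ∫ x in upperHalf m, F 0 x := by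
    -- At κ = 0 the fold factor is the sign of x_n, which is odd, and `D` is odd because `q` is
    -- even. Their product is even, and this symmetry is the source of the factor 1/2 in the
    -- conclusion.
    refine integral_eq_two_mul_upperHalf (integrable_of_bounded (hFm 0) (hFb 0) (hFs 0)) fun x => ?_
    simp only [hF, fold_zero_mirror, heven, hD.mirror_odd heven, mirror_last]
    ring_nf
  have hup : ∫ x in upperHalf m, F 0 x = ∫ x in upperHalf m, (q x * tl ψ x - D x * pd en ψ x) := by
    refine setIntegral_congr_fun measurableSet_upperHalf fun x hx => ?_
    have hx' : 0 < x (Fin.last m) := hx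
    simp only [hF]
    rw [fold_zero_of_nonneg hx'.le]
    simp only [ne_eq, OfNat.ofNat_ne_zero, not_false_eq_true, zero_pow, add_zero]
    rw [Real.sqrt_sq hx'.le, div_self hx'.ne', one_mul]
  rw [← hup, ← hψμ]
  linarith

end Fold

/-! ### Derivative bounds for the smooth step function -/

section SmoothTransition

theorem deriv_smoothTransition_nonneg (t : ℝ) : 0 ≤ deriv Real.smoothTransition t :=
  Real.smoothTransition.monotone.deriv_nonneg

theorem deriv_smoothTransition_of_nonpos {t : ℝ} (h : t ≤ 0) : deriv Real.smoothTransition t = 0 :=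
  IsLocalMin.deriv_eq_zero (Eventually.of_forall fun s => by
    rw [Real.smoothTransition.zero_of_nonpos h]
    exact Real.smoothTransition.nonneg s)

theorem deriv_smoothTransition_of_one_le {t : ℝ} (h : 1 ≤ t) : deriv Real.smoothTransition t = 0 :=
  IsLocalMax.deriv_eq_zero (Eventually.of_forall fun s => by
    rw [Real.smoothTransition.one_of_one_le h]
    exact Real.smoothTransition.le_one s)

theorem differentiable_smoothTransition : Differentiable ℝ Real.smoothTransition :=
  (Real.smoothTransition.contDiff (n := 1)).differentiable (by simp)

theorem contDiff_deriv_smoothTransition : ContDiff ℝ (⊤ : ℕ∞) (deriv Real.smoothTransition) := by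
  have h : ContDiff ℝ ((⊤ : ℕ∞) + 1) Real.smoothTransition := by
    simpa using Real.smoothTransition.contDiff (n := (⊤ : ℕ∞))
  exact h.deriv'

theorem exists_deriv_smoothTransition_bound :
    ∃ C : ℝ, 0 ≤ C ∧ ∀ t, |deriv Real.smoothTransition t| ≤ C := by
  obtain ⟨C, hC⟩ := (isCompact_Icc (a := (0 : ℝ)) (b := 1)).exists_bound_of_continuousOn
    contDiff_deriv_smoothTransition.continuous.continuousOn
  refine ⟨C, (norm_nonneg _).trans (hC 0 (by simp)), fun t => ?_⟩
  by_cases h : t ∈ Icc (0 : ℝ) 1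
  · exact hC t h
  · have h0 : deriv Real.smoothTransition t = 0 := by
      rcases lt_or_ge t 0 with h1 | h1
      · exact deriv_smoothTransition_of_nonpos h1.le
      · exact deriv_smoothTransition_of_one_le (by
          by_contra h2
          exact h ⟨h1, (not_le.1 h2).le⟩)
    rw [h0, abs_zero]
    exact (norm_nonneg _).trans (hC 0 (by simp))

end SmoothTransition

/-! ### Half-space cutoffs and Green inequalities for first derivatives -/

section Cutoff
variable {m : ℕ}

/-- A smooth cutoff to the upper half space, at scale `κ`. -/
noncomputable def cut (κ : ℝ) (x : Space m) : ℝ := Real.smoothTransition (x (Fin.last m) / κ)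

theorem contDiff_cut (κ : ℝ) : ContDiff ℝ (⊤ : ℕ∞) (cut κ : Space m → ℝ) :=
  Real.smoothTransition.contDiff.comp ((contDiff_coord _).div_const κ)

theorem pd_cut (κ : ℝ) (e x : Space m) : pd e (cut κ) x =
    deriv Real.smoothTransition (x (Fin.last m) / κ) / κ * e (Fin.last m) := by
  have h1 := (hasFDerivAt_coord (Fin.last m) x).mul_const κ⁻¹
  have h2 : HasFDerivAt (cut κ : Space m → ℝ) _ x :=
    (differentiable_smoothTransition (x (Fin.last m) * κ⁻¹)).hasDerivAt.comp_hasFDerivAt x h1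
  simp only [pd]
  rw [h2.fderiv]
  simp [div_eq_mul_inv]
  ring

theorem cut_nonneg (κ : ℝ) (x : Space m) : 0 ≤ cut κ x := Real.smoothTransition.nonneg _

theorem cut_le_one (κ : ℝ) (x : Space m) : cut κ x ≤ 1 := Real.smoothTransition.le_one _

theorem pd_mul_of_pd_eq_zero {g ψ : Space m → ℝ} {e : Space m} (hg : Differentiable ℝ g)
    (hψ : Differentiable ℝ ψ) (h0 : ∀ x, pd e g x = 0) :
    pd e (fun x => g x * ψ x) = fun x => g x * pd e ψ x := by
  ext x
  rw [pd_mul e hg hψ, h0, zero_mul, add_zero]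

theorem tl_mul_of_pd_eq_zero {g ψ : Space m → ℝ} (hg : Differentiable ℝ g)
    (hψ : ContDiff ℝ (⊤ : ℕ∞) ψ) (h0 : ∀ e : Space m, e (Fin.last m) = 0 → ∀ x, pd e g x = 0)
    (x : Space m) : tl (fun x => g x * ψ x) x = g x * tl ψ x := by
  simp only [tl, Finset.mul_sum]
  refine Finset.sum_congr rfl fun i _ => ?_
  rw [pd_mul_of_pd_eq_zero hg (hψ.differentiable (by simp)) (h0 _ (bv_castSucc_last i)),
    pd_mul_of_pd_eq_zero hg ((contDiff_pd hψ _).differentiable (by simp))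
      (h0 _ (bv_castSucc_last i))]

theorem pd_cut_tangential (κ : ℝ) {e : Space m} (he : e (Fin.last m) = 0) (x : Space m) :
    pd e (cut κ) x = 0 := by
  rw [pd_cut, he, mul_zero]

theorem pd_cut_normal_tangential (κ : ℝ) {e : Space m} (he : e (Fin.last m) = 0) (x : Space m) :
    pd e (pd en (cut κ)) x = 0 := by
  rw [pd_comm (contDiff_cut κ)]
  have : pd e (cut κ : Space m → ℝ) = fun _ => 0 := funext (pd_cut_tangential κ he)
  rw [this]
  simp [pd]

theorem pd_cut_nonneg {κ : ℝ} (hκ : 0 < κ) (x : Space m) : 0 ≤ pd en (cut κ) x := by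
  rw [pd_cut, en_last, mul_one]
  exact div_nonneg (deriv_smoothTransition_nonneg _) hκ.le

theorem pd_cut_of_nonpos {κ : ℝ} (hκ : 0 < κ) (e : Space m) {x : Space m} (hx : x (Fin.last m) ≤ 0) :
    pd e (cut κ) x = 0 := by
  rw [pd_cut, deriv_smoothTransition_of_nonpos (div_nonpos_of_nonpos_of_nonneg hx hκ.le)]
  simp

theorem pd_cut_of_le {κ : ℝ} (hκ : 0 < κ) (e : Space m) {x : Space m} (hx : κ ≤ x (Fin.last m)) :
    pd e (cut κ) x = 0 := by
  rw [pd_cut, deriv_smoothTransition_of_one_le ((one_le_div hκ).2 hx)]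
  simp

theorem tendsto_cut (x : Space m) :
    Tendsto (fun κ => cut κ x) (𝓝[>] 0) (𝓝 ((upperHalf m).indicator 1 x)) := by
  by_cases hx : 0 < x (Fin.last m)
  · rw [Set.indicator_of_mem (show x ∈ upperHalf m from hx)]
    refine tendsto_const_nhds.congr' ?_
    filter_upwards [Ioc_mem_nhdsGT hx] with κ hκ
    exact (Real.smoothTransition.one_of_one_le ((one_le_div hκ.1).2 hκ.2)).symm
  · rw [Set.indicator_of_notMem (show x ∉ upperHalf m from hx)]
    refine tendsto_const_nhds.congr' ?_
    filter_upwards [self_mem_nhdsWithin] with κ hκ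
    exact (Real.smoothTransition.zero_of_nonpos
      (div_nonpos_of_nonpos_of_nonneg (not_lt.1 hx) (le_of_lt hκ))).symm

theorem tendsto_integral_cut {F : Space m → ℝ} (hF : Integrable F) :
    Tendsto (fun κ => ∫ x, cut κ x * F x) (𝓝[>] 0) (𝓝 (∫ x in upperHalf m, F x)) := by
  have h : ∫ x in upperHalf m, F x = ∫ x, (upperHalf m).indicator 1 x * F x := by
    rw [← integral_indicator measurableSet_upperHalf]
    refine integral_congr_ae (Eventually.of_forall fun x => ?_)
    by_cases hx : x ∈ upperHalf m <;> simp [hx]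
  rw [h]
  refine tendsto_integral_filter_of_dominated_convergence (fun x => |F x|) ?_ ?_ hF.abs
    (Eventually.of_forall fun x => (tendsto_cut x).mul_const _)
  · exact Eventually.of_forall fun κ =>
      (contDiff_cut κ).continuous.aestronglyMeasurable.mul hF.aestronglyMeasurable
  · refine Eventually.of_forall fun κ => Eventually.of_forall fun x => ?_
    rw [norm_mul, Real.norm_eq_abs, Real.norm_eq_abs, abs_of_nonneg (cut_nonneg κ x)]
    exact mul_le_of_le_one_left (abs_nonneg _) (cut_le_one κ x)

/-- The normal derivative of the cutoff has size 1/κ on the strip 0 < x_n < κ. The weight x_n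
compensates this size, and the strip shrinks to nothing. -/
theorem tendsto_integral_pd_cut {f g : Space m → ℝ} (hf : LocBdd f) (hg : IsTest g) :
    Tendsto (fun κ => ∫ x, f x * (pd en (cut κ) x * (x (Fin.last m) * g x))) (𝓝[>] 0) (𝓝 0) := by
  obtain ⟨C, hC0, hC⟩ := exists_deriv_smoothTransition_bound
  obtain ⟨R, -, hR⟩ := hg.exists_radius
  obtain ⟨B, hB⟩ := (hf.mul (LocBdd.of_continuous hg.continuous)).bdd R
  have key : ∀ κ : ℝ, 0 < κ → ∀ x : Space m, |pd en (cut κ) x * x (Fin.last m)| ≤ C := by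
    intro κ hκ x
    by_cases h : x (Fin.last m) ≤ 0
    · simpa [pd_cut_of_nonpos hκ en h] using hC0
    by_cases h' : κ ≤ x (Fin.last m)
    · simpa [pd_cut_of_le hκ en h'] using hC0
    push Not at h h'
    rw [pd_cut, en_last, mul_one, div_mul_eq_mul_div, mul_div_assoc, abs_mul]
    refine (mul_le_mul (hC _) ?_ (abs_nonneg _) hC0).trans (mul_one C).le
    rw [abs_of_pos (div_pos h hκ)]
    exact (div_le_one hκ).2 h'.le
  have := tendsto_integral_of_bounded (μ := volume) (l := 𝓝[>] (0 : ℝ)) (G := fun _ : Space m => 0)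
    (F := fun κ x => f x * (pd en (cut κ) x * (x (Fin.last m) * g x))) (C * B) R ?_ ?_ ?_ ?_
  · simpa using this
  · refine Eventually.of_forall fun κ => Measurable.aestronglyMeasurable ?_
    exact hf.measurable.mul ((contDiff_pd (contDiff_cut κ) en).continuous.mul
      ((contDiff_coord _).continuous.mul hg.continuous)).measurable
  · filter_upwards [self_mem_nhdsWithin] with κ hκ x hx
    rw [show f x * (pd en (cut κ) x * (x (Fin.last m) * g x)) =
      (pd en (cut κ) x * x (Fin.last m)) * (f x * g x) by ring, abs_mul]
    exact mul_le_mul (key κ hκ x) (hB x hx) (abs_nonneg _) hC0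
  · exact Eventually.of_forall fun κ x hx => by simp [hR x hx]
  · refine Eventually.of_forall fun x => tendsto_const_nhds.congr' ?_
    by_cases h : 0 < x (Fin.last m)
    · filter_upwards [Ioc_mem_nhdsGT h] with κ hκ
      rw [pd_cut_of_le hκ.1 en hκ.2]
      simp
    · filter_upwards [self_mem_nhdsWithin] with κ hκ
      rw [pd_cut_of_nonpos hκ en (not_lt.1 h)]
      simp

/-- The cutoff depends on x_n alone and therefore commutes with the tangential Laplacian. -/
theorem integral_upperHalf_mul_tl_nonneg {q ψ : Space m → ℝ} (hc : Continuous q)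
    (h : IsConvexAlongThin q) (hψ : IsTest ψ) (h0 : ∀ x, 0 ≤ ψ x) :
    0 ≤ ∫ x in upperHalf m, q x * tl ψ x := by
  refine ge_of_tendsto (tendsto_integral_cut ((LocBdd.of_continuous hc).integrable_mul hψ.tl))
    (Eventually.of_forall fun κ => ?_)
  have := integral_mul_tl_nonneg hc h (hψ.mul_left (contDiff_cut κ))
    fun x => mul_nonneg (cut_nonneg κ x) (h0 x)
  simp only [tl_mul_of_pd_eq_zero ((contDiff_cut κ).differentiable (by simp)) hψ.smooth
    (fun e he => pd_cut_tangential κ he)] at this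
  refine this.trans_eq (integral_congr_ae (Eventually.of_forall fun x => ?_))
  ring

/-- The normal derivative of a solution, tested in the upper half space. -/
theorem integral_normal_deriv_mul_laplacian {q D Ψ : Space m → ℝ} {μ : Measure (Space m)}
    [IsLocallyFiniteMeasure μ] (hq : Continuous q) (heven : ∀ x, q (mirror x) = q x)
    (hconv : IsConvexAlongThin q) (hμ : HasNegLaplacian q μ) (hthin : ∀ᵐ x ∂μ, x (Fin.last m) = 0)
    (hD : IsSymmDeriv en q D) (hΨ : IsTest Ψ) (h0 : ∀ x, 0 ≤ x (Fin.last m) → 0 ≤ Ψ x) :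
    ∫ x in upperHalf m, D x * Δ Ψ x ≤ (1 / 2) * ∫ x, pd en Ψ x ∂μ := by
  have hql := LocBdd.of_continuous hq
  have hw := weak_form_upperHalf hq heven hμ hthin hD (hΨ.pd en)
  have i1 : Integrable (fun x => q x * pd en (tl Ψ) x + D x * tl Ψ x) :=
    (hql.integrable_mul (hΨ.tl.pd en)).add (hD.locBdd.integrable_mul hΨ.tl)
  have i2 : Integrable (fun x => D x * Δ Ψ x) := hD.locBdd.integrable_mul hΨ.laplacian
  -- Formally this is the integral of ∂_n(q · `tl Ψ`), that is, minus the integral of q · `tl Ψ`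
  -- over the thin space. The cutoff replaces that surface integral by one against ∂_n `cut κ` ≥ 0,
  -- where tangential convexity supplies the sign.
  have hle : ∫ x in upperHalf m, (q x * pd en (tl Ψ) x + D x * tl Ψ x) ≤ 0 := by
    refine le_of_tendsto (tendsto_integral_cut i1) ?_
    filter_upwards [self_mem_nhdsWithin] with κ hκ
    have hcd : Differentiable ℝ (cut κ : Space m → ℝ) := (contDiff_cut κ).differentiable (by simp)
    have hd1 := hD.integral_mul hql (hΨ.tl.mul_left (contDiff_cut κ))
    have hΨ' : IsTest fun x => pd en (cut κ) x * Ψ x := hΨ.mul_left (contDiff_pd (contDiff_cut κ) en)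
    have hn := integral_mul_tl_nonneg hq hconv hΨ' fun x => by
      rcases le_total (x (Fin.last m)) 0 with hx | hx
      · rw [pd_cut_of_nonpos hκ en hx, zero_mul]
      · exact mul_nonneg (pd_cut_nonneg hκ x) (h0 x hx)
    simp only [tl_mul_of_pd_eq_zero ((contDiff_pd (contDiff_cut κ) en).differentiable (by simp))
      hΨ.smooth (fun e he => pd_cut_normal_tangential κ he)] at hn
    simp only [pd_mul en hcd hΨ.tl.differentiable] at hd1
    have j1 : Integrable fun x => D x * (cut κ x * tl Ψ x) :=
      hD.locBdd.integrable_mul (hΨ.tl.mul_left (contDiff_cut κ))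
    have j2 : Integrable fun x => q x * (cut κ x * pd en (tl Ψ) x) :=
      hql.integrable_mul ((hΨ.tl.pd en).mul_left (contDiff_cut κ))
    have j3 : Integrable fun x => q x * (pd en (cut κ) x * tl Ψ x) :=
      hql.integrable_mul (hΨ.tl.mul_left (contDiff_pd (contDiff_cut κ) en))
    simp only [mul_add (q _)] at hd1
    rw [integral_add j2 j3] at hd1
    have : ∫ x, cut κ x * (q x * pd en (tl Ψ) x + D x * tl Ψ x) =
        (∫ x, q x * (cut κ x * pd en (tl Ψ) x)) + ∫ x, D x * (cut κ x * tl Ψ x) := by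
      rw [← integral_add j2 j1]
      refine integral_congr_ae (Eventually.of_forall fun x => ?_)
      ring
    rw [this]
    linarith
  have heq : ∀ x, q x * tl (pd en Ψ) x - D x * pd en (pd en Ψ) x =
      (q x * pd en (tl Ψ) x + D x * tl Ψ x) - D x * Δ Ψ x := fun x => by
    rw [laplacian_eq_tl_add hΨ.smooth, pd_tl hΨ.smooth]
    ring
  simp only [heq] at hw
  rw [integral_sub i1.integrableOn i2.integrableOn] at hw
  linarith

/-- A tangential derivative of a solution, tested in the upper half space. -/
theorem integral_tangential_deriv_mul_laplacian {q D v Ψ g : Space m → ℝ} {μ : Measure (Space m)}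
    [IsLocallyFiniteMeasure μ] (hq : Continuous q) (heven : ∀ x, q (mirror x) = q x)
    (hμ : HasNegLaplacian q μ) (hthin : ∀ᵐ x ∂μ, x (Fin.last m) = 0)
    (hD : IsSymmDeriv en q D) {e : Space m} (he : e (Fin.last m) = 0) (hv : IsSymmDeriv e q v)
    (hv0 : ∀ x, 0 ≤ v x) (hΨ : IsTest Ψ) (hg : IsTest g)
    (h0 : ∀ x, 0 ≤ x (Fin.last m) → -(x (Fin.last m) * g x) ≤ pd en Ψ x) :
    ∫ x in upperHalf m, v x * Δ Ψ x ≤ (1 / 2) * ∫ x, pd e Ψ x ∂μ := by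
  have hql := LocBdd.of_continuous hq
  have hw := weak_form_upperHalf hq heven hμ hthin hD (hΨ.pd e)
  have i1 : Integrable (fun x => q x * tl (pd e Ψ) x - D x * pd en (pd e Ψ) x) :=
    (hql.integrable_mul (hΨ.pd e).tl).sub (hD.locBdd.integrable_mul ((hΨ.pd e).pd en))
  have i2 : Integrable (fun x => v x * Δ Ψ x) := hv.locBdd.integrable_mul hΨ.laplacian
  have hle : ∫ x in upperHalf m, (q x * tl (pd e Ψ) x - D x * pd en (pd e Ψ) x) ≤
      -(∫ x in upperHalf m, v x * Δ Ψ x) + 0 := by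
    refine le_of_tendsto_of_tendsto (tendsto_integral_cut i1)
      ((tendsto_integral_cut i2).neg.add (tendsto_integral_pd_cut hv.locBdd hg)) ?_
    filter_upwards [self_mem_nhdsWithin] with κ hκ
    have hcd : Differentiable ℝ (cut κ : Space m → ℝ) := (contDiff_cut κ).differentiable (by simp)
    have hcs := contDiff_cut (m := m) κ
    have a1 := hv.integral_mul hql (hΨ.tl.mul_left hcs)
    rw [pd_mul_of_pd_eq_zero hcd hΨ.tl.differentiable (pd_cut_tangential κ he)] at a1
    have hT : IsTest fun x => cut κ x * pd en Ψ x := (hΨ.pd en).mul_left hcs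
    -- The mixed derivative of the test function is integrated by parts twice, trading the normal
    -- derivative of `q` for the tangential derivative `v`.
    have a2 := hD.integral_mul hql (hT.pd e)
    rw [pd_comm hT.smooth] at a2
    have a3 := hv.integral_mul hql (hT.pd en)
    rw [← a3, pd_mul_of_pd_eq_zero hcd (hΨ.pd en).differentiable (pd_cut_tangential κ he)] at a2
    simp only [pd_mul en hcd (hΨ.pd en).differentiable] at a2
    have k1 : Integrable fun x => v x * (cut κ x * tl Ψ x) :=
      hv.locBdd.integrable_mul (hΨ.tl.mul_left hcs)
    have k2 : Integrable fun x => v x * (cut κ x * pd en (pd en Ψ) x) :=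
      hv.locBdd.integrable_mul (((hΨ.pd en).pd en).mul_left hcs)
    have k3 : Integrable fun x => v x * (pd en (cut κ) x * pd en Ψ x) :=
      hv.locBdd.integrable_mul ((hΨ.pd en).mul_left (contDiff_pd hcs en))
    have k4 : Integrable fun x => q x * (cut κ x * pd e (tl Ψ) x) :=
      hql.integrable_mul ((hΨ.tl.pd e).mul_left hcs)
    have k5 : Integrable fun x => D x * (cut κ x * pd e (pd en Ψ) x) :=
      hD.locBdd.integrable_mul (((hΨ.pd en).pd e).mul_left hcs)
    have k6 : Integrable fun x => v x * (pd en (cut κ) x * (x (Fin.last m) * g x)) :=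
      hv.locBdd.integrable_mul ((hg.mul_left (contDiff_coord _)).mul_left (contDiff_pd hcs en))
    simp only [mul_add (v _)] at a2
    rw [integral_add k2 k3] at a2
    have e1 : ∫ x, cut κ x * (q x * tl (pd e Ψ) x - D x * pd en (pd e Ψ) x) =
        (∫ x, q x * (cut κ x * pd e (tl Ψ) x)) - ∫ x, D x * (cut κ x * pd e (pd en Ψ) x) := by
      rw [← integral_sub k4 k5]
      refine integral_congr_ae (Eventually.of_forall fun x => ?_)
      simp only [pd_tl hΨ.smooth, pd_comm hΨ.smooth en e]
      ring
    have e2 : ∫ x, cut κ x * (v x * Δ Ψ x) =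
        (∫ x, v x * (cut κ x * tl Ψ x)) + ∫ x, v x * (cut κ x * pd en (pd en Ψ) x) := by
      rw [← integral_add k1 k2]
      refine integral_congr_ae (Eventually.of_forall fun x => ?_)
      simp only [laplacian_eq_tl_add hΨ.smooth]
      ring
    -- This is the smeared boundary term -∫ v ∂_nΨ. The hypothesis `h0` permits a negative normal
    -- derivative of order x_n, as produced by a radial cutoff of a barrier, and that error
    -- disappears as κ → 0.
    have e3 : -(∫ x, v x * (pd en (cut κ) x * pd en Ψ x)) ≤
        ∫ x, v x * (pd en (cut κ) x * (x (Fin.last m) * g x)) := by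
      rw [← integral_neg]
      refine integral_mono k3.neg k6 fun x => ?_
      simp only
      rcases le_total (x (Fin.last m)) 0 with hx | hx
      · rw [pd_cut_of_nonpos hκ en hx]
        simp
      · have h1 := mul_nonneg (hv0 x) (pd_cut_nonneg hκ x)
        have h2 := mul_le_mul_of_nonneg_left (h0 x hx) h1
        linarith
    rw [e1, e2]
    linarith
  linarith

/-- If the contact set is contained in a hyperplane of the thin space, then the solution has no
mass on it. -/
theorem integral_eq_zero_of_contact_subset {q D φ : Space m → ℝ} {μ : Measure (Space m)}
    [IsLocallyFiniteMeasure μ] (hq : Continuous q) (heven : ∀ x, q (mirror x) = q x)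
    (hconv : IsConvexAlongThin q) (hμ : HasNegLaplacian q μ) (hthin : ∀ᵐ x ∂μ, x (Fin.last m) = 0)
    (hD : IsSymmDeriv en q D) {e : Space m} (he : e (Fin.last m) = 0) (he0 : e ≠ 0)
    (hcontact : ∀ᵐ x ∂μ, inner ℝ e x = 0) (hφ : IsTest φ) (h0 : ∀ x, 0 ≤ φ x) :
    ∫ x, φ x ∂μ = 0 := by
  let b : ContDiffBump (0 : ℝ) := ⟨1, 2, one_pos, one_lt_two⟩
  set β : ℝ → Space m → ℝ := fun κ x => b (inner ℝ e x / κ) with hβ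
  have hβs : ∀ κ, ContDiff ℝ (⊤ : ℕ∞) (β κ) := fun κ =>
    b.contDiff.comp (((innerSL ℝ e).contDiff).div_const κ)
  have hβd : ∀ κ x, pd en (β κ) x = 0 := by
    intro κ x
    have hen : inner ℝ e (en : Space m) = 0 := by
      rw [real_inner_comm, en, inner_bv, he]
    have h1 := hasDerivAt_line ((hβs κ).differentiable (by simp)) x en 0
    rw [zero_smul, add_zero] at h1
    refine h1.unique ?_
    have h2 : (fun t : ℝ => β κ (x + t • en)) = fun _ => β κ x := by
      ext t
      simp [hβ, inner_add_right, inner_smul_right, hen]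
    rw [h2]
    exact hasDerivAt_const _ _
  -- The bump `β κ` is 1 on the hyperplane carrying μ. Its tangential derivatives blow up as κ → 0,
  -- but they only enter a term that convexity makes nonnegative; normal derivatives do not see `β
  -- κ`.
  have key : ∀ κ, ∫ x, φ x ∂μ ≤ 2 * ∫ x in upperHalf m, D x * (β κ x * pd en φ x) := by
    intro κ
    have hψ : IsTest fun x => β κ x * φ x := hφ.mul_left (hβs κ)
    have h1 := weak_form_upperHalf hq heven hμ hthin hD hψ
    have i1 := (LocBdd.of_continuous hq).integrable_mul hψ.tl
    have i2 := hD.locBdd.integrable_mul (hψ.pd en)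
    rw [integral_sub i1.integrableOn i2.integrableOn] at h1
    have h2 := integral_upperHalf_mul_tl_nonneg hq hconv hψ fun x => mul_nonneg b.nonneg (h0 x)
    have h3 : ∫ x, β κ x * φ x ∂μ = ∫ x, φ x ∂μ := by
      refine integral_congr_ae ?_
      filter_upwards [hcontact] with x hx
      have : β κ x = 1 := b.one_of_mem_closedBall (by simp [hx, b.rIn_pos.le])
      rw [this, one_mul]
    rw [h3] at h1
    rw [pd_mul_of_pd_eq_zero ((hβs κ).differentiable (by simp)) hφ.differentiable (hβd κ)] at h1
    linarith
  have hlim : Tendsto (fun κ => 2 * ∫ x in upperHalf m, D x * (β κ x * pd en φ x)) (𝓝[>] 0) (𝓝 0) := by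
    have : Tendsto (fun κ => ∫ x in upperHalf m, D x * (β κ x * pd en φ x)) (𝓝[>] 0)
        (𝓝 (∫ x in upperHalf m, (0 : ℝ))) := by
      refine tendsto_integral_filter_of_dominated_convergence (fun x => |D x * pd en φ x|) ?_ ?_
        (hD.locBdd.integrable_mul (hφ.pd en)).abs.integrableOn ?_
      · exact Eventually.of_forall fun κ => (hD.locBdd.measurable.mul ((hβs κ).continuous.mul
          (hφ.pd en).continuous).measurable).aestronglyMeasurable
      · refine Eventually.of_forall fun κ => Eventually.of_forall fun x => ?_
        rw [Real.norm_eq_abs, show D x * (β κ x * pd en φ x) = β κ x * (D x * pd en φ x) by ring,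
          abs_mul, abs_of_nonneg b.nonneg]
        exact mul_le_of_le_one_left (abs_nonneg _) b.le_one
      · refine ae_restrict_of_ae ?_
        have : ∀ᵐ x : Space m, inner ℝ e x ≠ 0 := by
          rw [ae_iff]
          simpa using volume_inner_eq_zero he0
        filter_upwards [this] with x hx
        refine tendsto_const_nhds.congr' ?_
        filter_upwards [Ioo_mem_nhdsGT (show (0 : ℝ) < |inner ℝ e x| / 2 by positivity)] with κ hκ
        have : β κ x = 0 := by
          refine b.zero_of_le_dist ?_
          rw [dist_zero_right, Real.norm_eq_abs, abs_div, abs_of_pos hκ.1]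
          change (2 : ℝ) ≤ _
          rw [le_div_iff₀ hκ.1]
          linarith [hκ.2]
        rw [this]
        simp
    simpa using this.const_mul 2
  exact le_antisymm (ge_of_tendsto hlim (Eventually.of_forall key)) (integral_nonneg h0)

end Cutoff

/-! ### Euler's identity in weak form and a radial cutoff -/

section Radial
variable {m : ℕ}

/-- Derivative in the radial direction. -/
noncomputable def rad (ψ : Space m → ℝ) (x : Space m) : ℝ := fderiv ℝ ψ x x

theorem rad_eq_sum (ψ : Space m → ℝ) (x : Space m) : rad ψ x = ∑ i, x i * pd (bv i) ψ x := by
  unfold rad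
  conv_lhs => rw [← sum_smul_bv x]
  rw [map_sum]
  refine Finset.sum_congr rfl fun i _ => ?_
  rw [map_smul, sum_smul_bv]
  rfl

theorem IsTest.rad {φ : Space m → ℝ} (h : IsTest φ) : IsTest (rad φ) := by
  have : _root_.rad φ = fun x => ∑ i, x i * _root_.pd (bv i) φ x := funext (rad_eq_sum φ)
  rw [this]
  exact IsTest.sum _ fun i => (h.pd _).mul_left (contDiff_coord i)

theorem hasDerivAt_ray {ψ : Space m → ℝ} (h : Differentiable ℝ ψ) (x : Space m) (t : ℝ) :
    HasDerivAt (fun t : ℝ => ψ (t • x)) (fderiv ℝ ψ (t • x) x) t := by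
  have := hasDerivAt_line h 0 x t
  simpa [pd] using this

theorem pd_comp_smul {ψ : Space m → ℝ} (h : Differentiable ℝ ψ) (r : ℝ) (e x : Space m) :
    pd e (fun x => ψ (r • x)) x = r * pd e ψ (r • x) := by
  have h1 : HasFDerivAt (fun x : Space m => r • x) (r • ContinuousLinearMap.id ℝ (Space m)) x :=
    (hasFDerivAt_id x).const_smul r
  have h2 : HasFDerivAt (fun x => ψ (r • x)) _ x := (h (r • x)).hasFDerivAt.comp x h1
  simp only [pd]
  rw [h2.fderiv]
  simp

theorem IsTest.comp_smul {φ : Space m → ℝ} (h : IsTest φ) {r : ℝ} (hr : 0 < r) :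
    IsTest fun x => φ (r • x) := by
  obtain ⟨R, -, hR⟩ := h.exists_radius
  refine isTest_of_radius (h.smooth.comp (contDiff_const_smul r)) (R / r) fun x hx => hR _ ?_
  rw [norm_smul, Real.norm_eq_abs, abs_of_pos hr]
  rwa [div_lt_iff₀' hr] at hx

theorem hasDerivAt_integral_dilate {f φ : Space m → ℝ} (hf : LocBdd f) (hφ : IsTest φ) {t₀ : ℝ}
    (ht₀ : 0 < t₀) :
    HasDerivAt (fun t : ℝ => ∫ y, f y * φ (t • y)) (∫ y, f y * (t₀⁻¹ * rad φ (t₀ • y))) t₀ := by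
  obtain ⟨R, hR0, hR⟩ := hφ.exists_radius
  obtain ⟨R', hR0', hR'⟩ := hφ.rad.exists_radius
  obtain ⟨C, hC0, hC⟩ := hφ.rad.exists_bound
  have hball : ∀ t ∈ Metric.ball t₀ (t₀ / 2), t₀ / 2 < t := fun t ht => by
    rw [Metric.mem_ball, Real.dist_eq, abs_lt] at ht
    linarith
  have key : ∀ t ∈ Metric.ball t₀ (t₀ / 2), ∀ y : Space m,
      max R R' / (t₀ / 2) < ‖y‖ → max R R' < ‖t • y‖ := by
    intro t ht y hy
    have h1 := hball t ht
    rw [norm_smul, Real.norm_eq_abs, abs_of_pos (by linarith)]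
    rw [div_lt_iff₀' (by positivity)] at hy
    exact hy.trans_le (mul_le_mul_of_nonneg_right h1.le (norm_nonneg _))
  refine hasDerivAt_integral_mul hf (g := fun t y => φ (t • y))
    (g' := fun t y => t⁻¹ * rad φ (t • y)) (ε := t₀ / 2) (R := max R R' / (t₀ / 2))
    (C := (t₀ / 2)⁻¹ * C) (by positivity)
    (fun t => hφ.continuous.comp (continuous_const_smul t))
    (continuous_const.mul (hφ.rad.continuous.comp (continuous_const_smul t₀)))
    (fun t ht y hy => hR _ ((le_max_left _ _).trans_lt (key t ht y hy)))
    (fun t ht y hy => by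
      rw [hR' _ ((le_max_right _ _).trans_lt (key t ht y hy)), mul_zero])
    (fun t ht y => ?_) (fun t ht y => ?_)
  · have h1 := hball t ht
    have h2 : 0 < t := by linarith
    rw [abs_mul, abs_of_pos (by positivity)]
    exact mul_le_mul (inv_anti₀ (by positivity) h1.le) (hC _) (abs_nonneg _) (by positivity)
  · have h1 := hball t ht
    have h2 : t ≠ 0 := by linarith
    convert hasDerivAt_ray hφ.differentiable y t using 1
    simp only [rad, map_smul, smul_eq_mul]
    field_simp

/-- Euler's identity in weak form. -/
theorem integral_homogeneous_mul_rad {u ψ : Space m → ℝ} {a : ℝ} (hu : LocBdd u)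
    (ha : IsHomogeneousOfDegree u a) (hψ : IsTest ψ) :
    ∫ x, u x * rad ψ x = -((m + 1 : ℝ) + a) * ∫ x, u x * ψ x := by
  have h1 := hasDerivAt_integral_dilate hu hψ one_pos
  simp only [inv_one, one_mul, one_smul] at h1
  -- A change of variables with homogeneity turns the dilated pairing into a pure power of `t`.
  -- Euler's identity compares the two derivatives at `t = 1`.
  have h2 : (fun t : ℝ => ∫ y, u y * ψ (t • y)) =ᶠ[𝓝 1]
      fun t => t ^ (-((m + 1 : ℝ) + a)) * ∫ x, u x * ψ x := by
    filter_upwards [lt_mem_nhds (zero_lt_one' ℝ)] with t ht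
    have h3 := Measure.integral_comp_smul (volume : Measure (Space m))
      (fun z => u (t⁻¹ • z) * ψ z) t
    simp only [smul_smul, inv_mul_cancel₀ ht.ne', one_smul] at h3
    rw [h3]
    simp only [ha t⁻¹ (inv_pos.2 ht), mul_assoc]
    rw [integral_const_mul, finrank_euclideanSpace, Fintype.card_fin, smul_eq_mul, ← mul_assoc]
    congr 1
    rw [abs_of_pos (by positivity), Real.inv_rpow ht.le, neg_add, Real.rpow_add ht,
      Real.rpow_neg ht.le, Real.rpow_neg ht.le, ← Nat.cast_succ, Real.rpow_natCast]
  have h4 := h1.congr_of_eventuallyEq h2.symm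
  have h5 := ((Real.hasDerivAt_rpow_const (x := 1) (p := -((m + 1 : ℝ) + a))
    (Or.inl one_ne_zero)).mul_const (∫ x, u x * ψ x))
  simpa using h4.unique h5

/-- A radial cutoff function. -/
noncomputable def eta (x : Space m) : ℝ := Real.smoothTransition (2 - ‖x‖ ^ 2)

/-- The radial density with `∇ eta = - dens • x`. -/
noncomputable def dens (x : Space m) : ℝ := 2 * deriv Real.smoothTransition (2 - ‖x‖ ^ 2)

theorem contDiff_eta : ContDiff ℝ (⊤ : ℕ∞) (eta : Space m → ℝ) :=
  Real.smoothTransition.contDiff.comp (contDiff_const.sub (contDiff_norm_sq ℝ))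

theorem contDiff_dens : ContDiff ℝ (⊤ : ℕ∞) (dens : Space m → ℝ) :=
  contDiff_const.mul (contDiff_deriv_smoothTransition.comp (contDiff_const.sub (contDiff_norm_sq ℝ)))

theorem eta_of_two_lt {x : Space m} (hx : 2 < ‖x‖) : eta x = 0 :=
  Real.smoothTransition.zero_of_nonpos (by nlinarith)

theorem dens_of_two_lt {x : Space m} (hx : 2 < ‖x‖) : dens x = 0 := by
  rw [dens, deriv_smoothTransition_of_nonpos (by nlinarith), mul_zero]

theorem isTest_eta : IsTest (eta : Space m → ℝ) :=
  isTest_of_radius contDiff_eta 2 fun _ hx => eta_of_two_lt hx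

theorem isTest_dens : IsTest (dens : Space m → ℝ) :=
  isTest_of_radius contDiff_dens 2 fun _ hx => dens_of_two_lt hx

theorem eta_nonneg (x : Space m) : 0 ≤ eta x := Real.smoothTransition.nonneg _

theorem eta_eq_one {x : Space m} (hx : ‖x‖ ≤ 1) : eta x = 1 :=
  Real.smoothTransition.one_of_one_le (by nlinarith [norm_nonneg x])

theorem dens_nonneg (x : Space m) : 0 ≤ dens x :=
  mul_nonneg two_pos.le (deriv_smoothTransition_nonneg _)

theorem fderiv_eta (x e : Space m) : fderiv ℝ eta x e = -(dens x * inner ℝ x e) := by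
  have h1 := ((hasStrictFDerivAt_norm_sq x).hasFDerivAt).const_sub 2
  have h2 : HasFDerivAt (eta : Space m → ℝ) _ x :=
    (differentiable_smoothTransition (2 - ‖x‖ ^ 2)).hasDerivAt.comp_hasFDerivAt x h1
  rw [h2.fderiv]
  simp [dens]
  ring

theorem rad_eta (x : Space m) : rad eta x = -(‖x‖ ^ 2 * dens x) := by
  rw [rad, fderiv_eta, real_inner_self_eq_norm_sq, mul_comm]

theorem pd_bv_eta (i : Fin (m + 1)) : pd (bv i) eta = fun x : Space m => -(x i) * dens x := by
  ext x
  rw [pd, fderiv_eta, real_inner_comm, inner_bv]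
  ring

theorem pd_bv_coord (i : Fin (m + 1)) (x : Space m) : pd (bv i) (fun x : Space m => -(x i)) x = -1 := by
  simp only [pd]
  rw [((hasFDerivAt_coord i x).fun_neg).fderiv]
  simp [bv_apply]

/-- It is the divergence of the gradient field -`dens` x; the coefficient of `dens` is the
dimension. -/
theorem laplacian_eta (x : Space m) : Δ eta x = -((m + 1 : ℝ) * dens x + rad dens x) := by
  rw [laplacian_eq_sum_pd contDiff_eta.two, rad_eq_sum]
  have : ∀ i : Fin (m + 1), pd (bv i) (pd (bv i) eta) x =
      -(x i * pd (bv i) dens x) - dens x := fun i => by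
    rw [pd_bv_eta, pd_mul (bv i) ((contDiff_coord i).neg.differentiable (by simp))
      isTest_dens.differentiable, pd_bv_coord]
    ring
  simp only [this, Finset.sum_sub_distrib, Finset.sum_neg_distrib, Finset.sum_const,
    Finset.card_univ, Fintype.card_fin, nsmul_eq_mul]
  push_cast
  ring

/-- For a nonnegative homogeneous function, the mean against `dens` vanishes only if the function
does. -/
theorem ae_eq_zero_of_integral_mul_dens {u : Space m → ℝ} {a : ℝ} (hu : LocBdd u)
    (ha : IsHomogeneousOfDegree u a) (h0 : ∀ x, 0 ≤ u x) (ha0 : 0 < (m + 1 : ℝ) + a)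
    (h : ∫ x, u x * dens x = 0) : ∀ᵐ x, u x = 0 := by
  rw [integral_eq_zero_iff_of_nonneg (fun x => mul_nonneg (h0 x) (dens_nonneg x))
    (hu.integrable_mul isTest_dens)] at h
  -- The weight `dens` is confined to a shell. Since the radial derivative of `eta` is -|x|² `dens`,
  -- Euler's identity carries the vanishing to the mean against `eta`, hence to the unit ball;
  -- homogeneity then gives every ball.
  have h1 := integral_homogeneous_mul_rad hu ha isTest_eta
  have h2 : ∫ x, u x * rad eta x = 0 := by
    rw [← integral_zero (Space m) ℝ (μ := volume)]
    refine integral_congr_ae ?_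
    filter_upwards [h] with x hx
    have hx' : u x * dens x = 0 := hx
    rw [rad_eta]
    linear_combination (-‖x‖ ^ 2) * hx'
  rw [h2, zero_eq_mul] at h1
  have h3 : ∫ x, u x * eta x = 0 := by
    rcases h1 with h1 | h1
    · linarith
    · exact h1
  rw [integral_eq_zero_iff_of_nonneg (fun x => mul_nonneg (h0 x) (eta_nonneg x))
    (hu.integrable_mul isTest_eta)] at h3
  have hball : volume {x : Space m | ‖x‖ ≤ 1 ∧ u x ≠ 0} = 0 := by
    refine measure_mono_null (fun x hx => ?_) (ae_iff.1 h3)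
    simp [eta_eq_one hx.1, hx.2]
  have hk : ∀ k : ℕ, volume {x : Space m | ‖x‖ ≤ (k + 1 : ℝ) ∧ u x ≠ 0} = 0 := by
    intro k
    have hk0 : (0 : ℝ) < k + 1 := by positivity
    have h4 : {x : Space m | ‖x‖ ≤ (k + 1 : ℝ) ∧ u x ≠ 0} ⊆
        (fun x => ((k + 1 : ℝ))⁻¹ • x) ⁻¹' {x : Space m | ‖x‖ ≤ 1 ∧ u x ≠ 0} := by
      rintro x ⟨hx1, hx2⟩
      refine ⟨?_, ?_⟩
      · rw [norm_smul, norm_inv, Real.norm_eq_abs, abs_of_pos hk0, inv_mul_le_iff₀ hk0, mul_one]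
        exact hx1
      · rw [ha _ (inv_pos.2 hk0)]
        exact mul_ne_zero (Real.rpow_pos_of_pos (inv_pos.2 hk0) _).ne' hx2
    refine measure_mono_null h4 ?_
    rw [Measure.addHaar_preimage_smul _ (inv_ne_zero hk0.ne'), hball, mul_zero]
  rw [ae_iff]
  refine measure_mono_null (fun x hx => ?_) (measure_iUnion_null hk)
  obtain ⟨k, hk⟩ := exists_nat_gt ‖x‖
  exact mem_iUnion.2 ⟨k, by linarith, hx⟩

theorem integral_dens_pos : 0 < ∫ x : Space m, dens x := by
  have h0 : 0 ≤ ∫ x : Space m, dens x := integral_nonneg dens_nonneg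
  refine lt_of_le_of_ne h0 fun h => ?_
  have h1 := ae_eq_zero_of_integral_mul_dens (m := m) (u := fun _ => 1) (a := 0)
    (LocBdd.of_continuous continuous_const) (fun r _ x => by simp) (fun _ => zero_le_one)
    (by positivity) (by simpa using h.symm)
  simp only [one_ne_zero] at h1
  rw [ae_iff] at h1
  simp at h1

end Radial

/-! ### Weyl's lemma through a mean value property -/

section Weyl
variable {m : ℕ}

theorem weakHarmonic_translate {q : Space m → ℝ}
    (h : ∀ φ : Space m → ℝ, IsTest φ → ∫ x, q x * Δ φ x = 0) (a : Space m) {φ : Space m → ℝ}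
    (hφ : IsTest φ) : ∫ x, q (x + a) * Δ φ x = 0 := by
  rw [← integral_mul_translate, ← h _ (hφ.comp_translate a)]
  refine integral_congr_ae (Eventually.of_forall fun x => ?_)
  simp only
  rw [laplacian_eq_sum_pd hφ.smooth.two, laplacian_eq_sum_pd (hφ.comp_translate a).smooth.two]
  congr 1
  refine Finset.sum_congr rfl fun i _ => ?_
  rw [show (pd (bv i) fun x => φ (x - a)) = fun y => pd (bv i) φ (y - a) from
    funext (pd_translate φ (bv i) a), pd_translate]

/-- The average of `q` around `a` with weight `dens` at scale 1/t does not depend on t: its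
t-derivative pairs `q` with a multiple of the Laplacian of a dilate of `eta`. Shrinking the scale to
zero identifies the constant. -/
theorem mean_value {q : Space m → ℝ} (hq : Continuous q)
    (h : ∀ φ : Space m → ℝ, IsTest φ → ∫ x, q x * Δ φ x = 0) (a : Space m) :
    ∫ x, q (x + a) * dens x = q a * ∫ x : Space m, dens x := by
  have hqa : Continuous fun x => q (x + a) := by fun_prop
  have hql := LocBdd.of_continuous hqa
  set J : ℝ → ℝ := fun t => t ^ (m + 1) * ∫ y, q (y + a) * dens (t • y) with hJ
  have hJd : ∀ t : ℝ, 0 < t → HasDerivAt J 0 t := by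
    intro t ht
    have h1 := (hasDerivAt_pow (m + 1) t).mul (hasDerivAt_integral_dilate hql isTest_dens ht)
    refine h1.congr_deriv ?_
    have h2 := weakHarmonic_translate h a (isTest_eta.comp_smul ht)
    have h3 : ∀ x : Space m, Δ (fun x : Space m => eta (t • x)) x =
        -(t ^ 2 * ((m + 1 : ℝ) * dens (t • x))) - t ^ 2 * rad dens (t • x) := fun x => by
      rw [laplacian_eq_sum_pd (isTest_eta.comp_smul ht).smooth.two]
      have h4 : ∀ i : Fin (m + 1), pd (bv i) (pd (bv i) fun x : Space m => eta (t • x)) x =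
          t ^ 2 * pd (bv i) (pd (bv i) eta) (t • x) := fun i => by
        rw [show (pd (bv i) fun x : Space m => eta (t • x)) =
          fun x => (fun _ => t) x * (fun x => pd (bv i) eta (t • x)) x from
          funext (pd_comp_smul isTest_eta.differentiable t (bv i)),
          pd_mul_of_pd_eq_zero (differentiable_const t)
            ((isTest_eta.pd (bv i)).comp_smul ht).differentiable (fun x => by simp [pd])]
        simp only
        rw [pd_comp_smul (isTest_eta.pd (bv i)).differentiable]
        ring
      simp only [h4, ← Finset.mul_sum]
      rw [← laplacian_eq_sum_pd contDiff_eta.two, laplacian_eta]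
      ring
    simp only [h3] at h2
    have i1 : Integrable fun y => q (y + a) * dens (t • y) :=
      hql.integrable_mul (isTest_dens.comp_smul ht)
    have i2 : Integrable fun y => q (y + a) * rad dens (t • y) :=
      hql.integrable_mul (isTest_dens.rad.comp_smul ht)
    have h5 : ∫ x, q (x + a) * (-(t ^ 2 * ((m + 1 : ℝ) * dens (t • x))) -
        t ^ 2 * rad dens (t • x)) = -(t ^ 2 * (m + 1 : ℝ)) * (∫ y, q (y + a) * dens (t • y)) -
        t ^ 2 * ∫ y, q (y + a) * rad dens (t • y) := by
      rw [← integral_const_mul, ← integral_const_mul, ← integral_sub (i1.const_mul _) (i2.const_mul _)]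
      refine integral_congr_ae (Eventually.of_forall fun x => ?_)
      simp only
      ring
    rw [h5] at h2
    have h6 : ∫ y, q (y + a) * (t⁻¹ * rad dens (t • y)) =
        t⁻¹ * ∫ y, q (y + a) * rad dens (t • y) := by
      rw [← integral_const_mul]
      refine integral_congr_ae (Eventually.of_forall fun x => ?_)
      simp only
      ring
    rw [h6]
    have h7 : (m + 1 : ℝ) * (∫ y, q (y + a) * dens (t • y)) +
        ∫ y, q (y + a) * rad dens (t • y) = 0 := by
      have : t ^ 2 ≠ 0 := by positivity
      refine mul_left_cancel₀ this ?_
      linarith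
    have h8 : t * t⁻¹ = 1 := mul_inv_cancel₀ ht.ne'
    push_cast
    linear_combination t ^ m * h7 + t ^ m * (∫ y, q (y + a) * rad dens (t • y)) * h8
  have hconst : ∀ t : ℝ, 0 < t → J t = J 1 := fun t ht => by
    have hc : Convex ℝ (Ioi (0 : ℝ)) := convex_Ioi 0
    exact (isOpen_Ioi (a := (0 : ℝ))).is_const_of_deriv_eq_zero hc.isPreconnected
      (fun x hx => (hJd x hx).differentiableAt.differentiableWithinAt)
      (fun x hx => (hJd x hx).deriv) ht (zero_lt_one' ℝ)
  have hJ' : ∀ s : ℝ, 0 < s → J s⁻¹ = ∫ z, q (s • z + a) * dens z := fun s hs => by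
    have h3 := Measure.integral_comp_smul (volume : Measure (Space m))
      (fun z => q (s • z + a) * dens z) s⁻¹
    simp only [smul_smul, mul_inv_cancel₀ hs.ne', one_smul] at h3
    simp only [hJ]
    rw [h3, finrank_euclideanSpace, Fintype.card_fin, smul_eq_mul, abs_of_pos (by positivity),
      ← mul_assoc, mul_inv_cancel₀ (by positivity), one_mul]
  have hlim : Tendsto (fun s : ℝ => ∫ z, q (s • z + a) * dens z) (𝓝[>] 0)
      (𝓝 (∫ z : Space m, q a * dens z)) := by
    obtain ⟨C, hC⟩ := hql.bdd 2
    obtain ⟨B, hB0, hB⟩ := isTest_dens (m := m).exists_bound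
    refine tendsto_integral_of_bounded (C * B) 2 ?_ ?_ ?_ ?_
    · exact Eventually.of_forall fun s => (Continuous.mul (by fun_prop)
        isTest_dens.continuous).aestronglyMeasurable
    · filter_upwards [Ioc_mem_nhdsGT (zero_lt_one' ℝ)] with s hs x hx
      have hsx : ‖s • x‖ ≤ 2 := by
        rw [norm_smul, Real.norm_eq_abs, abs_of_pos hs.1]
        nlinarith [norm_nonneg x, hs.2, hs.1]
      rw [abs_mul]
      exact mul_le_mul (hC _ hsx) (hB x) (abs_nonneg _) ((abs_nonneg _).trans (hC _ hsx))
    · exact Eventually.of_forall fun s x hx => by rw [dens_of_two_lt hx, mul_zero]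
    · refine Eventually.of_forall fun x => Tendsto.mul_const _ ?_
      have : Continuous fun s : ℝ => q (s • x + a) := by fun_prop
      have h1 := this.tendsto 0
      simp only [zero_smul, zero_add] at h1
      exact h1.mono_left nhdsWithin_le_nhds
  rw [integral_const_mul] at hlim
  have h1 : J 1 = ∫ x, q (x + a) * dens x := by simp [hJ]
  rw [← h1]
  refine tendsto_nhds_unique (tendsto_const_nhds.congr' ?_) hlim
  filter_upwards [self_mem_nhdsWithin] with s hs
  rw [← hJ' s hs, hconst _ (inv_pos.2 hs)]

/-- **Weyl's lemma** on the whole space. -/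
theorem weyl_contDiff {q : Space m → ℝ} (hq : Continuous q)
    (h : ∀ φ : Space m → ℝ, IsTest φ → ∫ x, q x * Δ φ x = 0) : ContDiff ℝ (⊤ : ℕ∞) q := by
  have hd : ∀ x : Space m, dens (-x) = dens x := fun x => by simp [dens]
  -- By the mean value property, and because `dens` is even, `q` is a multiple of its own
  -- convolution with a smooth kernel.
  have h1 : q = fun a => (∫ x : Space m, dens x)⁻¹ *
      convolution q dens (ContinuousLinearMap.mul ℝ ℝ) volume a := by
    ext a
    have h2 : convolution q dens (ContinuousLinearMap.mul ℝ ℝ) volume a =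
        q a * ∫ x : Space m, dens x := by
      rw [convolution_def, ← mean_value hq h a, ← integral_mul_translate]
      refine integral_congr_ae (Eventually.of_forall fun x => ?_)
      simp only [ContinuousLinearMap.mul_apply']
      rw [← hd, neg_sub]
    rw [h2]
    have := (integral_dens_pos (m := m)).ne'
    field_simp
  rw [h1]
  exact contDiff_const.mul (isTest_dens.compact.contDiff_convolution_right _ hq.locallyIntegrable
    contDiff_dens)

theorem integral_mul_pd {f φ : Space m → ℝ} (hf : ContDiff ℝ (⊤ : ℕ∞) f) (hφ : IsTest φ)
    (e : Space m) : ∫ x, f x * pd e φ x = -∫ x, pd e f x * φ x :=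
  integral_mul_fderiv_eq_neg_fderiv_mul_of_integrable
    ((LocBdd.of_continuous (contDiff_pd hf e).continuous).integrable_mul hφ)
    ((LocBdd.of_continuous hf.continuous).integrable_mul (hφ.pd e))
    ((LocBdd.of_continuous hf.continuous).integrable_mul hφ)
    (fun x _ => hf.differentiable (by simp) x) fun x _ => hφ.differentiable x

theorem weyl_laplacian_eq_zero {q : Space m → ℝ} (hq : ContDiff ℝ (⊤ : ℕ∞) q)
    (h : ∀ φ : Space m → ℝ, IsTest φ → ∫ x, q x * Δ φ x = 0) (x : Space m) : Δ q x = 0 := by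
  have hcd : ∀ i : Fin (m + 1), ContDiff ℝ (⊤ : ℕ∞) (pd (bv i) (pd (bv i) q)) := fun i =>
    contDiff_pd (contDiff_pd hq _) _
  have hΔ : Δ q = fun x => ∑ i, pd (bv i) (pd (bv i) q) x := funext (laplacian_eq_sum_pd hq.two)
  have hc : Continuous (Δ q) := by
    rw [hΔ]
    exact continuous_finsetSum _ fun i _ => (hcd i).continuous
  have key : ∀ φ : Space m → ℝ, IsTest φ → ∫ x, Δ q x * φ x = 0 := fun φ hφ => by
    rw [← h φ hφ]
    simp only [hΔ, laplacian_eq_sum_pd hφ.smooth.two, Finset.mul_sum, Finset.sum_mul]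
    rw [integral_finsetSum _ fun i _ =>
        (LocBdd.of_continuous (hcd i).continuous).integrable_mul hφ,
      integral_finsetSum _ fun i _ =>
        (LocBdd.of_continuous hq.continuous).integrable_mul ((hφ.pd _).pd _)]
    refine Finset.sum_congr rfl fun i _ => ?_
    rw [integral_mul_pd hq (hφ.pd _), integral_mul_pd (contDiff_pd hq _) hφ, neg_neg]
  refine le_antisymm ?_ (nonneg_of_forall_test hc (fun φ hφ _ => (key φ hφ).ge) x)
  have := nonneg_of_forall_test (g := fun x => -Δ q x) hc.neg (fun φ hφ _ => by
    simp only [neg_mul, integral_neg, key φ hφ, neg_zero, le_refl]) x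
  linarith

end Weyl

/-! ### Homogeneous functions: rigidity and polynomials -/

section Liouville
variable {m : ℕ}

/-- Homogeneity gives f(x) = r^(-λ) f(rx), whose right side tends to zero with r because f is
bounded near the origin. -/
theorem IsHomogeneousOfDegree.eq_zero_of_neg {f : Space m → ℝ} {lam : ℝ}
    (hf : IsHomogeneousOfDegree f lam) (hc : Continuous f) (hlam : lam < 0) (x : Space m) :
    f x = 0 := by
  have h1 : Tendsto (fun r : ℝ => r ^ (-lam) * f (r • x)) (𝓝[>] 0)
      (𝓝 (0 ^ (-lam) * f ((0 : ℝ) • x))) := by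
    refine Tendsto.mono_left (ContinuousAt.tendsto (ContinuousAt.mul ?_ ?_)) nhdsWithin_le_nhds
    · exact Real.continuousAt_rpow_const _ _ (Or.inr (by linarith))
    · exact Continuous.continuousAt (by fun_prop)
  rw [Real.zero_rpow (by linarith), zero_mul] at h1
  refine tendsto_nhds_unique (tendsto_const_nhds.congr' ?_) h1
  filter_upwards [self_mem_nhdsWithin] with r hr
  have hr' : 0 < r := hr
  rw [hf r hr, ← mul_assoc, ← Real.rpow_add hr', neg_add_cancel, Real.rpow_zero, one_mul]

theorem IsHomogeneousOfDegree.eq_const {f : Space m → ℝ} (hf : IsHomogeneousOfDegree f 0)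
    (hc : Continuous f) (x : Space m) : f x = f 0 := by
  have : Continuous fun r : ℝ => f (r • x) := by fun_prop
  have h1 := (this.tendsto 0).mono_left (nhdsWithin_le_nhds (s := Ioi 0))
  rw [zero_smul] at h1
  refine tendsto_nhds_unique (tendsto_const_nhds.congr' ?_) h1
  filter_upwards [self_mem_nhdsWithin] with r hr
  rw [hf r hr, Real.rpow_zero, one_mul]

theorem IsHomogeneousOfDegree.pd {f : Space m → ℝ} {lam : ℝ} (hf : IsHomogeneousOfDegree f lam)
    (hd : Differentiable ℝ f) (e : Space m) : IsHomogeneousOfDegree (pd e f) (lam - 1) := by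
  intro r hr x
  have h1 := pd_comp_smul hd r e x
  have h2 : (fun x => f (r • x)) = fun x => (fun _ => r ^ lam) x * f x := funext fun x => hf r hr x
  rw [h2, pd_mul_of_pd_eq_zero (differentiable_const _) hd (fun x => by simp [_root_.pd])] at h1
  rw [Real.rpow_sub_one hr.ne']
  field_simp
  linarith

theorem IsHomogeneousOfDegree.euler {f : Space m → ℝ} {lam : ℝ} (hf : IsHomogeneousOfDegree f lam)
    (hd : Differentiable ℝ f) (x : Space m) : ∑ i, x i * _root_.pd (bv i) f x = lam * f x := by
  rw [← rad_eq_sum]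
  have h1 := hasDerivAt_ray hd x 1
  rw [one_smul] at h1
  have h2 := (Real.hasDerivAt_rpow_const (x := 1) (p := lam) (Or.inl one_ne_zero)).mul_const (f x)
  simp only [Real.one_rpow, mul_one] at h2
  refine h1.unique (h2.congr_of_eventuallyEq ?_)
  filter_upwards [lt_mem_nhds (zero_lt_one' ℝ)] with t ht
  exact hf t ht x

/-- A smooth homogeneous function is a polynomial of integral degree. -/
theorem exists_polynomial_of_homogeneous (N : ℕ) : ∀ (lam : ℝ) (f : Space m → ℝ), lam < N →
    IsHomogeneousOfDegree f lam → ContDiff ℝ (⊤ : ℕ∞) f →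
    (∃ P : MvPolynomial (Fin (m + 1)) ℝ, ∀ x : Space m, f x = MvPolynomial.eval (fun i => x i) P) ∧
      ((∃ x, f x ≠ 0) → ∃ k : ℕ, lam = k) := by
  -- Partial derivatives lower the degree by one, until it is negative or zero. Euler's identity
  -- rebuilds `f` from them when λ ≠ 0, and the integrality of λ is inherited from a nonzero partial
  -- derivative.
  induction N with
  | zero =>
    intro lam f hlam hf hs
    have h0 := hf.eq_zero_of_neg hs.continuous (by simpa using hlam)
    exact ⟨⟨0, fun x => by simp [h0 x]⟩, fun ⟨x, hx⟩ => absurd (h0 x) hx⟩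
  | succ N ih =>
    intro lam f hlam hf hs
    by_cases hl0 : lam = 0
    · subst hl0
      exact ⟨⟨MvPolynomial.C (f 0), fun x => by simp [hf.eq_const hs.continuous x]⟩,
        fun _ => ⟨0, by simp⟩⟩
    have hd : Differentiable ℝ f := hs.differentiable (by simp)
    have hi := fun i : Fin (m + 1) => ih (lam - 1) (_root_.pd (bv i) f)
      (by push_cast at hlam; linarith) (hf.pd hd _) (contDiff_pd hs _)
    choose P hP using fun i => (hi i).1
    have he := hf.euler hd
    refine ⟨⟨MvPolynomial.C lam⁻¹ * ∑ i, MvPolynomial.X i * P i, fun x => ?_⟩, fun ⟨x, hx⟩ => ?_⟩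
    · simp only [map_mul, map_sum, MvPolynomial.eval_C, MvPolynomial.eval_X, ← hP, he]
      field_simp
    · obtain ⟨i, hi0⟩ : ∃ i, _root_.pd (bv i) f x ≠ 0 := by
        by_contra hall
        push Not at hall
        have := he x
        simp only [hall, mul_zero, Finset.sum_const_zero] at this
        exact mul_ne_zero hl0 hx this.symm
      obtain ⟨k, hk⟩ := (hi i).2 ⟨x, hi0⟩
      exact ⟨k + 1, by push_cast; linarith⟩

/-- A continuous homogeneous function that is weakly harmonic is a harmonic polynomial. -/
theorem isHarmonicPolynomial_of_weakHarmonic {q : Space m → ℝ} {lam : ℝ} (hq : Continuous q)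
    (h : ∀ φ : Space m → ℝ, IsTest φ → ∫ x, q x * Δ φ x = 0) (hf : IsHomogeneousOfDegree q lam)
    (hne : ∃ x, q x ≠ 0) : IsHarmonicPolynomial q ∧ ∃ k : ℤ, lam = k := by
  have hs := weyl_contDiff hq h
  obtain ⟨N, hN⟩ := exists_nat_gt lam
  obtain ⟨hP, hk⟩ := exists_polynomial_of_homogeneous N lam q hN hf hs
  refine ⟨⟨hP, fun x _ => ⟨hs.two.contDiffAt, Eventually.of_forall fun y => ?_⟩⟩, ?_⟩
  · exact weyl_laplacian_eq_zero hs h y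
  · obtain ⟨k, hk⟩ := hk hne
    exact ⟨k, by simp [hk]⟩

/-- A smooth homogeneous function of degree one is linear. -/
theorem linear_of_homogeneous_one {f : Space m → ℝ} (hf : IsHomogeneousOfDegree f 1)
    (hs : ContDiff ℝ (⊤ : ℕ∞) f) : ∃ c : Fin (m + 1) → ℝ, ∀ x, f x = ∑ i, x i * c i := by
  have hd : Differentiable ℝ f := hs.differentiable (by simp)
  refine ⟨fun i => _root_.pd (bv i) f 0, fun x => ?_⟩
  have h1 := hf.euler hd x
  rw [one_mul] at h1
  rw [← h1]
  refine Finset.sum_congr rfl fun i _ => ?_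
  have h2 := hf.pd hd (bv i)
  rw [sub_self] at h2
  rw [h2.eq_const (contDiff_pd hs _).continuous]

end Liouville

/-! ### The half-power function Re √(X + iY) -/

section HalfPower

/-- Modulus of `X + iY`. -/
noncomputable def cmod (X Y : ℝ) : ℝ := √(X ^ 2 + Y ^ 2)

/-- Real part of `(X + iY) ^ (1/2)`. -/
noncomputable def reSqrt (X Y : ℝ) : ℝ := √((cmod X Y + X) / 2)

/-- The derivative of `reSqrt` in the first variable. -/
noncomputable def reSqrtX (X Y : ℝ) : ℝ := reSqrt X Y / (2 * cmod X Y)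

/-- The derivative of `reSqrt` in the second variable. -/
noncomputable def reSqrtY (X Y : ℝ) : ℝ := Y / (4 * cmod X Y * reSqrt X Y)

theorem cmod_sq (X Y : ℝ) : cmod X Y ^ 2 = X ^ 2 + Y ^ 2 := Real.sq_sqrt (by positivity)

theorem cmod_nonneg (X Y : ℝ) : 0 ≤ cmod X Y := Real.sqrt_nonneg _

theorem cmod_pos {Y : ℝ} (X : ℝ) (hY : 0 < Y) : 0 < cmod X Y := Real.sqrt_pos.2 (by positivity)

theorem le_cmod (X Y : ℝ) : Y ≤ cmod X Y :=
  Real.le_sqrt_of_sq_le (by nlinarith [sq_nonneg X])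

theorem abs_le_cmod (X Y : ℝ) : |X| ≤ cmod X Y :=
  Real.abs_le_sqrt (by nlinarith [sq_nonneg Y])

theorem cmod_le (X Y : ℝ) : cmod X Y ≤ |X| + |Y| := by
  refine Real.sqrt_le_iff.2 ⟨by positivity, ?_⟩
  nlinarith [sq_abs X, sq_abs Y, abs_nonneg X, abs_nonneg Y, mul_nonneg (abs_nonneg X) (abs_nonneg Y)]

theorem cmod_add_nonneg (X Y : ℝ) : 0 ≤ cmod X Y + X := by
  have := abs_le_cmod X Y
  linarith [neg_abs_le X]

theorem cmod_add_pos {Y : ℝ} (X : ℝ) (hY : 0 < Y) : 0 < cmod X Y + X := by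
  have h : |X| < cmod X Y := Real.lt_sqrt_of_sq_lt (by rw [sq_abs]; nlinarith)
  linarith [neg_abs_le X]

theorem reSqrt_nonneg (X Y : ℝ) : 0 ≤ reSqrt X Y := Real.sqrt_nonneg _

theorem reSqrt_pos {Y : ℝ} (X : ℝ) (hY : 0 < Y) : 0 < reSqrt X Y :=
  Real.sqrt_pos.2 (half_pos (cmod_add_pos X hY))

theorem reSqrt_sq (X Y : ℝ) : reSqrt X Y ^ 2 = (cmod X Y + X) / 2 :=
  Real.sq_sqrt (by linarith [cmod_add_nonneg X Y])

theorem reSqrt_sq_le (X Y : ℝ) : reSqrt X Y ^ 2 ≤ cmod X Y := by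
  rw [reSqrt_sq]
  linarith [le_abs_self X, abs_le_cmod X Y]

/-- For √(X + iY) = w + iv one has Y = 2wv and w² + v² = |X + iY|. -/
theorem sq_eq_reSqrt (X Y : ℝ) :
    Y ^ 2 = 4 * reSqrt X Y ^ 2 * (cmod X Y - reSqrt X Y ^ 2) := by
  have h := cmod_sq X Y
  rw [reSqrt_sq]
  nlinarith

theorem reSqrtX_nonneg (X Y : ℝ) : 0 ≤ reSqrtX X Y :=
  div_nonneg (reSqrt_nonneg _ _) (mul_nonneg two_pos.le (cmod_nonneg _ _))

theorem reSqrtY_nonneg (X : ℝ) {Y : ℝ} (hY : 0 ≤ Y) : 0 ≤ reSqrtY X Y :=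
  div_nonneg hY (mul_nonneg (mul_nonneg (by norm_num) (cmod_nonneg _ _)) (reSqrt_nonneg _ _))

theorem continuous_reSqrt : Continuous fun p : ℝ × ℝ => reSqrt p.1 p.2 := by
  unfold reSqrt cmod
  fun_prop

theorem hasDerivAt_cmod_X {Y : ℝ} (X : ℝ) (hY : 0 < Y) :
    HasDerivAt (fun X => cmod X Y) (X / cmod X Y) X := by
  have h := (((hasDerivAt_id X).pow 2).add_const (Y ^ 2)).sqrt (by simp; positivity)
  refine h.congr_deriv ?_
  have : √(X ^ 2 + Y ^ 2) = cmod X Y := rfl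
  simp only [Pi.pow_apply, id, this]
  have := (cmod_pos X hY).ne'
  field_simp
  simp

theorem hasDerivAt_cmod_Y {Y : ℝ} (X : ℝ) (hY : 0 < Y) :
    HasDerivAt (fun Y => cmod X Y) (Y / cmod X Y) Y := by
  have h := (((hasDerivAt_id Y).pow 2).const_add (X ^ 2)).sqrt (by simp; positivity)
  refine h.congr_deriv ?_
  have : √(X ^ 2 + Y ^ 2) = cmod X Y := rfl
  simp only [Pi.pow_apply, id, this]
  have := (cmod_pos X hY).ne'
  field_simp
  simp

theorem hasDerivAt_reSqrt_X {Y : ℝ} (X : ℝ) (hY : 0 < Y) :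
    HasDerivAt (fun X => reSqrt X Y) (reSqrtX X Y) X := by
  have h := (((hasDerivAt_cmod_X X hY).fun_add (hasDerivAt_id X)).div_const 2).sqrt
    (half_pos (cmod_add_pos X hY)).ne'
  refine h.congr_deriv ?_
  have h1 : √((cmod X Y + id X) / 2) = reSqrt X Y := rfl
  rw [h1, reSqrtX]
  have h2 := cmod_pos X hY
  have h3 := reSqrt_pos X hY
  have h4 := reSqrt_sq X Y
  field_simp
  linarith

theorem hasDerivAt_reSqrt_Y {Y : ℝ} (X : ℝ) (hY : 0 < Y) :
    HasDerivAt (fun Y => reSqrt X Y) (reSqrtY X Y) Y := by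
  have h := (((hasDerivAt_cmod_Y X hY).add_const X).div_const 2).sqrt
    (half_pos (cmod_add_pos X hY)).ne'
  refine h.congr_deriv ?_
  have h1 : √((cmod X Y + X) / 2) = reSqrt X Y := rfl
  rw [h1, reSqrtY]
  have h2 := cmod_pos X hY
  have h3 := reSqrt_pos X hY
  field_simp
  ring

/-- `reSqrt` is harmonic: its second derivatives in the two variables are opposite. -/
theorem exists_second_deriv_reSqrt {Y : ℝ} (X : ℝ) (hY : 0 < Y) :
    ∃ c : ℝ, HasDerivAt (fun X => reSqrtX X Y) c X ∧ HasDerivAt (fun Y => reSqrtY X Y) (-c) Y := by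
  have h2 := cmod_pos X hY
  have h3 := reSqrt_pos X hY
  have a := (hasDerivAt_reSqrt_X X hY).div ((hasDerivAt_cmod_X X hY).const_mul 2) (by positivity)
  have b := (hasDerivAt_id Y).div (((hasDerivAt_cmod_Y X hY).const_mul 4).mul
    (hasDerivAt_reSqrt_Y X hY)) (by simp only [Pi.mul_apply]; positivity)
  refine ⟨_, a, b.congr_deriv ?_⟩
  have e1 := sq_eq_reSqrt X Y
  have e2 : X = 2 * reSqrt X Y ^ 2 - cmod X Y := by
    rw [reSqrt_sq]
    ring
  simp only [Pi.mul_apply, id, reSqrtX, reSqrtY]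
  -- With X and Y² written through w and the modulus r, the square roots disappear and the claim
  -- becomes a rational identity in w, r and Y.
  generalize reSqrt X Y = w at *
  generalize cmod X Y = r at *
  subst e2
  field_simp
  rw [e1]
  ring

theorem euler_reSqrt {Y : ℝ} (X : ℝ) (hY : 0 < Y) :
    X * reSqrtX X Y + Y * reSqrtY X Y = 1 / 2 * reSqrt X Y := by
  have h2 := cmod_pos X hY
  have h3 := reSqrt_pos X hY
  have e1 := sq_eq_reSqrt X Y
  have e2 : X = 2 * reSqrt X Y ^ 2 - cmod X Y := by
    rw [reSqrt_sq]
    ring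
  simp only [reSqrtX, reSqrtY]
  generalize reSqrt X Y = w at *
  generalize cmod X Y = r at *
  subst e2
  field_simp
  rw [e1]
  ring

theorem reSqrt_homogeneous {r : ℝ} (hr : 0 < r) (X Y : ℝ) :
    reSqrt (r * X) (r * Y) = r ^ (1 / 2 : ℝ) * reSqrt X Y := by
  have h1 : cmod (r * X) (r * Y) = r * cmod X Y := by
    rw [cmod, show (r * X) ^ 2 + (r * Y) ^ 2 = r ^ 2 * (X ^ 2 + Y ^ 2) by ring,
      Real.sqrt_mul (by positivity), Real.sqrt_sq hr.le, cmod]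
  rw [reSqrt, h1, show (r * cmod X Y + r * X) / 2 = r * ((cmod X Y + X) / 2) by ring,
    Real.sqrt_mul hr.le, ← Real.sqrt_eq_rpow, reSqrt]

/-- Both |d| and w are at most the square root of the modulus. This and the companion bound for the
Y-derivative dominate the error terms created by the shifts d and d². -/
theorem sq_mul_reSqrtX_le {X Y d : ℝ} (hY : 0 < Y) (hd : d ^ 2 ≤ Y) : |d * reSqrtX X Y| ≤ 1 := by
  have h2 := cmod_pos X hY
  have h3 := reSqrt_sq_le X Y
  have h4 := le_cmod X Y
  refine abs_le_of_sq_le_sq ?_ zero_le_one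
  rw [reSqrtX, ← mul_div_assoc, div_pow, div_le_iff₀ (by positivity)]
  calc (d * reSqrt X Y) ^ 2 = d ^ 2 * reSqrt X Y ^ 2 := by ring
    _ ≤ cmod X Y * cmod X Y := mul_le_mul (hd.trans h4) h3 (sq_nonneg _) h2.le
    _ ≤ 1 ^ 2 * (2 * cmod X Y) ^ 2 := by nlinarith

theorem sq_mul_reSqrtY_le {X Y h : ℝ} (hh : 0 ≤ h) (hY : 0 < Y) (hd : h ≤ Y) (h1 : h ≤ 1) :
    |h * reSqrtY X Y| ≤ 1 := by
  have h2 := cmod_pos X hY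
  have h3 := reSqrt_sq_le X Y
  have h4 := le_cmod X Y
  have h5 := reSqrt_pos X hY
  have h6 : Y ^ 2 ≤ 4 * reSqrt X Y ^ 2 * cmod X Y := by
    rw [sq_eq_reSqrt X Y]
    exact mul_le_mul_of_nonneg_left (by nlinarith) (by positivity)
  have h7 : h ^ 2 ≤ cmod X Y := by nlinarith
  refine abs_le_of_sq_le_sq ?_ zero_le_one
  rw [reSqrtY, ← mul_div_assoc, div_pow, div_le_iff₀ (by positivity)]
  calc (h * Y) ^ 2 = h ^ 2 * Y ^ 2 := by ring
    _ ≤ cmod X Y * (4 * reSqrt X Y ^ 2 * cmod X Y) := mul_le_mul h7 h6 (sq_nonneg _) h2.le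
    _ ≤ 1 ^ 2 * (4 * cmod X Y * reSqrt X Y) ^ 2 := by
      have : 0 ≤ cmod X Y ^ 2 * reSqrt X Y ^ 2 := by positivity
      nlinarith

/-- The imaginary part v of the root satisfies v² ≥ d here, and Y = 2wv with Y = d² makes w small. A
height of order d² under a shift of order d leaves both w and ∂_X w of order √d or smaller on the
slit. -/
theorem reSqrt_le_of_le_neg {X d : ℝ} (hd : 0 < d) (hX : X ≤ -d) :
    reSqrt X (d ^ 2) ^ 2 ≤ d ^ 3 := by
  have h0 : 0 < d ^ 2 := by positivity
  have h1 := sq_eq_reSqrt X (d ^ 2)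
  have h2 : d ≤ cmod X (d ^ 2) - reSqrt X (d ^ 2) ^ 2 := by
    rw [reSqrt_sq]
    have := abs_le_cmod X (d ^ 2)
    have := neg_le_abs X
    linarith
  have h3 : 4 * reSqrt X (d ^ 2) ^ 2 * d ≤ d ^ 4 := by
    calc 4 * reSqrt X (d ^ 2) ^ 2 * d ≤ _ := mul_le_mul_of_nonneg_left h2 (by positivity)
      _ = d ^ 4 := by rw [← h1]; ring
  have h4 : 4 * reSqrt X (d ^ 2) ^ 2 ≤ d ^ 3 := by
    refine le_of_mul_le_mul_right ?_ hd
    calc _ ≤ d ^ 4 := h3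
      _ = d ^ 3 * d := by ring
  nlinarith [sq_nonneg (reSqrt X (d ^ 2))]

theorem reSqrtX_le_of_le_neg {X d : ℝ} (hd : 0 < d) (hX : X ≤ -d) :
    reSqrtX X (d ^ 2) ≤ √d := by
  have h0 : 0 < d ^ 2 := by positivity
  have h1 := reSqrt_le_of_le_neg hd hX
  have h2 : d ≤ cmod X (d ^ 2) := by
    have := abs_le_cmod X (d ^ 2)
    have := neg_le_abs X
    linarith
  have h3 := cmod_pos X h0
  refine Real.le_sqrt_of_sq_le ?_
  rw [reSqrtX, div_pow, div_le_iff₀ (by positivity)]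
  calc _ ≤ d ^ 3 := h1
    _ = d * d ^ 2 := by ring
    _ ≤ d * (2 * cmod X (d ^ 2)) ^ 2 := by
      refine mul_le_mul_of_nonneg_left ?_ hd.le
      nlinarith

/-- Away from the slit the modulus and w² are both at least d, against a numerator d². -/
theorem reSqrtY_le_of_le {X d : ℝ} (hd : 0 < d) (hX : d ≤ X) : reSqrtY X (d ^ 2) ≤ √d := by
  have h0 : 0 < d ^ 2 := by positivity
  have h2 : d ≤ cmod X (d ^ 2) := by
    have := abs_le_cmod X (d ^ 2)
    have := le_abs_self X
    linarith
  have h1 : d ≤ reSqrt X (d ^ 2) ^ 2 := by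
    rw [reSqrt_sq]
    linarith
  have h3 := reSqrt_pos X h0
  have h4 := cmod_pos X h0
  refine Real.le_sqrt_of_sq_le ?_
  rw [reSqrtY, div_pow, div_le_iff₀ (by positivity)]
  calc (d ^ 2) ^ 2 = d * (d ^ 2 * d) := by ring
    _ ≤ d * (cmod X (d ^ 2) ^ 2 * reSqrt X (d ^ 2) ^ 2) := by
      refine mul_le_mul_of_nonneg_left ?_ hd.le
      exact mul_le_mul (by nlinarith) h1 hd.le (by positivity)
    _ ≤ d * (4 * cmod X (d ^ 2) * reSqrt X (d ^ 2)) ^ 2 := by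
      refine mul_le_mul_of_nonneg_left ?_ hd.le
      have : 0 ≤ cmod X (d ^ 2) ^ 2 * reSqrt X (d ^ 2) ^ 2 := by positivity
      nlinarith

end HalfPower

/-! ### Smooth barriers and their limits -/

section Barrier
variable {m : ℕ}

/-- A smooth positive function equal to `h + t` for `t ≥ -h/4`. -/
noncomputable def raise (h t : ℝ) : ℝ := h + t * Real.smoothTransition (2 + 4 * t / h)

theorem raise_pos {h : ℝ} (hh : 0 < h) (t : ℝ) : 0 < raise h t := by
  unfold raise
  have h1 := Real.smoothTransition.nonneg (2 + 4 * t / h)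
  have h2 := Real.smoothTransition.le_one (2 + 4 * t / h)
  rcases le_or_gt t (-(h / 2)) with ht | ht
  · rw [Real.smoothTransition.zero_of_nonpos, mul_zero, add_zero]
    · exact hh
    · have : 4 * t / h ≤ -2 := by
        rw [div_le_iff₀ hh]
        linarith
      linarith
  · rcases le_or_gt 0 t with h0 | h0
    · nlinarith
    · nlinarith

theorem raise_of_le {h t : ℝ} (hh : 0 < h) (ht : -(h / 4) ≤ t) : raise h t = t + h := by
  rw [raise, Real.smoothTransition.one_of_one_le]
  · ring
  · have : -1 ≤ 4 * t / h := by
      rw [le_div_iff₀ hh]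
      linarith
    linarith

theorem contDiff_raise (h : ℝ) : ContDiff ℝ (⊤ : ℕ∞) (raise h) :=
  contDiff_const.add (contDiff_id.mul (Real.smoothTransition.contDiff.comp
    (contDiff_const.add ((contDiff_const.mul contDiff_id).div_const h))))

/-- A smooth positive function, harmonic near the upper half space and close to the positive
half-harmonic function of degree `1/2` vanishing on `{⟪e, x⟫ ≤ 0, x_n = 0}`. -/
noncomputable def barrier (e : Space m) (s h : ℝ) (x : Space m) : ℝ :=
  reSqrt (inner ℝ e x + s) (raise h (x (Fin.last m)))

theorem contDiff_barrier (e : Space m) (s : ℝ) {h : ℝ} (hh : 0 < h) :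
    ContDiff ℝ (⊤ : ℕ∞) (barrier e s h) := by
  have hX : ContDiff ℝ (⊤ : ℕ∞) fun x : Space m => inner ℝ e x + s :=
    (innerSL ℝ e).contDiff.add contDiff_const
  have hY : ContDiff ℝ (⊤ : ℕ∞) fun x : Space m => raise h (x (Fin.last m)) :=
    (contDiff_raise h).comp (contDiff_coord _)
  have hr : ContDiff ℝ (⊤ : ℕ∞) fun x : Space m =>
      cmod (inner ℝ e x + s) (raise h (x (Fin.last m))) :=
    ((hX.pow 2).add (hY.pow 2)).sqrt fun x => by
      have := raise_pos hh (x (Fin.last m))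
      positivity
  exact ((hr.add hX).div_const 2).sqrt fun x =>
    (half_pos (cmod_add_pos _ (raise_pos hh _))).ne'

theorem inner_en_eq_zero {e : Space m} (he : e (Fin.last m) = 0) : inner ℝ e (en : Space m) = 0 := by
  rw [real_inner_comm, en, inner_bv, he]

theorem pd_eq_of_line {f : Space m → ℝ} (hf : Differentiable ℝ f) {e x : Space m} {c : ℝ}
    (h : HasDerivAt (fun t : ℝ => f (x + t • e)) c 0) : pd e f x = c := by
  have := hasDerivAt_line hf x e 0
  rw [zero_smul, add_zero] at this
  exact this.unique h

theorem pd_barrier_tangential (e : Space m) (s : ℝ) {h : ℝ} (hh : 0 < h) {e' : Space m}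
    (he' : e' (Fin.last m) = 0) (x : Space m) :
    pd e' (barrier e s h) x =
      inner ℝ e e' * reSqrtX (inner ℝ e x + s) (raise h (x (Fin.last m))) := by
  refine pd_eq_of_line ((contDiff_barrier e s hh).differentiable (by simp)) ?_
  have h1 : HasDerivAt (fun t : ℝ => inner ℝ e x + t * inner ℝ e e' + s) (inner ℝ e e') 0 := by
    simpa using (((hasDerivAt_id (0 : ℝ)).mul_const (inner ℝ e e')).const_add (inner ℝ e x)).add_const s
  have h2 := hasDerivAt_reSqrt_X (inner ℝ e x + 0 * inner ℝ e e' + s) (raise_pos hh (x (Fin.last m)))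
  have h3 := h2.comp (0 : ℝ) h1
  simp only [zero_mul, add_zero] at h3
  refine (h3.congr_deriv (mul_comm _ _)).congr_of_eventuallyEq (Eventually.of_forall fun t => ?_)
  simp [barrier, inner_add_right, inner_smul_right, he']

theorem pd_barrier_normal {e : Space m} (he : e (Fin.last m) = 0) (s : ℝ) {h : ℝ} (hh : 0 < h)
    {x : Space m} (hx : -(h / 4) < x (Fin.last m)) :
    pd en (barrier e s h) x = reSqrtY (inner ℝ e x + s) (x (Fin.last m) + h) := by
  refine pd_eq_of_line ((contDiff_barrier e s hh).differentiable (by simp)) ?_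
  have h1 : HasDerivAt (fun t : ℝ => x (Fin.last m) + t + h) 1 0 := by
    simpa using ((hasDerivAt_id (0 : ℝ)).const_add (x (Fin.last m))).add_const h
  have hp : 0 < x (Fin.last m) + 0 + h := by linarith
  have h3 := (hasDerivAt_reSqrt_Y (inner ℝ e x + s) hp).comp (0 : ℝ) h1
  simp only [add_zero, mul_one] at h3
  refine h3.congr_of_eventuallyEq ?_
  have hev : ∀ᶠ t in 𝓝 (0 : ℝ), -(h / 4) < x (Fin.last m) + t := by
    have : Continuous fun t : ℝ => x (Fin.last m) + t := by fun_prop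
    exact this.continuousAt.eventually (lt_mem_nhds (by simpa using hx))
  filter_upwards [hev] with t ht
  simp only [barrier, inner_add_right, inner_smul_right, inner_en_eq_zero he, mul_zero, add_zero,
    Function.comp, PiLp.add_apply, PiLp.smul_apply, en_last, smul_eq_mul, mul_one]
  rw [raise_of_le hh ht.le]

theorem sum_inner_bv_sq {e : Space m} (he : e (Fin.last m) = 0) (hn : ‖e‖ = 1) :
    ∑ i : Fin m, inner ℝ e (bv i.castSucc) ^ 2 = 1 := by
  have h := EuclideanSpace.norm_sq_eq e
  rw [Fin.sum_univ_castSucc, he, hn] at h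
  simp only [norm_zero, Real.norm_eq_abs, sq_abs] at h
  have h' : ∀ i : Fin (m + 1), inner ℝ e (bv i) = e i := fun i => by rw [real_inner_comm, inner_bv]
  simp only [h']
  linarith

theorem sum_mul_inner_bv {e : Space m} (he : e (Fin.last m) = 0) (x : Space m) :
    ∑ i : Fin m, x i.castSucc * inner ℝ e (bv i.castSucc) = inner ℝ e x := by
  conv_rhs => rw [← sum_smul_bv x]
  rw [inner_sum, Fin.sum_univ_castSucc, inner_smul_right _ _ (x (Fin.last m))]
  have := inner_en_eq_zero he
  rw [en] at this
  rw [this, mul_zero, add_zero]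
  exact Finset.sum_congr rfl fun i _ => by rw [inner_smul_right]

theorem laplacian_barrier {e : Space m} (he : e (Fin.last m) = 0) (hn : ‖e‖ = 1) (s : ℝ) {h : ℝ}
    (hh : 0 < h) {x : Space m} (hx : 0 ≤ x (Fin.last m)) : Δ (barrier e s h) x = 0 := by
  have hb := contDiff_barrier e s hh
  have hp : 0 < x (Fin.last m) + h := by linarith
  obtain ⟨c, hc1, hc2⟩ := exists_second_deriv_reSqrt (inner ℝ e x + s) hp
  have hraise : raise h (x (Fin.last m)) = x (Fin.last m) + h := raise_of_le hh (by linarith)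
  have h1 : ∀ i : Fin m, pd (bv i.castSucc) (pd (bv i.castSucc) (barrier e s h)) x =
      inner ℝ e (bv i.castSucc) ^ 2 * c := by
    intro i
    refine pd_eq_of_line ((contDiff_pd hb _).differentiable (by simp)) ?_
    have a1 : HasDerivAt (fun t : ℝ => inner ℝ e x + t * inner ℝ e (bv i.castSucc) + s)
        (inner ℝ e (bv i.castSucc)) 0 := by
      simpa using (((hasDerivAt_id (0 : ℝ)).mul_const
        (inner ℝ e (bv i.castSucc))).const_add (inner ℝ e x)).add_const s
    have a2 : HasDerivAt (fun X => reSqrtX X (x (Fin.last m) + h)) c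
        (inner ℝ e x + 0 * inner ℝ e (bv i.castSucc) + s) := by simpa using hc1
    have a3 := (a2.comp (0 : ℝ) a1).const_mul (inner ℝ e (bv i.castSucc))
    refine (a3.congr_deriv (by ring)).congr_of_eventuallyEq (Eventually.of_forall fun t => ?_)
    change pd (bv i.castSucc) (barrier e s h) (x + t • bv i.castSucc) = _
    rw [pd_barrier_tangential e s hh (bv_castSucc_last i)]
    simp [inner_add_right, inner_smul_right, bv_castSucc_last, hraise]
  have h2 : pd en (pd en (barrier e s h)) x = -c := by
    refine pd_eq_of_line ((contDiff_pd hb _).differentiable (by simp)) ?_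
    have a1 : HasDerivAt (fun t : ℝ => x (Fin.last m) + t + h) 1 0 := by
      simpa using ((hasDerivAt_id (0 : ℝ)).const_add (x (Fin.last m))).add_const h
    have a2 : HasDerivAt (fun Y => reSqrtY (inner ℝ e x + s) Y) (-c) (x (Fin.last m) + 0 + h) := by
      simpa using hc2
    have a3 := a2.comp (0 : ℝ) a1
    refine (a3.congr_deriv (by ring)).congr_of_eventuallyEq ?_
    have hev : ∀ᶠ t in 𝓝 (0 : ℝ), -(h / 4) < x (Fin.last m) + t := by
      have : Continuous fun t : ℝ => x (Fin.last m) + t := by fun_prop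
      refine this.continuousAt.eventually (lt_mem_nhds ?_)
      simp only [add_zero]
      linarith
    filter_upwards [hev] with t ht
    rw [pd_barrier_normal he s hh (by simpa using ht)]
    simp [inner_add_right, inner_smul_right, inner_en_eq_zero he]
  rw [laplacian_eq_tl_add hb, h2, tl]
  simp only [h1]
  rw [← Finset.sum_mul, sum_inner_bv_sq he hn]
  ring

theorem rad_barrier {e : Space m} (he : e (Fin.last m) = 0) (s : ℝ) {h : ℝ}
    (hh : 0 < h) {x : Space m} (hx : 0 ≤ x (Fin.last m)) :
    rad (barrier e s h) x = 1 / 2 * reSqrt (inner ℝ e x + s) (x (Fin.last m) + h) -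
      (s * reSqrtX (inner ℝ e x + s) (x (Fin.last m) + h) +
        h * reSqrtY (inner ℝ e x + s) (x (Fin.last m) + h)) := by
  have hraise : raise h (x (Fin.last m)) = x (Fin.last m) + h := raise_of_le hh (by linarith)
  have h2 := pd_barrier_normal he s hh (x := x) (by linarith)
  rw [en] at h2
  rw [rad_eq_sum, Fin.sum_univ_castSucc, h2]
  simp only [pd_barrier_tangential e s hh (bv_castSucc_last _), hraise, ← mul_assoc]
  rw [← Finset.sum_mul, sum_mul_inner_bv he,
    ← euler_reSqrt (inner ℝ e x + s) (show 0 < x (Fin.last m) + h by linarith)]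
  ring

/-- The localized barrier. -/
noncomputable def cutBarrier (e : Space m) (s h : ℝ) (x : Space m) : ℝ := barrier e s h x * eta x

theorem isTest_cutBarrier (e : Space m) (s : ℝ) {h : ℝ} (hh : 0 < h) :
    IsTest (cutBarrier e s h) :=
  isTest_eta.mul_left (contDiff_barrier e s hh)

theorem pd_cutBarrier (e : Space m) (s : ℝ) {h : ℝ} (hh : 0 < h) (e' x : Space m) :
    pd e' (cutBarrier e s h) x = pd e' (barrier e s h) x * eta x -
      barrier e s h x * (dens x * inner ℝ x e') := by
  have : cutBarrier e s h = fun x => barrier e s h x * eta x := rfl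
  rw [this, pd_mul e' ((contDiff_barrier e s hh).differentiable (by simp))
    isTest_eta.differentiable]
  have h2 : pd e' eta x = -(dens x * inner ℝ x e') := fderiv_eta x e'
  rw [h2]
  ring

theorem laplacian_mul {f g : Space m → ℝ} (hf : ContDiff ℝ (⊤ : ℕ∞) f)
    (hg : ContDiff ℝ (⊤ : ℕ∞) g) (x : Space m) :
    Δ (fun x => f x * g x) x = f x * Δ g x + 2 * (∑ i, pd (bv i) f x * pd (bv i) g x) +
      Δ f x * g x := by
  have hd : ∀ {f : Space m → ℝ}, ContDiff ℝ (⊤ : ℕ∞) f → Differentiable ℝ f := fun h =>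
    h.differentiable (by simp)
  rw [laplacian_eq_sum_pd (hf.mul hg).two, laplacian_eq_sum_pd hf.two, laplacian_eq_sum_pd hg.two,
    Finset.mul_sum, Finset.mul_sum, Finset.sum_mul, ← Finset.sum_add_distrib,
    ← Finset.sum_add_distrib]
  refine Finset.sum_congr rfl fun i _ => ?_
  have h1 : pd (bv i) (fun x => f x * g x) =
      fun x => f x * pd (bv i) g x + pd (bv i) f x * g x :=
    funext (pd_mul _ (hd hf) (hd hg))
  rw [h1, pd_add _ ((hd hf).fun_mul (hd (contDiff_pd hg _)))
      ((hd (contDiff_pd hf _)).fun_mul (hd hg)),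
    pd_mul _ (hd hf) (hd (contDiff_pd hg _)), pd_mul _ (hd (contDiff_pd hf _)) (hd hg)]
  ring

/-- The barrier is harmonic here and the gradient of `eta` is radial, so the cross term is a
multiple of the radial derivative. Degree 1/2 raises the dimension in the coefficient of `dens` by
one; the last summand measures how far the shifts break homogeneity. -/
theorem laplacian_cutBarrier {e : Space m} (he : e (Fin.last m) = 0) (hn : ‖e‖ = 1) (s : ℝ) {h : ℝ}
    (hh : 0 < h) {x : Space m} (hx : 0 ≤ x (Fin.last m)) :
    Δ (cutBarrier e s h) x =
      -(((m + 1 : ℝ) + 1) * dens x + rad dens x) *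
        reSqrt (inner ℝ e x + s) (x (Fin.last m) + h) +
      2 * dens x * (s * reSqrtX (inner ℝ e x + s) (x (Fin.last m) + h) +
        h * reSqrtY (inner ℝ e x + s) (x (Fin.last m) + h)) := by
  have : cutBarrier e s h = fun x => barrier e s h x * eta x := rfl
  have hb := contDiff_barrier e s hh
  have hraise : raise h (x (Fin.last m)) = x (Fin.last m) + h := raise_of_le hh (by linarith)
  have hbar : barrier e s h x = reSqrt (inner ℝ e x + s) (x (Fin.last m) + h) := by
    rw [barrier, hraise]
  have h1 : ∑ i, pd (bv i) (barrier e s h) x * pd (bv i) eta x = -dens x * rad (barrier e s h) x := by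
    rw [rad_eq_sum, Finset.mul_sum]
    refine Finset.sum_congr rfl fun i _ => ?_
    rw [pd_bv_eta]
    ring
  rw [this, laplacian_mul hb contDiff_eta, laplacian_barrier he hn s hh hx, laplacian_eta, h1,
    rad_barrier he s hh hx, hbar]
  ring

theorem continuous_reSqrt_inner (e : Space m) :
    Continuous fun x : Space m => reSqrt (inner ℝ e x) (x (Fin.last m)) :=
  continuous_reSqrt.comp
    ((innerSL ℝ e).continuous.prodMk (contDiff_coord (Fin.last m)).continuous)

theorem isHomogeneous_indicator_mul_reSqrt {u : Space m → ℝ} {lam : ℝ}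
    (hhom : IsHomogeneousOfDegree u (lam - 1)) (e : Space m) :
    IsHomogeneousOfDegree ((upperHalf m).indicator
      fun x => u x * reSqrt (inner ℝ e x) (x (Fin.last m))) (lam - 1 / 2) := by
  intro r hr x
  have hmem : r • x ∈ upperHalf m ↔ x ∈ upperHalf m := by
    simp [upperHalf, hr]
  by_cases hx : x ∈ upperHalf m
  · rw [Set.indicator_of_mem hx, Set.indicator_of_mem (hmem.2 hx), hhom r hr]
    simp only [inner_smul_right, PiLp.smul_apply, smul_eq_mul]
    rw [reSqrt_homogeneous hr, show lam - 1 / 2 = lam - 1 + 1 / 2 by ring, Real.rpow_add hr]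
    ring
  · rw [Set.indicator_of_notMem hx, Set.indicator_of_notMem (fun h => hx (hmem.1 h)), mul_zero]

/-- Convergence of the Laplacians of the barriers, tested against a homogeneous function. -/
theorem tendsto_integral_laplacian_cutBarrier {u : Space m → ℝ} {lam : ℝ} (hu : LocBdd u)
    (hhom : IsHomogeneousOfDegree u (lam - 1)) {e : Space m} (he : e (Fin.last m) = 0)
    (hn : ‖e‖ = 1) {τ : ℝ} (hτ : τ ^ 2 = 1) :
    Tendsto (fun d : ℝ => ∫ x in upperHalf m, u x * Δ (cutBarrier e (τ * d) (d ^ 2)) x) (𝓝[>] 0)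
      (𝓝 ((lam - 3 / 2) * ∫ x, (upperHalf m).indicator
        (fun x => u x * reSqrt (inner ℝ e x) (x (Fin.last m))) x * dens x)) := by
  set w : Space m → ℝ := fun x => reSqrt (inner ℝ e x) (x (Fin.last m)) with hw
  set k : Space m → ℝ := fun x => -(((m + 1 : ℝ) + 1) * dens x + rad dens x) with hk
  have hwc : Continuous w := continuous_reSqrt_inner e
  have hkT : IsTest k := by
    have := ((isTest_dens (m := m)).mul_left (g := fun _ => -((m + 1 : ℝ) + 1)) contDiff_const).add
      ((isTest_dens (m := m)).rad.mul_left (g := fun _ => -1) contDiff_const)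
    refine (funext fun x => ?_ : k = _) ▸ this
    simp only [hk]
    ring
  set U : Space m → ℝ := (upperHalf m).indicator fun x => u x * w x with hU
  have hUl : LocBdd U := (hu.mul (LocBdd.of_continuous hwc)).indicator measurableSet_upperHalf
  have hUh : IsHomogeneousOfDegree U (lam - 1 / 2) := isHomogeneous_indicator_mul_reSqrt hhom e
  -- The critical exponent appears here. `U` has degree λ - 1/2, so Euler's identity gives -(n + 1)
  -- + (n + λ - 1/2) = λ - 3/2 with n = m + 1.
  have hval : (lam - 3 / 2) * ∫ x, U x * dens x =
      ∫ x, (upperHalf m).indicator (fun x => u x * (k x * w x)) x := by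
    have h1 := integral_homogeneous_mul_rad hUl hUh isTest_dens
    have i1 := hUl.integrable_mul (isTest_dens (m := m))
    have i2 := hUl.integrable_mul (isTest_dens (m := m)).rad
    have h2 : ∫ x, (upperHalf m).indicator (fun x => u x * (k x * w x)) x =
        -((m + 1 : ℝ) + 1) * (∫ x, U x * dens x) - ∫ x, U x * rad dens x := by
      rw [← integral_const_mul, ← integral_sub (i1.const_mul _) i2]
      refine integral_congr_ae (Eventually.of_forall fun x => ?_)
      by_cases hx : x ∈ upperHalf m
      · simp only [hU, Set.indicator_of_mem hx, hk]
        ring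
      · simp [hU, hx]
    rw [h2, h1]
    ring
  rw [hval]
  obtain ⟨R, hR0, hR⟩ := hkT.exists_radius
  obtain ⟨B₁, hB₁0, hB₁⟩ := hkT.exists_bound
  obtain ⟨B₂, hB₂0, hB₂⟩ := (isTest_dens (m := m)).exists_bound
  obtain ⟨C, hC⟩ := hu.bdd 2
  have hform : ∀ d : ℝ, 0 < d → ∀ x ∈ upperHalf m, Δ (cutBarrier e (τ * d) (d ^ 2)) x =
      k x * reSqrt (inner ℝ e x + τ * d) (x (Fin.last m) + d ^ 2) +
      2 * dens x * (τ * d * reSqrtX (inner ℝ e x + τ * d) (x (Fin.last m) + d ^ 2) +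
        d ^ 2 * reSqrtY (inner ℝ e x + τ * d) (x (Fin.last m) + d ^ 2)) := fun d hd x hx =>
    laplacian_cutBarrier he hn _ (by positivity) (le_of_lt hx)
  have hconv : ∀ d, ∫ x in upperHalf m, u x * Δ (cutBarrier e (τ * d) (d ^ 2)) x =
      ∫ x, (upperHalf m).indicator (fun x => u x * Δ (cutBarrier e (τ * d) (d ^ 2)) x) x := fun d =>
    (integral_indicator measurableSet_upperHalf).symm
  simp only [hconv]
  have hden2 : ∀ x : Space m, 2 < ‖x‖ → k x = 0 := fun x hx => by
    have h1 : dens =ᶠ[𝓝 x] fun _ => (0 : ℝ) := by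
      filter_upwards [continuous_norm.continuousAt.eventually (lt_mem_nhds hx)] with y hy
      exact dens_of_two_lt hy
    simp only [hk, rad, h1.fderiv_eq, dens_of_two_lt hx]
    simp
  -- For d ≤ 1 and |x| ≤ 2 both shifted coordinates are at most 3 in absolute value, so the modulus
  -- is at most 6. The two error terms are each at most 1.
  refine tendsto_integral_of_bounded (C * (B₁ * 6 + 2 * B₂ * (1 + 1))) 2 ?_ ?_ ?_ ?_
  · filter_upwards [self_mem_nhdsWithin] with d hd
    have hd0 : (0 : ℝ) < d ^ 2 := pow_pos hd 2
    exact (hu.measurable.mul (isTest_cutBarrier e (τ * d) hd0).laplacian.continuous.measurable).indicator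
      measurableSet_upperHalf |>.aestronglyMeasurable
  · filter_upwards [Ioc_mem_nhdsGT (zero_lt_one' ℝ)] with d hd x hx
    have hC0 : 0 ≤ C := (abs_nonneg _).trans (hC x hx)
    have hd1 : d ^ 2 ≤ 1 := by nlinarith [hd.1, hd.2]
    by_cases hxu : x ∈ upperHalf m
    · have hxn : 0 < x (Fin.last m) := hxu
      have hxn2 : x (Fin.last m) ≤ 2 :=
        (le_abs_self _).trans ((PiLp.norm_apply_le x (Fin.last m)).trans hx)
      have hdp : 0 < d ^ 2 := pow_pos hd.1 2
      have hYp : 0 < x (Fin.last m) + d ^ 2 := by linarith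
      have hτ1 : |τ| = 1 := by
        rw [← sq_eq_sq₀ (abs_nonneg _) zero_le_one, sq_abs, hτ, one_pow]
      have hX : |inner ℝ e x + τ * d| ≤ 3 := by
        refine (abs_add_le _ _).trans ?_
        have h1 : |inner ℝ e x| ≤ 2 := by
          have := abs_real_inner_le_norm e x
          rw [hn, one_mul] at this
          exact this.trans hx
        have h2 : |τ * d| ≤ 1 := by
          rw [abs_mul, hτ1, one_mul, abs_of_pos hd.1]
          exact hd.2
        linarith
      have hcm : cmod (inner ℝ e x + τ * d) (x (Fin.last m) + d ^ 2) ≤ 6 := by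
        refine (cmod_le _ _).trans ?_
        rw [abs_of_pos hYp]
        linarith
      have hw6 : |reSqrt (inner ℝ e x + τ * d) (x (Fin.last m) + d ^ 2)| ≤ 6 := by
        refine abs_le_of_sq_le_sq ?_ (by norm_num)
        exact (reSqrt_sq_le _ _).trans (hcm.trans (by norm_num))
      have hb1 : |τ * d * reSqrtX (inner ℝ e x + τ * d) (x (Fin.last m) + d ^ 2)| ≤ 1 :=
        sq_mul_reSqrtX_le hYp (by rw [mul_pow, hτ]; linarith)
      have hb2 : |d ^ 2 * reSqrtY (inner ℝ e x + τ * d) (x (Fin.last m) + d ^ 2)| ≤ 1 :=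
        sq_mul_reSqrtY_le hdp.le hYp (by linarith) hd1
      rw [Set.indicator_of_mem hxu, hform d hd.1 x hxu, abs_mul]
      refine mul_le_mul (hC x hx) ?_ (abs_nonneg _) hC0
      refine (abs_add_le _ _).trans (add_le_add ?_ ?_)
      · rw [abs_mul]
        exact mul_le_mul (hB₁ x) hw6 (abs_nonneg _) hB₁0
      · rw [abs_mul, abs_mul, abs_two]
        refine mul_le_mul (mul_le_mul_of_nonneg_left (hB₂ x) two_pos.le)
          ((abs_add_le _ _).trans (add_le_add hb1 hb2)) (abs_nonneg _) (by positivity)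
    · rw [Set.indicator_of_notMem hxu, abs_zero]
      positivity
  · filter_upwards [self_mem_nhdsWithin] with d hd x hx
    by_cases hxu : x ∈ upperHalf m
    · rw [Set.indicator_of_mem hxu, hform d hd x hxu, hden2 x hx, dens_of_two_lt hx]
      simp
    · rw [Set.indicator_of_notMem hxu]
  · refine Eventually.of_forall fun x => ?_
    by_cases hxu : x ∈ upperHalf m
    · have hxn : 0 < x (Fin.last m) := hxu
      rw [Set.indicator_of_mem hxu]
      have hcX : Continuous fun d : ℝ => inner ℝ e x + τ * d := by fun_prop
      have hcY : Continuous fun d : ℝ => x (Fin.last m) + d ^ 2 := by fun_prop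
      have c1 : Continuous fun d : ℝ => reSqrt (inner ℝ e x + τ * d) (x (Fin.last m) + d ^ 2) :=
        continuous_reSqrt.comp (hcX.prodMk hcY)
      have c2 : Continuous fun d : ℝ => cmod (inner ℝ e x + τ * d) (x (Fin.last m) + d ^ 2) := by
        unfold cmod
        fun_prop
      have hpos1 : ∀ d : ℝ, 0 < x (Fin.last m) + d ^ 2 := fun d => by positivity
      have c3 : Continuous fun d : ℝ => reSqrtX (inner ℝ e x + τ * d) (x (Fin.last m) + d ^ 2) :=
        c1.div (by fun_prop) fun d => by
          have := cmod_pos (inner ℝ e x + τ * d) (hpos1 d)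
          positivity
      have c4 : Continuous fun d : ℝ => reSqrtY (inner ℝ e x + τ * d) (x (Fin.last m) + d ^ 2) :=
        hcY.div (by fun_prop) fun d => by
          have := cmod_pos (inner ℝ e x + τ * d) (hpos1 d)
          have := reSqrt_pos (inner ℝ e x + τ * d) (hpos1 d)
          positivity
      have c5 : Continuous fun d : ℝ => u x * (k x * reSqrt (inner ℝ e x + τ * d) (x (Fin.last m) + d ^ 2) +
        2 * dens x * (τ * d * reSqrtX (inner ℝ e x + τ * d) (x (Fin.last m) + d ^ 2) +
        d ^ 2 * reSqrtY (inner ℝ e x + τ * d) (x (Fin.last m) + d ^ 2))) := by fun_prop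
      have h1 := (c5.tendsto 0).mono_left (nhdsWithin_le_nhds (s := Ioi 0))
      simp only [mul_zero, add_zero, zero_mul, ne_eq, OfNat.ofNat_ne_zero, not_false_eq_true,
        zero_pow] at h1
      refine h1.congr' ?_
      filter_upwards [self_mem_nhdsWithin] with d hd
      rw [Set.indicator_of_mem hxu, hform d hd x hxu]
    · simp [hxu]

theorem abs_integral_le_of_support {μ : Measure (Space m)} [IsLocallyFiniteMeasure μ]
    {F : Space m → ℝ} {c : ℝ} (hs : ∀ x, 2 < ‖x‖ → F x = 0) (hb : ∀ᵐ x ∂μ, |F x| ≤ c) :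
    |∫ x, F x ∂μ| ≤ c * μ.real (Metric.closedBall 0 2) := by
  rw [← setIntegral_eq_integral_of_forall_compl_eq_zero (s := Metric.closedBall (0 : Space m) 2)
    fun x hx => hs x (by simpa using hx)]
  exact norm_setIntegral_le_of_norm_le_const_ae
    ((isCompact_closedBall (0 : Space m) 2).measure_lt_top)
    (ae_restrict_of_ae (show ∀ᵐ x ∂μ, ‖F x‖ ≤ c from hb))

theorem pd_cutBarrier_of_two_lt (e : Space m) (s : ℝ) {h : ℝ} (hh : 0 < h) (e' : Space m)
    {x : Space m} (hx : 2 < ‖x‖) : pd e' (cutBarrier e s h) x = 0 := by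
  rw [pd_cutBarrier e s hh, eta_of_two_lt hx, dens_of_two_lt hx]
  simp

theorem eta_le_one (x : Space m) : eta x ≤ 1 := Real.smoothTransition.le_one _

theorem tendsto_zero_of_sqrt_bound {F : ℝ → ℝ} {C : ℝ}
    (h : ∀ᶠ d in 𝓝[>] (0 : ℝ), |F d| ≤ C * √d) : Tendsto F (𝓝[>] 0) (𝓝 0) := by
  refine squeeze_zero_norm' h ?_
  have : Continuous fun d : ℝ => C * √d := by fun_prop
  have h1 := (this.tendsto 0).mono_left (nhdsWithin_le_nhds (s := Ioi 0))
  simpa using h1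

/-- The shift +d moves the support of μ to X ≥ d, where the normal derivative of the barrier is at
most √d. The cutoff contributes nothing, its gradient being tangential on the thin space. -/
theorem tendsto_integral_pd_en_cutBarrier {μ : Measure (Space m)} [IsLocallyFiniteMeasure μ]
    (hthin : ∀ᵐ x ∂μ, x (Fin.last m) = 0) {e : Space m} (he : e (Fin.last m) = 0)
    (hμ : ∀ᵐ x ∂μ, 0 ≤ inner ℝ e x) :
    Tendsto (fun d : ℝ => ∫ x, pd en (cutBarrier e (1 * d) (d ^ 2)) x ∂μ) (𝓝[>] 0) (𝓝 0) := by
  refine tendsto_zero_of_sqrt_bound (C := μ.real (Metric.closedBall 0 2)) ?_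
  filter_upwards [self_mem_nhdsWithin] with d hd
  have hd0 : (0 : ℝ) < d := hd
  have hd2 : 0 < d ^ 2 := by positivity
  rw [mul_comm (μ.real _)]
  refine abs_integral_le_of_support (μ := μ) (fun x hx => pd_cutBarrier_of_two_lt e _ hd2 en hx) ?_
  filter_upwards [hthin, hμ] with x hx hx2
  rw [pd_cutBarrier e _ hd2, pd_barrier_normal he _ hd2 (by rw [hx]; linarith), en,
    real_inner_comm _ x, inner_bv, hx, zero_add, mul_zero, mul_zero, sub_zero, abs_mul,
    abs_of_nonneg (eta_nonneg x), abs_of_nonneg (reSqrtY_nonneg _ hd2.le)]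
  refine (mul_le_of_le_one_right (reSqrtY_nonneg _ hd2.le) (eta_le_one x)).trans
    (reSqrtY_le_of_le hd0 ?_)
  linarith

/-- The shift -d moves the support of μ to X ≤ -d, where the barrier and its X-derivative are both
at most √d. -/
theorem tendsto_integral_pd_tangential_cutBarrier {μ : Measure (Space m)}
    [IsLocallyFiniteMeasure μ] (hthin : ∀ᵐ x ∂μ, x (Fin.last m) = 0) {e : Space m} (hn : ‖e‖ = 1)
    (hμ : ∀ᵐ x ∂μ, inner ℝ e x ≤ 0) {e' : Space m} (he' : e' (Fin.last m) = 0) :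
    Tendsto (fun d : ℝ => ∫ x, pd e' (cutBarrier e (-1 * d) (d ^ 2)) x ∂μ) (𝓝[>] 0) (𝓝 0) := by
  obtain ⟨B, hB0, hB⟩ := (isTest_dens (m := m)).exists_bound
  refine tendsto_zero_of_sqrt_bound
    (C := (‖e'‖ + B * (2 * ‖e'‖)) * μ.real (Metric.closedBall 0 2)) ?_
  filter_upwards [Ioc_mem_nhdsGT (zero_lt_one' ℝ)] with d hd
  have hd0 : (0 : ℝ) < d := hd.1
  have hd2 : 0 < d ^ 2 := by positivity
  rw [mul_right_comm]
  refine abs_integral_le_of_support (μ := μ) (fun x hx => pd_cutBarrier_of_two_lt e _ hd2 e' hx) ?_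
  filter_upwards [hthin, hμ] with x hx hx2
  have hraise : raise (d ^ 2) (x (Fin.last m)) = d ^ 2 := by
    rw [raise_of_le hd2 (by rw [hx]; linarith), hx, zero_add]
  have hX : inner ℝ e x + -1 * d ≤ -d := by linarith
  have h1 := reSqrtX_le_of_le_neg hd0 hX
  have h2 : reSqrt (inner ℝ e x + -1 * d) (d ^ 2) ≤ √d := by
    refine Real.le_sqrt_of_sq_le ((reSqrt_le_of_le_neg hd0 hX).trans ?_)
    nlinarith [hd.2, mul_pos hd0 hd0]
  by_cases hx3 : 2 < ‖x‖
  · rw [pd_cutBarrier_of_two_lt e _ hd2 e' hx3, abs_zero]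
    positivity
  · push Not at hx3
    rw [pd_cutBarrier e _ hd2, pd_barrier_tangential e _ hd2 he', barrier, hraise]
    refine (abs_sub _ _).trans ?_
    have a1 : |inner ℝ e e' * reSqrtX (inner ℝ e x + -1 * d) (d ^ 2) * eta x| ≤ ‖e'‖ * √d := by
      have h3 := abs_real_inner_le_norm e e'
      rw [hn, one_mul] at h3
      rw [abs_mul, abs_mul, abs_of_nonneg (eta_nonneg x), abs_of_nonneg (reSqrtX_nonneg _ _)]
      refine (mul_le_of_le_one_right (mul_nonneg (abs_nonneg _) (reSqrtX_nonneg _ _))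
        (eta_le_one x)).trans ?_
      exact mul_le_mul h3 h1 (reSqrtX_nonneg _ _) (norm_nonneg _)
    have a2 : |reSqrt (inner ℝ e x + -1 * d) (d ^ 2) * (dens x * inner ℝ x e')| ≤
        √d * (B * (2 * ‖e'‖)) := by
      have h3 := (abs_real_inner_le_norm x e').trans
        (mul_le_mul_of_nonneg_right hx3 (norm_nonneg e'))
      rw [abs_mul, abs_mul, abs_of_nonneg (reSqrt_nonneg _ _)]
      exact mul_le_mul h2 (mul_le_mul (hB x) h3 (abs_nonneg _) hB0) (by positivity)
        (Real.sqrt_nonneg _)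
    linarith

end Barrier

/-! ### Convex and concave functions on the line -/

section RealConvex

theorem ConcaveOn.le_of_even {g : ℝ → ℝ} (hg : ConcaveOn ℝ univ g) (heven : ∀ t, g (-t) = g t)
    {a b : ℝ} (hab : |a| ≤ b) : g b ≤ g a := by
  rcases (abs_nonneg a).trans hab |>.eq_or_lt with h0 | h0
  · have : a = 0 := abs_nonpos_iff.1 (h0 ▸ hab)
    rw [← h0, this]
  obtain ⟨h1, h2⟩ := abs_le.1 hab
  have h := hg.2 (mem_univ b) (mem_univ (-b))
    (show 0 ≤ (b + a) / (2 * b) from div_nonneg (by linarith) (by linarith))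
    (show 0 ≤ (b - a) / (2 * b) from div_nonneg (by linarith) (by linarith))
    (by field_simp; ring)
  have e1 : ((b + a) / (2 * b)) • b + ((b - a) / (2 * b)) • -b = a := by
    simp only [smul_eq_mul]
    field_simp
    ring
  rw [e1, heven] at h
  refine le_trans (le_of_eq ?_) h
  simp only [smul_eq_mul]
  field_simp
  ring

/-- A convex function on the line that is bounded above near `-∞` is monotone. -/
theorem ConvexOn.monotone_of_bounded {g : ℝ → ℝ} (hg : ConvexOn ℝ univ g) {T C : ℝ}
    (h : ∀ t ≤ T, g t ≤ C) : Monotone g := by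
  intro a b hab
  rcases hab.eq_or_lt with rfl | hab
  · exact le_rfl
  by_contra hlt
  push Not at hlt
  -- A drop between `a` and `b` has slope -c. Convexity keeps all slopes left of `a` at or below -c,
  -- so `g` grows at least linearly towards -∞ and exceeds `C`.
  set c := (g a - g b) / (b - a) with hc
  have hc0 : 0 < c := div_pos (by linarith) (by linarith)
  obtain ⟨t, ht1, ht2, ht3⟩ : ∃ t, t ≤ T ∧ t < a ∧ C < g a + c * (a - t) := by
    refine ⟨min T (a - (|C - g a| + 1) / c), min_le_left _ _, ?_, ?_⟩
    · refine (min_le_right _ _).trans_lt ?_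
      have : 0 < (|C - g a| + 1) / c := by positivity
      linarith
    · have h1 : (|C - g a| + 1) / c ≤ a - min T (a - (|C - g a| + 1) / c) := by
        linarith [min_le_right T (a - (|C - g a| + 1) / c)]
      rw [div_le_iff₀' hc0] at h1
      linarith [le_abs_self (C - g a)]
  have h2 := hg.slope_mono_adjacent (mem_univ t) (mem_univ b) ht2 hab
  rw [div_le_iff₀ (by linarith)] at h2
  have h3 : (g b - g a) / (b - a) = -c := by
    rw [hc, ← neg_div, neg_sub]
  rw [h3] at h2
  linarith [h t ht1]

end RealConvex

/-! ### Convex cones: interior and supporting directions -/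

section Cone
variable {m : ℕ}

/-- Take `z` to be the sum of a finite spanning subset of the cone. Adding a large multiple of it
makes all coefficients of a given vector nonnegative, so `z` is a relative interior point. -/
theorem exists_interior_direction {L : Set (Space m)} (h0 : (0 : Space m) ∈ L)
    (hadd : ∀ x ∈ L, ∀ y ∈ L, x + y ∈ L) (hsmul : ∀ r : ℝ, 0 ≤ r → ∀ x ∈ L, r • x ∈ L) :
    ∃ z ∈ L, ∀ x ∈ Submodule.span ℝ L, ∃ T : ℝ, ∀ t ≥ T, x + t • z ∈ L := by
  classical
  obtain ⟨s, hsL, hs⟩ := (Submodule.fg_span_iff_fg_span_finset_subset L).1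
    (IsNoetherian.noetherian (Submodule.span ℝ L))
  have hsum : ∀ (c : Space m → ℝ), (∀ b ∈ s, 0 ≤ c b) → ∑ b ∈ s, c b • b ∈ L := fun c hc =>
    Finset.sum_induction _ (· ∈ L) (fun x y hx hy => hadd x hx y hy) h0
      fun b hb => hsmul _ (hc b hb) b (hsL hb)
  refine ⟨∑ b ∈ s, b, by simpa using hsum (fun _ => 1) (fun _ _ => zero_le_one), fun x hx => ?_⟩
  rw [hs] at hx
  obtain ⟨c, -, rfl⟩ := Submodule.mem_span_finset.1 hx
  refine ⟨∑ b ∈ s, |c b|, fun t ht => ?_⟩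
  rw [Finset.smul_sum, ← Finset.sum_add_distrib]
  simp only [← add_smul]
  refine hsum _ fun b hb => ?_
  have h1 := Finset.single_le_sum (f := fun b => |c b|) (fun i _ => abs_nonneg _) hb
  have h2 := neg_abs_le (c b)
  linarith

theorem sub_smul_en_last (x : Space m) :
    (x - x (Fin.last m) • en : Space m) (Fin.last m) = 0 := by
  simp

/-- Separate `x₀` from the cone. A functional bounded above on a cone is nonpositive there, and
removing its normal component changes nothing on the thin space, where it is still positive at `x₀`.
-/
theorem exists_supporting_direction {L : Set (Space m)} (h0 : (0 : Space m) ∈ L)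
    (hthin : ∀ x ∈ L, x (Fin.last m) = 0) (hclosed : IsClosed L)
    (hadd : ∀ x ∈ L, ∀ y ∈ L, x + y ∈ L) (hsmul : ∀ r : ℝ, 0 ≤ r → ∀ x ∈ L, r • x ∈ L)
    {x₀ : Space m} (hx₀ : x₀ (Fin.last m) = 0) (hx₀L : x₀ ∉ L) :
    ∃ e : Space m, e (Fin.last m) = 0 ∧ ‖e‖ = 1 ∧ ∀ x ∈ L, inner ℝ e x ≤ 0 := by
  have hconv : Convex ℝ L := fun x hx y hy a b ha hb _ =>
    hadd _ (hsmul a ha x hx) _ (hsmul b hb y hy)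
  obtain ⟨f, u, hf1, hf2⟩ := geometric_hahn_banach_closed_point hconv hclosed hx₀L
  have hu : 0 < u := by simpa using hf1 0 h0
  have hf0 : ∀ x ∈ L, f x ≤ 0 := by
    intro x hx
    by_contra hpos
    push Not at hpos
    have := hf1 _ (hsmul (u / f x) (by positivity) x hx)
    rw [map_smul, smul_eq_mul, div_mul_cancel₀ _ hpos.ne'] at this
    exact lt_irrefl _ this
  set y := (InnerProductSpace.toDual ℝ (Space m)).symm f with hy
  have hyf : ∀ x, inner ℝ y x = f x := fun x => InnerProductSpace.toDual_symm_apply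
  set y' := y - y (Fin.last m) • (en : Space m) with hy'
  have hy'f : ∀ x : Space m, x (Fin.last m) = 0 → inner ℝ y' x = f x := fun x hx => by
    rw [hy', inner_sub_left, real_inner_smul_left, en, inner_bv, hx, mul_zero, sub_zero, hyf]
  have hne : y' ≠ 0 := by
    intro h
    have := hy'f x₀ hx₀
    rw [h, inner_zero_left] at this
    linarith
  refine ⟨‖y'‖⁻¹ • y', ?_, norm_smul_inv_norm hne, fun x hx => ?_⟩
  · rw [PiLp.smul_apply, sub_smul_en_last, smul_zero]
  · rw [real_inner_smul_left, hy'f x (hthin x hx)]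
    exact mul_nonpos_of_nonneg_of_nonpos (inv_nonneg.2 (norm_nonneg _)) (hf0 x hx)

end Cone

/-- A measure that vanishes on nonnegative test functions vanishes on all test functions. -/
theorem integral_eq_zero_of_nonneg_tests {m : ℕ} {μ : Measure (Space m)} [IsLocallyFiniteMeasure μ]
    (h : ∀ φ : Space m → ℝ, IsTest φ → (∀ x, 0 ≤ φ x) → ∫ x, φ x ∂μ = 0) {φ : Space m → ℝ}
    (hφ : IsTest φ) : ∫ x, φ x ∂μ = 0 := by
  obtain ⟨R, hR0, hR⟩ := hφ.exists_radius
  obtain ⟨C, hC0, hC⟩ := hφ.exists_bound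
  -- Writing φ as (C b + φ) - C b makes it a difference of two nonnegative test functions.
  let b : ContDiffBump (0 : Space m) := ⟨R, R + 1, hR0, by linarith⟩
  have hb : IsTest fun x => C * b x :=
    IsTest.mul_left (φ := b) ⟨b.contDiff, b.hasCompactSupport⟩ contDiff_const
  have h1 := h _ hb fun x => mul_nonneg hC0 b.nonneg
  have h2 := h _ (hb.add hφ) fun x => by
    by_cases hx : ‖x‖ ≤ R
    · rw [b.one_of_mem_closedBall (by simpa using hx), mul_one]
      linarith [neg_abs_le (φ x), hC x]
    · rw [hR x (not_le.1 hx), add_zero]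
      exact mul_nonneg hC0 b.nonneg
  rw [integral_add (hb.integrable μ) (hφ.integrable μ), h1, zero_add] at h2
  exact h2

/-! ### Even solutions: signs and the contact cone -/

/-- Homogeneous solutions that are even in the normal variable and have positive degree and
nonzero Laplacian. -/
structure IsEvenSolution {m : ℕ} (q : Space m → ℝ) (μ : Measure (Space m)) (lam : ℝ) : Prop where
  continuous : Continuous q
  even : ∀ x, q (mirror x) = q x
  laplacian : HasNegLaplacian q μ
  thin : ∀ᵐ x ∂μ, x (Fin.last m) = 0
  zero : ∀ᵐ x ∂μ, q x = 0
  nonneg : ∀ x : Space m, x (Fin.last m) = 0 → 0 ≤ q x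
  convex : IsConvexAlongThin q
  homogeneous : IsHomogeneousOfDegree q lam
  degree_pos : 0 < lam
  nontrivial : ∃ φ : Space m → ℝ, IsTest φ ∧ (∀ x, 0 ≤ φ x) ∧ ∫ x, φ x ∂μ ≠ 0

namespace IsEvenSolution
variable {m : ℕ} {q : Space m → ℝ} {μ : Measure (Space m)} {lam : ℝ}

theorem apply_zero (h : IsEvenSolution q μ lam) : q 0 = 0 := by
  have h1 := h.homogeneous 2 two_pos 0
  rw [smul_zero] at h1
  have h2 : (1 : ℝ) < 2 ^ lam := Real.one_lt_rpow one_lt_two h.degree_pos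
  have h3 : (2 ^ lam - 1) * q 0 = 0 := by linarith
  rcases mul_eq_zero.1 h3 with h4 | h4
  · linarith
  · exact h4

theorem le_of_abs_le (h : IsEvenSolution q μ lam) {y : Space m} (hy : y (Fin.last m) = 0) {a b : ℝ}
    (hab : |a| ≤ b) : q (y + b • en) ≤ q (y + a • en) := by
  refine (concaveOn_normal h.continuous h.convex h.laplacian y).le_of_even (fun t => ?_) hab
  rw [← h.even, map_add, map_smul, mirror_en, mirror_of_thin hy, smul_neg, neg_smul, neg_neg]

/-- An even concave function on the normal line is largest at its centre, which is the projection to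
the thin space. -/
theorem le_projection (h : IsEvenSolution q μ lam) (x : Space m) :
    q x ≤ q (x - x (Fin.last m) • en) := by
  have h1 := h.le_of_abs_le (sub_smul_en_last x) (a := 0) (b := |x (Fin.last m)|) (by simp)
  rw [zero_smul, add_zero] at h1
  refine le_trans (le_of_eq ?_) h1
  rcases abs_choice (x (Fin.last m)) with h2 | h2
  · rw [h2, sub_add_cancel]
  · rw [h2, ← h.even x, mirror_eq]
    congr 1
    rw [two_mul, add_smul, neg_smul]
    abel

theorem normalDeriv_nonpos (h : IsEvenSolution q μ lam) {D : Space m → ℝ}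
    (hD : IsSymmDeriv en q D) {x : Space m} (hx : x ∈ upperHalf m) : D x ≤ 0 := by
  have hx' : 0 < x (Fin.last m) := hx
  refine le_of_tendsto (hD.lim x) ?_
  filter_upwards [Ioc_mem_nhdsGT hx'] with s hs
  refine div_nonpos_of_nonpos_of_nonneg ?_ (by linarith [hs.1])
  have h1 := h.le_of_abs_le (sub_smul_en_last x) (a := x (Fin.last m) - s) (b := x (Fin.last m) + s)
    (by rw [abs_of_nonneg (by linarith [hs.2])]; linarith [hs.1])
  rw [add_smul, sub_smul, ← add_assoc, sub_add_cancel, ← add_sub_assoc, sub_add_cancel] at h1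
  linarith

/-- Convexity bounds `q` at the midpoint by zero, homogeneity transfers this to the sum, and `q` is
nonnegative on the thin space. -/
theorem contact_add (h : IsEvenSolution q μ lam) {x y : Space m} (hx : x (Fin.last m) = 0)
    (hx0 : q x = 0) (hy : y (Fin.last m) = 0) (hy0 : q y = 0) : q (x + y) = 0 := by
  have h1 := h.convex.two_mul_le (e := (1 / 2 : ℝ) • (x - y)) (by simp [hx, hy])
    ((1 / 2 : ℝ) • (x + y)) 1
  have e1 : (1 / 2 : ℝ) • (x + y) + (1 : ℝ) • (1 / 2 : ℝ) • (x - y) = x := by module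
  have e2 : (1 / 2 : ℝ) • (x + y) - (1 : ℝ) • (1 / 2 : ℝ) • (x - y) = y := by module
  rw [e1, e2, hx0, hy0, h.homogeneous _ (by norm_num)] at h1
  have h2 : (0 : ℝ) < (1 / 2) ^ lam := Real.rpow_pos_of_pos (by norm_num) _
  have h3 := h.nonneg (x + y) (by simp [hx, hy])
  nlinarith

theorem contact_smul (h : IsEvenSolution q μ lam) {x : Space m} (hx0 : q x = 0) {r : ℝ}
    (hr : 0 ≤ r) : q (r • x) = 0 := by
  rcases hr.eq_or_lt with rfl | hr
  · rw [zero_smul, h.apply_zero]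
  · rw [h.homogeneous r hr, hx0, mul_zero]

theorem exists_normalDeriv (h : IsEvenSolution q μ lam) : ∃ D, IsSymmDeriv en q D :=
  exists_symmDeriv_of_concave h.continuous en fun x =>
    concaveOn_normal h.continuous h.convex h.laplacian x

end IsEvenSolution

section Halfspace
variable {m : ℕ}

/-- The weighted mean of a nonnegative homogeneous function over the upper half space is positive
unless the function vanishes. -/
theorem integral_indicator_pos_or_ae_zero {u : Space m → ℝ} {lam : ℝ} (hu : LocBdd u)
    (hlam : 0 < lam) (hhom : IsHomogeneousOfDegree u (lam - 1))
    (h0 : ∀ x ∈ upperHalf m, 0 ≤ u x) (e : Space m) :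
    0 < ∫ x, (upperHalf m).indicator
        (fun x => u x * reSqrt (inner ℝ e x) (x (Fin.last m))) x * dens x ∨
      ∀ᵐ x ∂(volume.restrict (upperHalf m)), u x = 0 := by
  set U := (upperHalf m).indicator
    (fun x => u x * reSqrt (inner ℝ e x) (x (Fin.last m))) with hU
  have hU0 : ∀ x, 0 ≤ U x := fun x =>
    Set.indicator_nonneg (fun x hx => mul_nonneg (h0 x hx) (reSqrt_nonneg _ _)) x
  have hUl : LocBdd U := (hu.mul (LocBdd.of_continuous (continuous_reSqrt_inner e))).indicator
    measurableSet_upperHalf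
  rcases (integral_nonneg fun x => mul_nonneg (hU0 x) (dens_nonneg x) :
    0 ≤ ∫ x, U x * dens x).eq_or_lt with h1 | h1
  · right
    have hm : (0 : ℝ) ≤ m := Nat.cast_nonneg m
    have h2 := ae_eq_zero_of_integral_mul_dens hUl (isHomogeneous_indicator_mul_reSqrt hhom e) hU0
      (by linarith) h1.symm
    rw [ae_restrict_iff' measurableSet_upperHalf]
    filter_upwards [h2] with x hx hxu
    rw [hU, Set.indicator_of_mem hxu] at hx
    have hx' : 0 < x (Fin.last m) := hxu
    exact (mul_eq_zero.1 hx).resolve_right (reSqrt_pos _ hx').ne'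
  · exact Or.inl h1

end Halfspace

/-! ### The two bounds on the degree -/

/-- The contact set of `q`. -/
def contactSet {m : ℕ} (q : Space m → ℝ) : Set (Space m) := {x | x (Fin.last m) = 0 ∧ q x = 0}

namespace IsEvenSolution
variable {m : ℕ} {q : Space m → ℝ} {μ : Measure (Space m)} {lam : ℝ}

theorem zero_mem_contactSet (h : IsEvenSolution q μ lam) : 0 ∈ contactSet q :=
  ⟨rfl, h.apply_zero⟩

theorem add_mem_contactSet (h : IsEvenSolution q μ lam) :
    ∀ x ∈ contactSet q, ∀ y ∈ contactSet q, x + y ∈ contactSet q := fun x hx y hy =>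
  ⟨by simp [hx.1, hy.1], h.contact_add hx.1 hx.2 hy.1 hy.2⟩

theorem smul_mem_contactSet (h : IsEvenSolution q μ lam) :
    ∀ r : ℝ, 0 ≤ r → ∀ x ∈ contactSet q, r • x ∈ contactSet q := fun _ hr x hx =>
  ⟨by simp [hx.1], h.contact_smul hx.2 hr⟩

theorem isClosed_contactSet (h : IsEvenSolution q μ lam) : IsClosed (contactSet q) :=
  (isClosed_eq (contDiff_coord (Fin.last m)).continuous continuous_const).inter
    (isClosed_eq h.continuous continuous_const)

theorem ae_mem_contactSet (h : IsEvenSolution q μ lam) : ∀ᵐ x ∂μ, x ∈ contactSet q := by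
  filter_upwards [h.thin, h.zero] with x h1 h2 using ⟨h1, h2⟩

variable [IsLocallyFiniteMeasure μ]

/-- The lower bound on the degree, obtained from the normal derivative. -/
theorem three_halves_le (h : IsEvenSolution q μ lam) {e : Space m} (he : e (Fin.last m) = 0)
    (hn : ‖e‖ = 1) (hsupp : ∀ x ∈ contactSet q, inner ℝ e x ≤ 0) : 3 / 2 ≤ lam := by
  obtain ⟨D, hD⟩ := h.exists_normalDeriv
  have hne : ‖-e‖ = 1 := by rw [norm_neg, hn]
  have hel : (-e) (Fin.last m) = 0 := by simp [he]
  have hsupp' : ∀ᵐ x ∂μ, 0 ≤ inner ℝ (-e) x := by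
    filter_upwards [h.ae_mem_contactSet] with x hx
    rw [inner_neg_left]
    linarith [hsupp x hx]
  have hhom : IsHomogeneousOfDegree (fun x => -D x) (lam - 1) := fun r hr x => by
    simp only [hD.homogeneous h.homogeneous r hr x, mul_neg]
  have hlim := tendsto_integral_laplacian_cutBarrier hD.neg.locBdd hhom hel hne (one_pow 2)
  have hlim' := (tendsto_integral_pd_en_cutBarrier h.thin hel hsupp').const_mul (-(1 / 2 : ℝ))
  rw [mul_zero] at hlim'
  have hle := le_of_tendsto_of_tendsto hlim' hlim (by
    filter_upwards [self_mem_nhdsWithin] with d hd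
    have hd2 : (0 : ℝ) < d ^ 2 := pow_pos hd 2
    have := integral_normal_deriv_mul_laplacian h.continuous h.even h.convex h.laplacian h.thin hD
      (isTest_cutBarrier (-e) (1 * d) hd2)
      fun x _ => mul_nonneg (reSqrt_nonneg _ _) (eta_nonneg x)
    simp only [neg_mul, integral_neg]
    linarith)
  rcases integral_indicator_pos_or_ae_zero hD.neg.locBdd h.degree_pos hhom
    (fun x hx => neg_nonneg.2 (h.normalDeriv_nonpos hD hx)) (-e) with h1 | h1
  · have := nonneg_of_mul_nonneg_left hle h1
    linarith
  -- If the normal derivative vanishes above the thin space, the weak form equates a nonnegative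
  -- tangential term with -1/2 of the mass of φ, so μ would be trivial.
  · exfalso
    obtain ⟨φ, hφ, hφ0, hφ1⟩ := h.nontrivial
    have h2 := weak_form_upperHalf h.continuous h.even h.laplacian h.thin hD hφ
    have h3 := integral_upperHalf_mul_tl_nonneg h.continuous h.convex hφ hφ0
    have h4 : ∫ x in upperHalf m, (q x * tl φ x - D x * pd en φ x) =
        ∫ x in upperHalf m, q x * tl φ x := by
      refine integral_congr_ae ?_
      filter_upwards [h1] with x hx
      rw [neg_eq_zero.1 hx, zero_mul, sub_zero]
    rw [h4] at h2
    have h5 : 0 ≤ ∫ x, φ x ∂μ := integral_nonneg hφ0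
    exact hφ1 (by linarith)

/-- The upper bound on the degree, obtained from a tangential derivative. -/
theorem le_three_halves (h : IsEvenSolution q μ lam) {e : Space m} (he : e (Fin.last m) = 0)
    (hn : ‖e‖ = 1) (hsupp : ∀ x ∈ contactSet q, inner ℝ e x ≤ 0)
    (hspan : ∀ x : Space m, x (Fin.last m) = 0 → x ∈ Submodule.span ℝ (contactSet q))
    {x₀ : Space m} (hx₀ : x₀ (Fin.last m) = 0) (hx₀q : q x₀ ≠ 0) : lam ≤ 3 / 2 := by
  obtain ⟨D, hD⟩ := h.exists_normalDeriv
  obtain ⟨z, hz, hzT⟩ := exists_interior_direction h.zero_mem_contactSet h.add_mem_contactSet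
    h.smul_mem_contactSet
  have hel : (-z) (Fin.last m) = 0 := by simp [hz.1]
  obtain ⟨v, hv, hvle⟩ := exists_symmDeriv_of_convex h.continuous (-z) fun x => h.convex x (-z) hel
  -- Far back along the line the projection of the point lies in the contact cone, so `q ≤ 0` there
  -- by `le_projection`. A convex function bounded above near -∞ is monotone.
  have hmono : ∀ x, Monotone fun t : ℝ => q (x + t • -z) := fun x => by
    obtain ⟨T, hT⟩ := hzT _ (hspan _ (sub_smul_en_last x))
    refine (h.convex x (-z) hel).monotone_of_bounded (T := -T) (C := 0) fun t ht => ?_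
    have h1 := h.le_projection (x + t • -z)
    have h2 : (x + t • -z : Space m) - (x + t • -z : Space m) (Fin.last m) • en =
        x - x (Fin.last m) • en + (-t) • z := by
      rw [PiLp.add_apply, PiLp.smul_apply, hel, smul_zero, add_zero, smul_neg, neg_smul]
      abel
    rw [h2, (hT (-t) (by linarith)).2] at h1
    exact h1
  have hdiff : ∀ x, 0 ≤ q x - q (x - -z) := fun x => by
    have := hmono x (show (-1 : ℝ) ≤ 0 by norm_num)
    simp only [zero_smul, add_zero, neg_smul, one_smul, ← sub_eq_add_neg] at this
    linarith
  have hv0 : ∀ x, 0 ≤ v x := fun x => (hdiff x).trans (hvle x)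
  have hhom := hv.homogeneous h.homogeneous
  have hlim := tendsto_integral_laplacian_cutBarrier hv.locBdd hhom he hn
    (show (-1 : ℝ) ^ 2 = 1 by norm_num)
  have hsupp' : ∀ᵐ x ∂μ, inner ℝ e x ≤ 0 := by
    filter_upwards [h.ae_mem_contactSet] with x hx using hsupp x hx
  have hlim' := (tendsto_integral_pd_tangential_cutBarrier h.thin hn hsupp' hel).const_mul
    (1 / 2 : ℝ)
  rw [mul_zero] at hlim'
  have hle := le_of_tendsto_of_tendsto hlim hlim' (by
    filter_upwards [self_mem_nhdsWithin] with d hd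
    have hd2 : (0 : ℝ) < d ^ 2 := pow_pos hd 2
    refine integral_tangential_deriv_mul_laplacian h.continuous h.even h.laplacian h.thin hD hel hv
      hv0 (isTest_cutBarrier e (-1 * d) hd2)
      (isTest_dens.mul_left (contDiff_barrier e (-1 * d) hd2)) fun x hx => ?_
    rw [pd_cutBarrier e _ hd2, pd_barrier_normal he _ hd2 (by linarith),
      real_inner_comm en x, en, inner_bv]
    have h1 := mul_nonneg (reSqrtY_nonneg (inner ℝ e x + -1 * d)
      (show 0 ≤ x (Fin.last m) + d ^ 2 by linarith)) (eta_nonneg x)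
    linarith)
  rcases integral_indicator_pos_or_ae_zero hv.locBdd h.degree_pos hhom (fun x _ => hv0 x) e
    with h1 | h1
  · by_contra hlt
    push Not at hlt
    exact absurd hle (not_le.2 (mul_pos (by linarith) h1))
  -- A vanishing derivative makes `q` invariant under translation by `z`, first above the thin space
  -- and then on it by closure. But `x₀ + k z` enters the contact cone for large k, contradicting `q
  -- x₀ ≠ 0`.
  · exfalso
    have hc2 : Continuous fun x => q (x - -z) :=
      h.continuous.comp (continuous_id.sub continuous_const)
    have heq : EqOn q (fun x => q (x - -z)) (upperHalf m) := by
      refine Measure.eqOn_open_of_ae_eq (μ := volume) ?_ isOpen_upperHalf h.continuous.continuousOn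
        hc2.continuousOn
      filter_upwards [h1] with x hx
      linarith [hdiff x, hvle x]
    have hthin : ∀ x : Space m, x (Fin.last m) = 0 → q x = q (x + z) := fun x hx => by
      have hcl : EqOn q (fun x => q (x - -z)) (closure (upperHalf m)) :=
        heq.closure h.continuous hc2
      have hmem : x ∈ closure (upperHalf m) := by
        have hl : Tendsto (fun s : ℝ => x + s • (en : Space m)) (𝓝[>] 0) (𝓝 x) := by
          have : Continuous fun s : ℝ => x + s • (en : Space m) := by fun_prop
          simpa using (this.tendsto 0).mono_left nhdsWithin_le_nhds
        refine mem_closure_of_tendsto hl ?_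
        filter_upwards [self_mem_nhdsWithin] with s hs
        simpa [upperHalf, hx, en, bv_apply] using hs
      have := hcl hmem
      simpa using this
    have hk : ∀ k : ℕ, q x₀ = q (x₀ + (k : ℝ) • z) := fun k => by
      induction k with
      | zero => simp
      | succ k ih =>
        rw [ih, hthin _ (by simp [hx₀, hz.1]), Nat.cast_succ, add_smul, one_smul, add_assoc]
    obtain ⟨T, hT⟩ := hzT _ (hspan x₀ hx₀)
    obtain ⟨k, hkT⟩ := exists_nat_ge T
    exact hx₀q ((hk k).trans (hT k hkT).2)

/-- The contact set spans the thin space. -/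
theorem mem_span_contactSet (h : IsEvenSolution q μ lam) {x : Space m}
    (hx : x (Fin.last m) = 0) : x ∈ Submodule.span ℝ (contactSet q) := by
  by_contra hxs
  set S := Submodule.span ℝ (contactSet q) with hS
  obtain ⟨D, hD⟩ := h.exists_normalDeriv
  obtain ⟨φ, hφ, hφ0, hφ1⟩ := h.nontrivial
  have hthin : ∀ y ∈ S, y (Fin.last m) = 0 := fun y hy => by
    induction hy using Submodule.span_induction with
    | mem y hy => exact hy.1
    | zero => rfl
    | add y z _ _ h1 h2 => simp [h1, h2]
    | smul r y _ h1 => simp [h1]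
  -- The component of `x` orthogonal to the span is a tangential normal vector of a hyperplane
  -- containing the contact set. A solution carries no mass there, against nontriviality of μ.
  refine hφ1 (integral_eq_zero_of_contact_subset (e := x - S.starProjection x) h.continuous h.even
    h.convex h.laplacian h.thin hD ?_ (fun h0 => hxs ?_) ?_ hφ hφ0)
  · simp [hx, hthin _ (S.starProjection_apply_mem x)]
  · rw [sub_eq_zero.1 h0]
    exact S.starProjection_apply_mem x
  · filter_upwards [h.ae_mem_contactSet] with y hy
    exact (S.mem_orthogonal' _).1 (S.sub_starProjection_mem_orthogonal x) y
      (Submodule.subset_span hy)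

end IsEvenSolution

/-! ### Solutions depending on the normal variable only -/

section Planar
variable {m : ℕ}

theorem pd_coord_mul (i : Fin (m + 1)) {g : Space m → ℝ} (hg : Differentiable ℝ g) (x : Space m) :
    pd (bv i) (fun x => x i * g x) x = x i * pd (bv i) g x + g x := by
  rw [pd_mul _ (fun x => (hasFDerivAt_coord i x).differentiableAt) hg]
  have : pd (bv i) (fun x : Space m => x i) x = 1 := by
    rw [pd, (hasFDerivAt_coord i x).fderiv]
    simp [bv_apply]
  rw [this, one_mul]

variable {q : Space m → ℝ} {lam : ℝ}

/-- Each tangential summand of the weak Euler identity equals minus the pairing of `q` with ψ, by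
invariance. Subtracting these m terms reduces the dimension to one. -/
theorem integral_mul_coord_mul_pd_en (hq : LocBdd q) (hhom : IsHomogeneousOfDegree q lam)
    (hinv : ∀ e : Space m, e (Fin.last m) = 0 → ∀ x (s : ℝ), q (x + s • e) = q x)
    {ψ : Space m → ℝ} (hψ : IsTest ψ) :
    ∫ x, q x * (x (Fin.last m) * pd en ψ x) = -(1 + lam) * ∫ x, q x * ψ x := by
  have hcoord : ∀ i, IsTest fun x : Space m => x i * pd (bv i) ψ x := fun i =>
    (hψ.pd _).mul_left (contDiff_coord i)
  have htan : ∀ i : Fin m, ∫ x, q x * (x i.castSucc * pd (bv i.castSucc) ψ x) =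
      -∫ x, q x * ψ x := fun i => by
    have h1 := integral_pd_eq_zero hq (hψ.mul_left (contDiff_coord i.castSucc)) (bv i.castSucc)
      (hinv _ (bv_castSucc_last i))
    simp only [pd_coord_mul _ hψ.differentiable, mul_add] at h1
    rw [integral_add (hq.integrable_mul (hcoord _)) (hq.integrable_mul hψ)] at h1
    linarith
  have h2 := integral_homogeneous_mul_rad hq hhom hψ
  simp only [rad_eq_sum, Finset.mul_sum] at h2
  rw [integral_finsetSum _ fun i _ => hq.integrable_mul (hcoord i), Fin.sum_univ_castSucc] at h2
  simp only [htan, Finset.sum_const, Finset.card_univ, Fintype.card_fin, nsmul_eq_mul] at h2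
  simp only [en]
  linarith

/-- A homogeneous function of the normal variable alone that is harmonic off the thin space has
degree one. -/
theorem degree_eq_one_of_invariant {μ : Measure (Space m)} (hc : Continuous q)
    (hhom : IsHomogeneousOfDegree q lam) (hpos : 0 < lam)
    (hinv : ∀ e : Space m, e (Fin.last m) = 0 → ∀ x (s : ℝ), q (x + s • e) = q x)
    (hμ : HasNegLaplacian q μ) (hthin : ∀ᵐ x ∂μ, x (Fin.last m) = 0)
    (hne : ∫ x, q x * eta x ≠ 0) : lam = 1 := by
  have hq := LocBdd.of_continuous hc
  have hn := contDiff_coord (Fin.last m)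
  -- The factor x_n annihilates the measure. By the one-dimensional Euler identity the remaining
  -- normal terms have coefficient 2 - (1 + λ).
  have key : ∀ χ : Space m → ℝ, IsTest χ → (1 - lam) * ∫ x, q x * pd en χ x = 0 := fun χ hχ => by
    have hφ : IsTest fun x : Space m => x (Fin.last m) * χ x := hχ.mul_left hn
    have h1 := hμ.apply_test hφ
    rw [integral_mul_laplacian_eq hc hφ, integral_eq_zero_of_ae (μ := μ) (by
      filter_upwards [hthin] with x hx
      rw [hx, zero_mul, Pi.zero_apply]), neg_zero] at h1
    have h2 : ∫ x, q x * tl (fun x : Space m => x (Fin.last m) * χ x) x = 0 := by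
      simp only [tl, Finset.mul_sum]
      rw [integral_finsetSum _ fun i _ => hq.integrable_mul ((hφ.pd _).pd _)]
      exact Finset.sum_eq_zero fun i _ =>
        integral_pd_eq_zero hq (hφ.pd _) _ (hinv _ (bv_castSucc_last i))
    have h3 : ∀ x, pd en (pd en fun x : Space m => x (Fin.last m) * χ x) x =
        x (Fin.last m) * pd en (pd en χ) x + 2 * pd en χ x := fun x => by
      have : (pd en fun x : Space m => x (Fin.last m) * χ x) =
          fun x => x (Fin.last m) * pd en χ x + χ x :=
        funext fun x => pd_coord_mul _ hχ.differentiable x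
      rw [this, pd_add _ ((hχ.pd en).mul_left hn).differentiable hχ.differentiable, en,
        pd_coord_mul _ (hχ.pd _).differentiable]
      ring
    simp only [h3, mul_add] at h1
    rw [h2, integral_add (hq.integrable_mul (((hχ.pd en).pd en).mul_left hn))
      (hq.integrable_mul ((hχ.pd en).mul_left contDiff_const)),
      integral_mul_coord_mul_pd_en hq hhom hinv (hχ.pd en)] at h1
    simp only [mul_left_comm (q _) 2, integral_const_mul] at h1
    linarith
  -- For χ = x_n `eta` the remaining pairing is -λ times the nonzero mean against `eta`.
  have h1 := key _ (isTest_eta.mul_left hn)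
  simp only [en, pd_coord_mul _ isTest_eta.differentiable, mul_add] at h1
  rw [integral_add (hq.integrable_mul ((isTest_eta.pd _).mul_left hn)) (hq.integrable_mul isTest_eta)]
    at h1
  have h2 := integral_mul_coord_mul_pd_en hq hhom hinv isTest_eta
  rw [en] at h2
  rw [h2] at h1
  have h3 : (1 - lam) * (lam * ∫ x, q x * eta x) = 0 := by linarith
  have := (mul_eq_zero.1 h3).resolve_right (mul_ne_zero hpos.ne' hne)
  linarith

end Planar

/-! ### Classification of even solutions -/

namespace IsEvenSolution
variable {m : ℕ} {q : Space m → ℝ} {μ : Measure (Space m)} {lam : ℝ}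

theorem exists_apply_ne_zero (h : IsEvenSolution q μ lam) : ∃ x, q x ≠ 0 := by
  by_contra! h0
  obtain ⟨φ, hφ, -, hφ1⟩ := h.nontrivial
  have h1 := h.laplacian.apply_test hφ
  simp only [h0, zero_mul, integral_zero] at h1
  exact hφ1 (by linarith)

/-- Full contact gives q ≤ 0 everywhere. Along every tangential line `q` is then monotone in both
directions, hence constant, and only the profile |x_n|^λ remains. -/
theorem eq_neg_abs_of_contact (h : IsEvenSolution q μ lam)
    (hfull : ∀ x : Space m, x (Fin.last m) = 0 → q x = 0) :
    lam = 1 ∧ ∃ b : ℝ, 0 < b ∧ ∀ x : Space m, q x = -(b * |x (Fin.last m)|) := by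
  have hle : ∀ x, q x ≤ 0 := fun x => (h.le_projection x).trans_eq (hfull _ (sub_smul_en_last x))
  have hmono : ∀ e : Space m, e (Fin.last m) = 0 → ∀ x, Monotone fun t : ℝ => q (x + t • e) :=
    fun e he x => (h.convex x e he).monotone_of_bounded (T := 0) fun t _ => hle _
  have hinv1 : ∀ e : Space m, e (Fin.last m) = 0 → ∀ x, q (x + e) = q x := fun e he x => by
    have h1 := hmono e he x zero_le_one
    have h2 := hmono (-e) (by simp [he]) (x + e) zero_le_one
    simp only [zero_smul, add_zero, one_smul, add_neg_cancel_right] at h1 h2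
    exact le_antisymm h2 h1
  have hinv : ∀ e : Space m, e (Fin.last m) = 0 → ∀ x (s : ℝ), q (x + s • e) = q x :=
    fun e he x s => hinv1 _ (by simp [he]) x
  have hform : ∀ x : Space m, q x = |x (Fin.last m)| ^ lam * q en := fun x => by
    have h1 := hinv1 _ (sub_smul_en_last x) (x (Fin.last m) • en)
    rw [add_sub_cancel] at h1
    rw [h1]
    have h2 : q (x (Fin.last m) • en) = q (|x (Fin.last m)| • en) := by
      rcases abs_choice (x (Fin.last m)) with h2 | h2
      · rw [h2]
      · rw [h2, ← h.even, map_smul, mirror_en, smul_neg, neg_smul]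
    rw [h2]
    rcases (abs_nonneg (x (Fin.last m))).eq_or_lt with h3 | h3
    · rw [← h3, zero_smul, h.apply_zero, Real.zero_rpow h.degree_pos.ne', zero_mul]
    · exact h.homogeneous _ h3 _
  have hen : q en < 0 := (hle en).lt_of_ne fun h0 => by
    obtain ⟨x, hx⟩ := h.exists_apply_ne_zero
    exact hx (by rw [hform, h0, mul_zero])
  have hneg : ∫ x, q x * eta x ≠ 0 := fun h0 => by
    have h1 : ∫ x, -q x * eta x = 0 := by simp only [neg_mul, integral_neg, h0, neg_zero]
    have hcont : Continuous fun x => -q x * eta x := h.continuous.neg.mul isTest_eta.continuous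
    rw [integral_eq_zero_iff_of_nonneg
      (fun x => mul_nonneg (neg_nonneg.2 (hle x)) (eta_nonneg x))
      ((LocBdd.of_continuous h.continuous.neg).integrable_mul isTest_eta)] at h1
    have h2 := congrFun ((hcont.ae_eq_iff_eq volume continuous_zero).1 h1) en
    simp [eta_eq_one norm_en.le] at h2
    exact hen.ne h2
  have h1 := degree_eq_one_of_invariant h.continuous h.homogeneous h.degree_pos hinv h.laplacian
    h.thin hneg
  refine ⟨h1, -q en, neg_pos.2 hen, fun x => ?_⟩
  rw [hform, h1, Real.rpow_one]
  ring

theorem degree [IsLocallyFiniteMeasure μ] (h : IsEvenSolution q μ lam) :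
    lam = 3 / 2 ∨
      (lam = 1 ∧ ∃ b : ℝ, 0 < b ∧ ∀ x : Space m, q x = -(b * |x (Fin.last m)|)) := by
  by_cases hfull : ∀ x : Space m, x (Fin.last m) = 0 → q x = 0
  · exact Or.inr (h.eq_neg_abs_of_contact hfull)
  · push Not at hfull
    obtain ⟨x₀, hx₀, hx₀q⟩ := hfull
    obtain ⟨e, he, hn, hsupp⟩ := exists_supporting_direction h.zero_mem_contactSet
      (fun x hx => hx.1) h.isClosed_contactSet h.add_mem_contactSet h.smul_mem_contactSet hx₀
      fun hx => hx₀q hx.2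
    exact Or.inl (le_antisymm
      (h.le_three_halves he hn hsupp (fun x hx => h.mem_span_contactSet hx) hx₀ hx₀q)
      (h.three_halves_le he hn hsupp))

end IsEvenSolution

/-! ### Reduction to the even part -/

section EvenPart
variable {m : ℕ}

/-- The part of `q` that is even in the normal variable. -/
noncomputable def evenPart (q : Space m → ℝ) (x : Space m) : ℝ := (q x + q (mirror x)) / 2

theorem pd_comp_mirror {φ : Space m → ℝ} (h : Differentiable ℝ φ) (e x : Space m) :
    pd e (fun x => φ (mirror x)) x = pd (mirror e) φ (mirror x) := by
  have h1 : HasFDerivAt (fun x => φ (mirror x)) _ x := (h (mirror x)).hasFDerivAt.comp x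
    (mirror : Space m ≃ₗᵢ[ℝ] Space m).toContinuousLinearEquiv.hasFDerivAt
  rw [pd, h1.fderiv]
  rfl

theorem IsTest.comp_mirror {φ : Space m → ℝ} (h : IsTest φ) : IsTest fun x => φ (mirror x) := by
  obtain ⟨R, -, hR⟩ := h.exists_radius
  exact isTest_of_radius
    (h.smooth.comp (mirror : Space m ≃ₗᵢ[ℝ] Space m).toContinuousLinearEquiv.contDiff) R
    fun x hx => hR _ (by rwa [LinearIsometryEquiv.norm_map])

theorem pd_pd_comp_mirror {φ : Space m → ℝ} (h : IsTest φ) (e x : Space m) :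
    pd e (pd e fun x => φ (mirror x)) x = pd (mirror e) (pd (mirror e) φ) (mirror x) := by
  have : (pd e fun x => φ (mirror x)) = fun x => pd (mirror e) φ (mirror x) :=
    funext fun x => pd_comp_mirror h.differentiable e x
  rw [this, pd_comp_mirror (h.pd _).differentiable]

theorem laplacian_comp_mirror {φ : Space m → ℝ} (h : IsTest φ) (x : Space m) :
    Δ (fun x => φ (mirror x)) x = Δ φ (mirror x) := by
  rw [laplacian_eq_tl_add h.comp_mirror.smooth, laplacian_eq_tl_add h.smooth, tl, tl,
    pd_pd_comp_mirror h, mirror_en]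
  congr 1
  · refine Finset.sum_congr rfl fun i _ => ?_
    rw [pd_pd_comp_mirror h, mirror_of_thin (bv_castSucc_last i)]
  · have hneg : ∀ ψ : Space m → ℝ, pd (-en) ψ = fun x => -pd en ψ x := fun ψ =>
      funext fun x => by simp [pd]
    rw [hneg φ, hneg]
    simp only [pd, fderiv_fun_neg, _root_.neg_apply, neg_neg]
    rfl

theorem continuous_mirror : Continuous (mirror : Space m → Space m) :=
  LinearIsometryEquiv.continuous _

variable {q : Space m → ℝ} {μ : Measure (Space m)} {lam : ℝ}

/-- Reflection commutes with the Laplacian and fixes the thin space, which carries μ. So the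
reflected function has the same measure. -/
theorem HasNegLaplacian.evenPart (hμ : HasNegLaplacian q μ) (hc : Continuous q)
    (hthin : ∀ᵐ x ∂μ, x (Fin.last m) = 0) : HasNegLaplacian (evenPart q) μ := by
  intro φ hφ1 hφ2
  have hφ : IsTest φ := ⟨hφ1, hφ2⟩
  have h1 := hμ.apply_test hφ
  have h2 := hμ.apply_test hφ.comp_mirror
  have h3 : ∫ x, φ (mirror x) ∂μ = ∫ x, φ x ∂μ := integral_congr_ae (by
    filter_upwards [hthin] with x hx
    rw [mirror_of_thin hx])
  have h4 := integral_mirror fun x => q x * Δ (fun x => φ (mirror x)) x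
  simp only [laplacian_comp_mirror hφ, mirror_mirror] at h4 h2
  have h5 : ∀ x, _root_.evenPart q x * Δ φ x =
      1 / 2 * (q x * Δ φ x + q (mirror x) * Δ φ x) := fun x => by
    rw [_root_.evenPart]
    ring
  have hcm : Continuous fun x => q (mirror x) := hc.comp continuous_mirror
  simp only [h5]
  rw [integral_const_mul, integral_add ((LocBdd.of_continuous hc).integrable_mul hφ.laplacian)
    ((LocBdd.of_continuous hcm).integrable_mul hφ.laplacian), h1, h4, h2, h3]
  ring

theorem IsHomogeneousOfDegree.evenPart (h : IsHomogeneousOfDegree q lam) :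
    IsHomogeneousOfDegree (evenPart q) lam := fun r hr x => by
  rw [_root_.evenPart, _root_.evenPart, map_smul, h r hr, h r hr]
  ring

theorem continuous_evenPart (hc : Continuous q) : Continuous (evenPart q) :=
  (hc.add (hc.comp continuous_mirror)).div_const 2

theorem IsConvexAlongThin.evenPart (h : IsConvexAlongThin q) : IsConvexAlongThin (evenPart q) := by
  intro x e he
  have h1 := ((h x e he).add (h (mirror x) e he)).smul (show (0 : ℝ) ≤ 1 / 2 by norm_num)
  refine h1.congr fun t _ => ?_
  simp only [_root_.evenPart, mirror_add_smul he, Pi.add_apply, smul_eq_mul]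
  ring

theorem evenPart_of_thin {x : Space m} (hx : x (Fin.last m) = 0) : evenPart q x = q x := by
  rw [evenPart, mirror_of_thin hx]
  ring

theorem isEvenSolution_evenPart (hc : Continuous q) (hμ : HasNegLaplacian q μ)
    (hthin : ∀ᵐ x ∂μ, x (Fin.last m) = 0) (hzero : ∀ᵐ x ∂μ, q x = 0)
    (hnonneg : ∀ x : Space m, x (Fin.last m) = 0 → 0 ≤ q x) (hconv : IsConvexAlongThin q)
    (hhom : IsHomogeneousOfDegree q lam) (hpos : 0 < lam)
    (hnt : ∃ φ : Space m → ℝ, IsTest φ ∧ (∀ x, 0 ≤ φ x) ∧ ∫ x, φ x ∂μ ≠ 0) :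
    IsEvenSolution (evenPart q) μ lam where
  continuous := continuous_evenPart hc
  even x := by rw [evenPart, evenPart, mirror_mirror, add_comm]
  laplacian := hμ.evenPart hc hthin
  thin := hthin
  zero := by
    filter_upwards [hthin, hzero] with x h1 h2
    rw [evenPart_of_thin h1, h2]
  nonneg x hx := by
    rw [evenPart_of_thin hx]
    exact hnonneg x hx
  convex := hconv.evenPart
  homogeneous := hhom.evenPart
  degree_pos := hpos
  nontrivial := hnt

/-- The odd part is weakly harmonic since the measures cancel, hence smooth, hence linear by
homogeneity. It vanishes on the thin space, so only the coefficient of x_n survives. -/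
theorem exists_eq_add_evenPart (hc : Continuous q) (hμ : HasNegLaplacian q μ)
    (hthin : ∀ᵐ x ∂μ, x (Fin.last m) = 0) (hhom : IsHomogeneousOfDegree q 1) :
    ∃ a : ℝ, ∀ x : Space m, q x = a * x (Fin.last m) + evenPart q x := by
  have hce := continuous_evenPart hc
  set f : Space m → ℝ := fun x => q x - evenPart q x with hf
  have hweak : ∀ φ : Space m → ℝ, IsTest φ → ∫ x, f x * Δ φ x = 0 := fun φ hφ => by
    simp only [hf, sub_mul]
    rw [integral_sub ((LocBdd.of_continuous hc).integrable_mul hφ.laplacian)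
      ((LocBdd.of_continuous hce).integrable_mul hφ.laplacian), hμ.apply_test hφ,
      (hμ.evenPart hc hthin).apply_test hφ, sub_self]
  have hfhom : IsHomogeneousOfDegree f 1 := fun r hr x => by
    simp only [hf]
    rw [hhom r hr, hhom.evenPart r hr]
    ring
  obtain ⟨c, hfc⟩ := linear_of_homogeneous_one hfhom (weyl_contDiff (hc.sub hce) hweak)
  have hci : ∀ i : Fin m, c i.castSucc = 0 := fun i => by
    have h1 := hfc (bv i.castSucc)
    simp only [hf, evenPart_of_thin (bv_castSucc_last i), sub_self, bv_apply, ite_mul, one_mul,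
      zero_mul, Finset.sum_ite_eq', Finset.mem_univ, if_true] at h1
    exact h1.symm
  refine ⟨c (Fin.last m), fun x => ?_⟩
  have h1 := hfc x
  simp only [Fin.sum_univ_castSucc, hci, mul_zero, Finset.sum_const_zero, zero_add, hf] at h1
  linarith

end EvenPart

/-! ### The classification theorem -/

theorem mainTheorem8 (m : ℕ) (lam : ℝ) (q : Space m → ℝ)
    (hq : IsSignoriniSolution q)
    (hne : ∃ x, q x ≠ 0)
    (hhom : IsHomogeneousOfDegree q lam)
    (hconv : IsConvexAlongThin q) :
    lam = 3 / 2 ∨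
      (IsHarmonicPolynomial q ∧ ∃ k : ℤ, lam = k) ∨
      (lam = 1 ∧ ∃ a b : ℝ, 0 < b ∧
        ∀ x : Space m, q x = a * x (Fin.last m) - b * |x (Fin.last m)|) := by
  have hc := hq.continuous
  rcases lt_trichotomy lam 0 with hlam | rfl | hlam
  · obtain ⟨x, hx⟩ := hne
    exact absurd (hhom.eq_zero_of_neg hc hlam x) hx
  · refine Or.inr (Or.inl ⟨⟨⟨MvPolynomial.C (q 0), fun x => ?_⟩, ?_⟩, 0, by simp⟩)
    · rw [MvPolynomial.eval_C, hhom.eq_const hc x]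
    · rw [show q = fun _ => q 0 from funext (hhom.eq_const hc)]
      exact InnerProductSpace.harmonicOnNhd_const _
  · obtain ⟨μ, hfin, hμ, hzero, hthin⟩ := hq.laplacian
    have hthin' : ∀ᵐ x ∂μ, x (Fin.last m) = 0 := ae_iff.2 hthin
    -- Either μ is seen by some nonnegative test function and the even part is classified, or it
    -- pairs to zero with every test function and `q` is weakly harmonic.
    by_cases hnt : ∃ φ : Space m → ℝ, IsTest φ ∧ (∀ x, 0 ≤ φ x) ∧ ∫ x, φ x ∂μ ≠ 0
    · rcases (isEvenSolution_evenPart hc hμ hthin' hzero hq.nonneg_on_thin hconv hhom hlam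
        hnt).degree with h1 | ⟨rfl, b, hb, h1⟩
      · exact Or.inl h1
      · obtain ⟨a, ha⟩ := exists_eq_add_evenPart hc hμ hthin' hhom
        refine Or.inr (Or.inr ⟨rfl, a, b, hb, fun x => ?_⟩)
        rw [ha, h1]
        ring
    · push Not at hnt
      refine Or.inr (Or.inl (isHarmonicPolynomial_of_weakHarmonic hc (fun φ hφ => ?_) hhom hne))
      rw [hμ.apply_test hφ, integral_eq_zero_of_nonneg_tests hnt hφ, neg_zero]
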